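/- Let $n\ge 1$, let $\mathbb{B}_n$ be the open unit ball of $\mathbb{C}^n$, let $v$ be Lebesgue measure on $\mathbb{B}_n$ normalized by $v(\mathbb{B}_n)=1$, and let $d\lambda(z)=(1-|z|^2)^{-(n+1)}\,dv(z)$. For $1<p<\infty$ let $A^p$ be the space of holomorphic functions in $L^p(\mathbb{B}_n,dv)$ with the $L^p$ norm, let $\frac1p+\frac1{p'}=1$, and let $\langle f,g\rangle_{A^2}=\int_{\mathbb{B}_n} f\overline{g}\,dv$ for $f\in A^p$, $g\in A^{p'}$. Put $\bar z w=\sum_i \overline{z_i}w_i$ and $$K_z(w)=\frac{1}{(1-\bar z w)^{n+1}},\qquad k_z(w)=\frac{(1-|z|^2)^{\frac{n+1}{2}}}{(1-\bar z w)^{n+1}},\qquad k_z^{(p)}=\frac{K_z}{\|K_z\|_{A^2}^{2/p'}},\qquad k_z^{(p')}=\frac{K_z}{\|K_z\|_{A^2}^{2/p}}.$$ Let $\varphi_z$ be the Möbius involution of $\mathbb{B}_n$ interchanging $0$ and $z$, and put $\rho(z,w)=|\varphi_z(w)|$, $\beta(z,w)=\frac12\log\frac{1+\rho(z,w)}{1-\rho(z,w)}$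 and $D(z,r)=\{w\in\mathbb{B}_n:\beta(z,w)\le r\}$. A bounded operator $S$ on $A^p$ is called $p$ weakly localized, $S\in\mathcal{A}_p(\mathbb{B}_n)$, if, with $\langle S^*k_z,k_w\rangle_{A^2}:=\langle k_z,Sk_w\rangle_{A^2}$: (i) there is $0<\delta<\min\{p,p'\}$ such that $$\sup_{z}\int_{\mathbb{B}_n}|\langle Sk_z,k_w\rangle_{A^2}|\frac{\|K_z\|_{A^2}^{1-\frac{2\delta}{p'(n+1)}}}{\|K_w\|_{A^2}^{1-\frac{2\delta}{p'(n+1)}}}\,d\lambda(w)<\infty,\qquad \sup_{z}\int_{\mathbb{B}_n}|\langle S^*k_z,k_w\rangle_{A^2}|\frac{\|K_z\|_{A^2}^{1-\frac{2\delta}{p(n+1)}}}{\|K_w\|_{A^2}^{1-\frac{2\delta}{p(n+1)}}}\,d\lambda(w)<\infty;$$ (ii) there is $0<\delta<\min\{p,p'\}$ such that, as $r\to\infty$, $$\sup_{z}\int_{D(z,r)^c}|\langle Sk_z,k_w\rangle_{A^2}|\frac{\|K_z\|_{A^2}^{1-\frac{2\delta}{p'(n+1)}}}{\|K_w\|_{A^2}^{1-\frac{2\delta}{p'(n+1)}}}\,d\lambda(w)\to0,\qquad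 \sup_{z}\int_{D(z,r)^c}|\langle S^*k_z,k_w\rangle_{A^2}|\frac{\|K_z\|_{A^2}^{1-\frac{2\delta}{p(n+1)}}}{\|K_w\|_{A^2}^{1-\frac{2\delta}{p(n+1)}}}\,d\lambda(w)\to0.$$ **Theorem.** Let $1<p<\infty$ and let $T$ be a bounded operator on $A^p$ that belongs to the operator-norm closure of $\mathcal{A}_p(\mathbb{B}_n)$. Then there are $r,C>0$ (both depending on $T$) such that $$\|T\|_{\mathrm e}\le C\limsup_{|z|\to1^-}\ \sup_{w\in D(z,r)}\bigl|\langle Tk_z^{(p)},k_w^{(p')}\rangle_{A^2}\bigr|,$$ where $\|T\|_{\mathrm e}=\inf\{\|T-K\|: K \text{ a compact operator on } A^p\}$ is the essential norm of $T$ on $A^p$. -/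

import Mathlib

open MeasureTheory Filter Topology
open scoped ENNReal ComplexConjugate

namespace BergmanBall

noncomputable section

/-- The open unit ball of `ℂⁿ` (with its Euclidean norm), as a type. -/
abbrev CBall (n : ℕ) : Type := Metric.ball (0 : EuclideanSpace ℂ (Fin n)) 1

/-- Lebesgue measure on the unit ball, normalized to total mass `1`. -/
def ballMeasure (n : ℕ) : Measure (CBall n) :=
  (volume (Metric.ball (0 : EuclideanSpace ℂ (Fin n)) 1))⁻¹ •
    (volume : Measure (EuclideanSpace ℂ (Fin n))).comap Subtype.val

instance (n : ℕ) : IsProbabilityMeasure (ballMeasure n) := by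
  refine ⟨?_⟩
  rw [ballMeasure, Measure.smul_apply, smul_eq_mul,
    comap_subtype_coe_apply Metric.isOpen_ball.measurableSet, Set.image_univ, Subtype.range_coe]
  exact ENNReal.inv_mul_cancel (Metric.measure_ball_pos volume _ one_pos).ne'
    measure_ball_lt_top.ne

/-- The invariant measure `dλ(z) = (1 - |z|²)^{-(n+1)} dv(z)`. -/
def invMeasure (n : ℕ) : Measure (CBall n) :=
  (ballMeasure n).withDensity fun z =>
    ENNReal.ofReal ((1 - ‖(z : EuclideanSpace ℂ (Fin n))‖ ^ 2) ^ (n + 1))⁻¹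

/-- The Bergman space `A^p`: the classes in `L^p(𝔹, dv)` with a holomorphic representative,
normed by the `L^p` norm. -/
def Bergman (n : ℕ) (p : ℝ≥0∞) : Submodule ℂ (Lp ℂ p (ballMeasure n)) where
  carrier := {f | ∃ g : EuclideanSpace ℂ (Fin n) → ℂ,
    DifferentiableOn ℂ g (Metric.ball 0 1) ∧ f =ᵐ[ballMeasure n] fun z => g z}
  add_mem' := by
    rintro f₁ f₂ ⟨g₁, hg₁, h₁⟩ ⟨g₂, hg₂, h₂⟩
    refine ⟨g₁ + g₂, hg₁.add hg₂, ?_⟩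
    filter_upwards [Lp.coeFn_add f₁ f₂, h₁, h₂] with z hz h1 h2
    exact hz.trans (by simp [h1, h2])
  zero_mem' := by
    refine ⟨0, differentiableOn_const 0, ?_⟩
    filter_upwards [Lp.coeFn_zero ℂ p (ballMeasure n)] with z hz
    exact hz.trans (by simp)
  smul_mem' := by
    rintro c f ⟨g, hg, h⟩
    refine ⟨c • g, hg.const_smul c, ?_⟩
    filter_upwards [Lp.coeFn_smul c f, h] with z hz h1
    exact hz.trans (by simp [h1])

/-- The kernel function `K_z(w) = (1 - z̄ w)^{-(n+1)}`, where `z̄ w = ∑ conj(z_i) w_i`. -/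
def kernelFun {n : ℕ} (z : CBall n) (w : EuclideanSpace ℂ (Fin n)) : ℂ :=
  ((1 - inner ℂ (z : EuclideanSpace ℂ (Fin n)) w) ^ (n + 1))⁻¹

lemma le_norm_one_sub_inner {n : ℕ} (z : CBall n) {w : EuclideanSpace ℂ (Fin n)}
    (hw : w ∈ Metric.ball (0 : EuclideanSpace ℂ (Fin n)) 1) :
    1 - ‖(z : EuclideanSpace ℂ (Fin n))‖
      ≤ ‖1 - inner ℂ (z : EuclideanSpace ℂ (Fin n)) w‖ := by
  have hw' : ‖w‖ ≤ 1 := (mem_ball_zero_iff.1 hw).le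
  have h1 : ‖inner ℂ (z : EuclideanSpace ℂ (Fin n)) w‖ ≤ ‖(z : EuclideanSpace ℂ (Fin n))‖ :=
    (norm_inner_le_norm _ _).trans (mul_le_of_le_one_right (norm_nonneg _) hw')
  have h2 := norm_sub_norm_le (1 : ℂ) (inner ℂ (z : EuclideanSpace ℂ (Fin n)) w)
  rw [norm_one] at h2
  linarith

lemma one_sub_norm_pos {n : ℕ} (z : CBall n) : 0 < 1 - ‖(z : EuclideanSpace ℂ (Fin n))‖ :=
  sub_pos.2 (mem_ball_zero_iff.1 z.2)

lemma differentiableOn_kernelFun {n : ℕ} (z : CBall n) :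
    DifferentiableOn ℂ (kernelFun z) (Metric.ball 0 1) := by
  unfold kernelFun
  refine DifferentiableOn.inv ?_ ?_
  · exact (((differentiable_const (1 : ℂ)).sub
      (innerSL ℂ (z : EuclideanSpace ℂ (Fin n))).differentiable).pow (n + 1)).differentiableOn
  · intro w hw
    exact pow_ne_zero _ (norm_pos_iff.1 ((one_sub_norm_pos z).trans_le
      (le_norm_one_sub_inner z hw)))

lemma memLp_kernelFun {n : ℕ} (p : ℝ≥0∞) (z : CBall n) :
    MemLp (fun w : CBall n => kernelFun z w) p (ballMeasure n) := by
  refine MemLp.of_bound (C := ((1 - ‖(z : EuclideanSpace ℂ (Fin n))‖) ^ (n + 1))⁻¹) ?_ ?_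
  · exact (continuousOn_iff_continuous_domRestrict.1
      (differentiableOn_kernelFun z).continuousOn).aestronglyMeasurable
  · refine Eventually.of_forall fun w => ?_
    rw [kernelFun, norm_inv, norm_pow]
    have := one_sub_norm_pos z
    have := le_norm_one_sub_inner z w.2
    gcongr

/-- The reproducing kernel `K_z` as an element of `A^p`. -/
def kernel (n : ℕ) (p : ℝ≥0∞) (z : CBall n) : Bergman n p :=
  ⟨(memLp_kernelFun p z).toLp _, kernelFun z, differentiableOn_kernelFun z,
    (memLp_kernelFun p z).coeFn_toLp⟩

/-- The norm `‖K_z‖_{A²}`. -/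
def kernelNorm {n : ℕ} (z : CBall n) : ℝ := ‖kernel n 2 z‖

/-- The normalized reproducing kernel `k_z(w) = (1 - |z|²)^{(n+1)/2} / (1 - z̄ w)^{n+1}`,
as an element of `A^p`. -/
def normKernel (n : ℕ) (p : ℝ≥0∞) (z : CBall n) : Bergman n p :=
  ((((1 - ‖(z : EuclideanSpace ℂ (Fin n))‖ ^ 2) ^ (((n : ℝ) + 1) / 2) : ℝ)) : ℂ) • kernel n p z

/-- The `p`-normalized reproducing kernel `k_z^{(p)} = K_z / ‖K_z‖_{A²}^{2/p'}`, where `p'` is the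
exponent conjugate to `p`. -/
def pNormKernel (n : ℕ) (p p' : ℝ≥0∞) (z : CBall n) : Bergman n p :=
  (((kernelNorm z ^ (2 / p'.toReal) : ℝ) : ℂ))⁻¹ • kernel n p z

/-- The pairing `⟨f, g⟩_{A²} = ∫ f ḡ dv` of `f ∈ A^p` with `g ∈ A^{p'}`. -/
def pairing {n : ℕ} {p p' : ℝ≥0∞} (f : Bergman n p) (g : Bergman n p') : ℂ :=
  ∫ z, (f : Lp ℂ p (ballMeasure n)) z * conj ((g : Lp ℂ p' (ballMeasure n)) z) ∂(ballMeasure n)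

/-- The Möbius involution `φ_z` of the ball that interchanges `0` and `z`:
`φ_z(w) = (z - P_z w - √(1 - |z|²) (w - P_z w)) / (1 - z̄ w)`, with `P_z` the orthogonal projection
onto the line spanned by `z`. -/
def mobius {n : ℕ} (z w : CBall n) : EuclideanSpace ℂ (Fin n) :=
  (1 - inner ℂ (z : EuclideanSpace ℂ (Fin n)) (w : EuclideanSpace ℂ (Fin n)))⁻¹ •
    ((z : EuclideanSpace ℂ (Fin n)) - (ℂ ∙ (z : EuclideanSpace ℂ (Fin n))).starProjection w
      - ((Real.sqrt (1 - ‖(z : EuclideanSpace ℂ (Fin n))‖ ^ 2) : ℝ) : ℂ) •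
        ((w : EuclideanSpace ℂ (Fin n))
          - (ℂ ∙ (z : EuclideanSpace ℂ (Fin n))).starProjection w))

/-- The pseudohyperbolic metric `ρ`. -/
def pseudoDist {n : ℕ} (z w : CBall n) : ℝ := ‖mobius z w‖

/-- The Bergman (hyperbolic) metric `β`. -/
def bergmanDist {n : ℕ} (z w : CBall n) : ℝ :=
  1 / 2 * Real.log ((1 + pseudoDist z w) / (1 - pseudoDist z w))

/-- The hyperbolic ball `D(z, r)`. -/
def hypBall {n : ℕ} (z : CBall n) (r : ℝ) : Set (CBall n) := {w | bergmanDist z w ≤ r}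

/-- The integrand `|⟨T k_z, k_w⟩| ‖K_z‖^a / ‖K_w‖^a`, with `a = 1 - 2δ / (p'(n+1))`. -/
def locKernel {n : ℕ} {p : ℝ≥0∞} [Fact (1 ≤ p)] (p' : ℝ≥0∞) (T : Bergman n p →L[ℂ] Bergman n p)
    (δ : ℝ) (z w : CBall n) : ℝ≥0∞ :=
  ENNReal.ofReal (‖pairing (T (normKernel n p z)) (normKernel n p' w)‖ *
    (kernelNorm z ^ (1 - 2 * δ / (p'.toReal * (n + 1))) /
      kernelNorm w ^ (1 - 2 * δ / (p'.toReal * (n + 1)))))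

/-- The integrand `|⟨T* k_z, k_w⟩| ‖K_z‖^a / ‖K_w‖^a`, with `a = 1 - 2δ / (p(n+1))`. Here
`⟨T* k_z, k_w⟩` is `⟨k_z, T k_w⟩`, by the definition of the adjoint for the `A²` pairing between
`A^p` and `A^{p'}`. -/
def locKernelAdj {n : ℕ} {p : ℝ≥0∞} [Fact (1 ≤ p)] (p' : ℝ≥0∞)
    (T : Bergman n p →L[ℂ] Bergman n p) (δ : ℝ) (z w : CBall n) : ℝ≥0∞ :=
  ENNReal.ofReal (‖pairing (normKernel n p' z) (T (normKernel n p w))‖ *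
    (kernelNorm z ^ (1 - 2 * δ / (p.toReal * (n + 1))) /
      kernelNorm w ^ (1 - 2 * δ / (p.toReal * (n + 1)))))

/-- `T` is `p` weakly localized. -/
structure WeaklyLocalized {n : ℕ} {p : ℝ≥0∞} [Fact (1 ≤ p)] (p' : ℝ≥0∞)
    (T : Bergman n p →L[ℂ] Bergman n p) : Prop where
  bounded : ∃ δ : ℝ, 0 < δ ∧ δ < min p.toReal p'.toReal ∧
    (⨆ z : CBall n, ∫⁻ w, locKernel p' T δ z w ∂(invMeasure n)) < ∞ ∧
    (⨆ z : CBall n, ∫⁻ w, locKernelAdj p' T δ z w ∂(invMeasure n)) < ∞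
  decay : ∃ δ : ℝ, 0 < δ ∧ δ < min p.toReal p'.toReal ∧
    Tendsto (fun r : ℝ => ⨆ z : CBall n,
      ∫⁻ w in (hypBall z r)ᶜ, locKernel p' T δ z w ∂(invMeasure n)) atTop (𝓝 0) ∧
    Tendsto (fun r : ℝ => ⨆ z : CBall n,
      ∫⁻ w in (hypBall z r)ᶜ, locKernelAdj p' T δ z w ∂(invMeasure n)) atTop (𝓝 0)

/-- The essential norm: the distance in operator norm to the compact operators. -/
def essNorm {E : Type*} [NormedAddCommGroup E] [NormedSpace ℂ E] (T : E →L[ℂ] E) : ℝ :=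
  ⨅ K : {K : E →L[ℂ] E // IsCompactOperator K}, ‖T - K‖

end

end BergmanBall

/-! Write P for the Bergman projection, `bergmanIntegral`. Since f = Pf and f ↦ P(1_{1-|z|² ≥ σ} f)
is compact (`exists_compact_core`), the essential norm of T is controlled by the size of T on
functions Pφ with φ supported in the rim 1-|z|² < σ (`ofReal_essNorm_le`). The bound needed there is
‖TPφ‖ ≤ (Dε + Kη)‖φ‖_p, where η bounds the local suprema over the rim and D depends on n and p only
(`exists_enorm_apply_le`).

To obtain it, take a weakly localized S with ‖T - S‖ < ε. By the decay condition and a Schur test,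
the integral kernel of S outside {cosh² β ≤ c} has norm at most ε for some c
(`WeaklyLocalized.exists_far_le`). Cover the ball by sets E_i and let G_i contain every point that
is c-near E_i. On E_i, TPφ = (T-S)Pφ + SP(1_{G_i^c} φ) + (S-T)P(1_{G_i} φ) + TP(1_{G_i} φ). The
first term is small because T - S is. The second sees only the far kernel of S. The third has no
usable kernel bound, but its p-th powers can be summed over i, at the cost of the overlap of the
G_i. The last sees the kernel of T near the diagonal and near the sphere, where the local suprema
bound it; a Schur test with a constant K depending on c finishes it.

The decisive point is that the overlap of the G_i does not depend on c, which itself depends on ε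
(`exists_cover`): hence D is fixed before ε. Choosing ε a small multiple of the essential norm lets
Dε be absorbed on the left.

Besides the covering, the analytic input is the reproducing formula (Möbius change of variables and
the mean value property) and the L^p boundedness of the projection with |K_z(w)| as kernel (the
Forelli–Rudin estimate `exists_forelliRudin` and the Schur test `lintegral_schur`). -/

namespace BergmanBall

/-! ### Korányi quasi-distance and packing in anisotropic coordinates -/

section Koranyi

variable {E : Type*} [NormedAddCommGroup E] [InnerProductSpace ℂ E]

/-- The Korányi quasi-distance `|1 - ⟨z, w⟩|^{1/2}` on the closed unit ball. -/
noncomputable def korDist (z w : E) : ℝ := √‖1 - inner ℂ z w‖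

lemma korDist_nonneg (z w : E) : 0 ≤ korDist z w := Real.sqrt_nonneg _

lemma korDist_sq (z w : E) : korDist z w ^ 2 = ‖1 - inner ℂ z w‖ :=
  Real.sq_sqrt (norm_nonneg _)

lemma norm_one_sub_inner_comm (z w : E) : ‖1 - inner ℂ z w‖ = ‖1 - inner ℂ w z‖ := by
  rw [← inner_conj_symm, ← RCLike.norm_conj]
  simp

lemma korDist_comm (z w : E) : korDist z w = korDist w z := by
  rw [korDist, norm_one_sub_inner_comm, korDist]

lemma continuous_korDist : Continuous fun x : E × E => korDist x.1 x.2 := by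
  unfold korDist; fun_prop

lemma korDist_self {z : E} (hz : ‖z‖ ≤ 1) : korDist z z ^ 2 = 1 - ‖z‖ ^ 2 := by
  rw [korDist_sq, inner_self_eq_norm_sq_to_K]
  have : (0 : ℝ) ≤ 1 - ‖z‖ ^ 2 := by nlinarith [norm_nonneg z]
  have h : (1 - ((‖z‖ : ℝ) : ℂ) ^ 2) = ((1 - ‖z‖ ^ 2 : ℝ) : ℂ) := by push_cast; ring
  erw [h]
  rw [Complex.norm_real, Real.norm_of_nonneg this]

lemma norm_inner_le_one {z w : E} (hz : ‖z‖ ≤ 1) (hw : ‖w‖ ≤ 1) : ‖inner ℂ z w‖ ≤ 1 :=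
  (norm_inner_le_norm z w).trans (mul_le_one₀ hz (norm_nonneg _) hw)

lemma one_sub_norm_sq_le {x : ℂ} (hx : ‖x‖ ≤ 1) : 1 - ‖x‖ ^ 2 ≤ 2 * ‖1 - x‖ := by
  have h := norm_sub_norm_le (1 : ℂ) x
  rw [norm_one] at h
  nlinarith [norm_nonneg x]

/-- The square of the norm of `(I - u u*)^{1/2} z`. -/
lemma exists_sqrt_one_sub_rankOne {u : E} (hu : ‖u‖ ≤ 1) :
    ∃ c : ℂ, ∀ z w : E, inner ℂ (z - (c * inner ℂ u z) • u) (w - (c * inner ℂ u w) • u)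
      = inner ℂ z w - inner ℂ z u * inner ℂ u w := by
  set s : ℝ := √(1 - ‖u‖ ^ 2) with hs
  have hs2 : s ^ 2 = 1 - ‖u‖ ^ 2 := Real.sq_sqrt (by nlinarith [norm_nonneg u])
  have hs0 : 0 ≤ s := Real.sqrt_nonneg _
  -- On the line of u the root must act as s, and 1 - |u|²/(1 + s) = s. This form of the coefficient
  -- needs no division by |u|².
  refine ⟨((1 + s)⁻¹ : ℝ), fun z w => ?_⟩
  have hu2 : inner ℂ u u = ((1 - s ^ 2 : ℝ) : ℂ) := by
    rw [inner_self_eq_norm_sq_to_K, hs2]; push_cast; simp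
  have h1 : ((1 : ℂ) + (s : ℂ)) ≠ 0 := by
    exact_mod_cast (by positivity : (1 + s) ≠ 0)
  simp only [inner_sub_left, inner_sub_right, inner_smul_left, inner_smul_right, hu2, map_mul,
    Complex.conj_ofReal, inner_conj_symm]
  push_cast
  field_simp
  ring

/-- Expand 1 - ⟨z,w⟩ = (1 - ⟨z,u⟩) + ⟨z,u⟩(1 - ⟨u,w⟩) - (⟨z,w⟩ - ⟨z,u⟩⟨u,w⟩). The last bracket is
the inner product of the images of z and w under (I - uu*)^{1/2}, and those have squared norm |x|² -
|⟨x,u⟩|² ≤ 2|1 - ⟨x,u⟩|. Cauchy–Schwarz then yields exactly the cross term of the square. -/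
lemma norm_one_sub_inner_triangle {z u w : E} (hz : ‖z‖ ≤ 1) (hu : ‖u‖ ≤ 1) (hw : ‖w‖ ≤ 1) :
    ‖1 - inner ℂ z w‖ ≤ (korDist z u + korDist u w) ^ 2 := by
  obtain ⟨c, hc⟩ := exists_sqrt_one_sub_rankOne hu
  have key : ∀ x : E, ‖x‖ ≤ 1 → ‖x - (c * inner ℂ u x) • u‖ ^ 2 ≤ 2 * korDist x u ^ 2 := by
    intro x hx
    have h1 : ((‖x - (c * inner ℂ u x) • u‖ ^ 2 : ℝ) : ℂ)
        = ((‖x‖ ^ 2 - ‖inner ℂ x u‖ ^ 2 : ℝ) : ℂ) := by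
      have := hc x x
      rw [inner_self_eq_norm_sq_to_K, inner_self_eq_norm_sq_to_K, ← inner_conj_symm u x,
        RCLike.mul_conj, inner_conj_symm] at this
      push_cast
      exact this
    rw [Complex.ofReal_inj.1 h1, korDist_sq]
    have := one_sub_norm_sq_le (norm_inner_le_one hx hu)
    nlinarith [norm_nonneg x]
  have h2 : ‖inner ℂ z w - inner ℂ z u * inner ℂ u w‖ ≤ 2 * (korDist z u * korDist u w) := by
    rw [← hc]
    refine (norm_inner_le_norm _ _).trans (abs_le_of_sq_le_sq ?_ ?_ |> (le_abs_self _).trans)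
    · rw [mul_pow]
      calc _ ≤ (2 * korDist z u ^ 2) * (2 * korDist w u ^ 2) := by
            gcongr <;> apply key <;> assumption
        _ = _ := by rw [korDist_comm w u]; ring
    · have := korDist_nonneg z u; have := korDist_nonneg u w; positivity
  have h3 : 1 - inner ℂ z w = (1 - inner ℂ z u) + inner ℂ z u * (1 - inner ℂ u w)
      - (inner ℂ z w - inner ℂ z u * inner ℂ u w) := by ring
  rw [h3]
  calc _ ≤ ‖1 - inner ℂ z u‖ + ‖inner ℂ z u‖ * ‖1 - inner ℂ u w‖
        + ‖inner ℂ z w - inner ℂ z u * inner ℂ u w‖ := by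
        refine (norm_sub_le _ _).trans ?_
        gcongr
        refine (norm_add_le _ _).trans ?_
        rw [norm_mul]
    _ ≤ ‖1 - inner ℂ z u‖ + 1 * ‖1 - inner ℂ u w‖ + 2 * (korDist z u * korDist u w) := by
        gcongr
        exact norm_inner_le_one hz hu
    _ = _ := by rw [← korDist_sq, ← korDist_sq]; ring

/-- The triangle inequality for the Korányi quasi-distance. -/
lemma korDist_triangle {z u w : E} (hz : ‖z‖ ≤ 1) (hu : ‖u‖ ≤ 1) (hw : ‖w‖ ≤ 1) :
    korDist z w ≤ korDist z u + korDist u w := by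
  rw [korDist]
  exact Real.sqrt_le_iff.2 ⟨add_nonneg (korDist_nonneg _ _) (korDist_nonneg _ _),
    norm_one_sub_inner_triangle hz hu hw⟩

/-- The rescaled coordinates of `z` in the Korányi ball of radius `s` about `ζ`. -/
noncomputable def korCoord (s : ℝ) (ζ z : E) : ℂ × E :=
  ((s ^ 2 : ℝ)⁻¹ • (1 - inner ℂ ζ z), (s⁻¹ : ℝ) • (z - inner ℂ ζ z • ζ))

/-- At Korányi distance d from ζ, the quantity 1 - ⟨ζ,z⟩ has size d² but the component off the line
of ζ only has size d. Hence the scales s² and s in `korCoord`. -/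
lemma norm_sub_inner_smul_sq_le {ζ z : E} (hζ : ‖ζ‖ ≤ 1) (hz : ‖z‖ ≤ 1) :
    ‖z - inner ℂ ζ z • ζ‖ ^ 2 ≤ 2 * korDist z ζ ^ 2 := by
  have h1 : ‖z - inner ℂ ζ z • ζ‖ ^ 2
      = ‖z‖ ^ 2 - 2 * ‖inner ℂ ζ z‖ ^ 2 + ‖inner ℂ ζ z‖ ^ 2 * ‖ζ‖ ^ 2 := by
    rw [@norm_sub_sq ℂ, inner_smul_right, ← inner_conj_symm z ζ, RCLike.mul_conj, norm_smul]
    have : RCLike.re (((‖inner ℂ ζ z‖ : ℝ) : ℂ) ^ 2) = ‖inner ℂ ζ z‖ ^ 2 := by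
      rw [← Complex.ofReal_pow]; exact Complex.ofReal_re _
    erw [this]; ring
  have h2 := one_sub_norm_sq_le (norm_inner_le_one hζ hz)
  rw [h1, korDist_comm, korDist_sq]
  nlinarith [norm_nonneg z, norm_nonneg ζ, sq_nonneg ‖inner ℂ ζ z‖,
    mul_nonneg (sq_nonneg ‖inner ℂ ζ z‖) (by nlinarith [norm_nonneg ζ] : 0 ≤ 1 - ‖ζ‖ ^ 2)]

lemma norm_korCoord_le {s : ℝ} (hs : 0 < s) {ζ z : E} (hζ : ‖ζ‖ ≤ 1) (hz : ‖z‖ ≤ 1)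
    (h : korDist z ζ ≤ 6 * s) : ‖korCoord s ζ z‖ ≤ 36 := by
  have hk := korDist_nonneg z ζ
  rw [korCoord, Prod.norm_def, max_le_iff]
  constructor
  · rw [norm_smul, norm_inv, Real.norm_of_nonneg (by positivity), norm_one_sub_inner_comm,
      ← korDist_sq, inv_mul_le_iff₀ (by positivity)]
    nlinarith
  · rw [norm_smul, norm_inv, Real.norm_of_nonneg hs.le, inv_mul_le_iff₀ hs]
    have := norm_sub_inner_smul_sq_le hζ hz
    refine abs_le_of_sq_le_sq ?_ (by positivity) |> (le_abs_self _).trans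
    nlinarith

/-- Points of a Korányi ball that are close in rescaled coordinates are close. -/
lemma korDist_lt_of_korCoord {s : ℝ} (hs : 0 < s) {ζ x y : E} (hζ : ‖ζ‖ ≤ 1)
    (hy : ‖y‖ ≤ 1) (hy6 : korDist y ζ ≤ 6 * s) (hys : 1 - ‖y‖ ^ 2 ≤ s ^ 2 / 20)
    (h : dist (korCoord s ζ x) (korCoord s ζ y) < 1 / 100) : korDist x y < s := by
  have h1 := norm_korCoord_le hs hζ hy hy6
  rw [dist_eq_norm, korCoord, korCoord, Prod.mk_sub_mk, Prod.norm_def, max_lt_iff] at h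
  obtain ⟨ha, hb⟩ := h
  simp only [← smul_sub, norm_smul, norm_inv] at ha hb
  rw [Real.norm_of_nonneg (by positivity), inv_mul_lt_iff₀ (by positivity)] at ha
  rw [Real.norm_of_nonneg hs.le, inv_mul_lt_iff₀ hs] at hb
  set v := x - inner ℂ ζ x • ζ - (y - inner ℂ ζ y • ζ) with hv
  set v' := y - inner ℂ ζ y • ζ with hv'
  have hv'n : ‖v'‖ ≤ 36 * s := by
    have := (le_max_right _ _).trans h1
    rw [korCoord, norm_smul, norm_inv, Real.norm_of_nonneg hs.le, inv_mul_le_iff₀ hs] at this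
    linarith
  set t := inner ℂ ζ x - inner ℂ ζ y with ht
  have htn : ‖t‖ ≤ s ^ 2 / 100 := by
    have : 1 - inner ℂ ζ x - (1 - inner ℂ ζ y) = -t := by rw [ht]; ring
    rw [this, norm_neg] at ha
    linarith
  have hvζ : ‖inner ℂ ζ v‖ ≤ s ^ 2 / 100 := by
    have e : inner ℂ ζ v = t * ((1 - ‖ζ‖ ^ 2 : ℝ) : ℂ) := by
      rw [hv]
      simp only [hv', inner_sub_right, inner_smul_right, inner_self_eq_norm_sq_to_K]
      push_cast; rw [ht]; simp; ring
    rw [e, norm_mul, Complex.norm_real, Real.norm_of_nonneg (by nlinarith [norm_nonneg ζ])]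
    nlinarith [norm_nonneg t, norm_nonneg ζ, sq_nonneg ‖ζ‖]
  have hxy : x - y = t • ζ + v := by rw [hv, hv', ht, sub_smul]; abel
  -- The four terms are at most s²/20 (y is near the sphere), s²/100 twice, and 36s · s/100 for the
  -- component off the line of ζ; the sum stays below s².
  have hdec : 1 - inner ℂ y x = (1 - inner ℂ y y) - inner ℂ y ζ * t
      - inner ℂ y ζ * inner ℂ ζ v - inner ℂ v' v := by
    have e1 : x = y + (t • ζ + v) := by rw [← hxy]; abel
    have e2 : inner ℂ y v = inner ℂ y ζ * inner ℂ ζ v + inner ℂ v' v := by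
      rw [hv', inner_sub_left, inner_smul_left, inner_conj_symm]; ring
    rw [e1, inner_add_right, inner_add_right, inner_smul_right, e2]; ring
  have hyζ := norm_inner_le_one hy hζ
  have h5 : ‖1 - inner ℂ y x‖ < s ^ 2 := by
    rw [hdec]
    calc _ ≤ ‖1 - inner ℂ y y‖ + ‖inner ℂ y ζ‖ * ‖t‖ + ‖inner ℂ y ζ‖ * ‖inner ℂ ζ v‖
          + ‖v'‖ * ‖v‖ := by
          refine (norm_sub_le _ _).trans (add_le_add ((norm_sub_le _ _).trans (add_le_add
            ((norm_sub_le _ _).trans_eq ?_) ?_)) (norm_inner_le_norm _ _))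
          · rw [norm_mul]
          · rw [norm_mul]
      _ ≤ s ^ 2 / 20 + 1 * (s ^ 2 / 100) + 1 * (s ^ 2 / 100) + (36 * s) * (s * (1 / 100)) := by
          gcongr
          rw [← korDist_sq, korDist_self hy]; exact hys
      _ < s ^ 2 := by nlinarith [sq_pos_of_pos hs]
  rw [korDist, Real.sqrt_lt' hs, norm_one_sub_inner_comm]
  exact h5

/-- A number, depending on the space only, that bounds the size of `s`-separated subsets, near the
sphere, of Korányi balls of radius `3 s`. -/
lemma exists_packing_bound (E : Type*) [NormedAddCommGroup E] [InnerProductSpace ℂ E]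
    [FiniteDimensional ℂ E] :
    ∃ N : ℕ, ∀ (s : ℝ), 0 < s → ∀ (z : E), ‖z‖ ≤ 1 → ∀ {ι : Type} (A : Finset ι) (x : ι → E),
      (∀ i ∈ A, ‖x i‖ ≤ 1 ∧ 1 - ‖x i‖ ^ 2 ≤ s ^ 2 / 20 ∧ korDist z (x i) ≤ 3 * s) →
      (∀ i ∈ A, ∀ j ∈ A, i ≠ j → s ≤ korDist (x i) (x j)) → A.card ≤ N := by
  have : ProperSpace E := FiniteDimensional.proper ℂ E
  -- After rescaling around one of the points, all of them lie in this fixed compact set, whatever s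
  -- is. Two points in the same ball of radius 1/200 would be closer than s, so choosing a centre
  -- for each point is injective.
  have hc : IsCompact (Metric.closedBall (0 : ℂ × E) 36) := isCompact_closedBall _ _
  obtain ⟨t, -, htfin, hcov⟩ := hc.finite_cover_balls (e := 1 / 200) (by norm_num)
  refine ⟨htfin.toFinset.card, fun s hs z hz ι A x hA hsep => ?_⟩
  rcases A.eq_empty_or_nonempty with rfl | ⟨i₀, hi₀⟩
  · simp
  have h6 : ∀ i ∈ A, korDist (x i) (x i₀) ≤ 6 * s := fun i hi => by
    have := korDist_triangle (hA i hi).1 hz (hA i₀ hi₀).1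
    rw [korDist_comm (x i) z] at this
    linarith [(hA i hi).2.2, (hA i₀ hi₀).2.2]
  have hex : ∀ i ∈ A, ∃ c ∈ t, dist (korCoord s (x i₀) (x i)) c < 1 / 200 := fun i hi => by
    have := hcov (mem_closedBall_zero_iff.2 (norm_korCoord_le hs (hA i₀ hi₀).1 (hA i hi).1
      (h6 i hi)))
    simpa using this
  choose! c hct hcd using hex
  refine Finset.card_le_card_of_injOn c (fun i hi => by simpa using hct i hi) ?_
  intro i hi j hj hij
  by_contra hne
  refine (hsep i hi j hj hne).not_gt ?_
  refine korDist_lt_of_korCoord hs (hA i₀ hi₀).1 (hA j hj).1 (h6 j hj) (hA j hj).2.1 ?_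
  have h1 := hcd i hi
  have h2 := hcd j hj
  rw [← hij] at h2
  linarith [dist_triangle_right (korCoord s (x i₀) (x i)) (korCoord s (x i₀) (x j)) (c i)]

end Koranyi

end BergmanBall

namespace BergmanBall

/-! ### Hyperbolic balls in terms of 1 - |z|² and |1 - ⟨z,w⟩| -/

section Mobius

variable {n : ℕ}

/-- The defect `1 - |z|²` of a point of the ball. -/
noncomputable def defect (z : CBall n) : ℝ := 1 - ‖(z : EuclideanSpace ℂ (Fin n))‖ ^ 2

lemma norm_lt_one (z : CBall n) : ‖(z : EuclideanSpace ℂ (Fin n))‖ < 1 :=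
  mem_ball_zero_iff.1 z.2

lemma defect_pos (z : CBall n) : 0 < defect z := by
  have := norm_lt_one z
  have := norm_nonneg (z : EuclideanSpace ℂ (Fin n))
  unfold defect; nlinarith

lemma defect_le_one (z : CBall n) : defect z ≤ 1 := by
  unfold defect; nlinarith [norm_nonneg (z : EuclideanSpace ℂ (Fin n))]

lemma continuous_defect : Continuous (defect (n := n)) := by
  unfold defect; fun_prop

/-- The quantity `|1 - ⟨z, w⟩|`. -/
noncomputable def korSq (z w : CBall n) : ℝ :=
  ‖1 - inner ℂ (z : EuclideanSpace ℂ (Fin n)) (w : EuclideanSpace ℂ (Fin n))‖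

lemma korSq_comm (z w : CBall n) : korSq z w = korSq w z := norm_one_sub_inner_comm _ _

lemma defect_le_two_korSq (z w : CBall n) : defect z ≤ 2 * korSq z w := by
  have h1 := le_norm_one_sub_inner z w.2
  have h2 := norm_lt_one z
  have := norm_nonneg (z : EuclideanSpace ℂ (Fin n))
  unfold defect korSq; nlinarith

lemma korSq_pos (z w : CBall n) : 0 < korSq z w := by
  linarith [defect_le_two_korSq z w, defect_pos z]

lemma korSq_le_two (z w : CBall n) : korSq z w ≤ 2 := by
  refine (norm_sub_le _ _).trans ?_
  rw [norm_one]
  linarith [norm_inner_le_one (norm_lt_one z).le (norm_lt_one w).le]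

lemma continuous_korSq : Continuous fun x : CBall n × CBall n => korSq x.1 x.2 := by
  unfold korSq; fun_prop

/-- The relation `cosh² β(z, w) ≤ c`. -/
def Near (c : ℝ) (z w : CBall n) : Prop := korSq z w ^ 2 ≤ c * (defect z * defect w)

lemma Near.symm {c : ℝ} {z w : CBall n} (h : Near c z w) : Near c w z := by
  unfold Near at *; rw [korSq_comm, mul_comm (defect w)]; exact h

lemma isClosed_near (c : ℝ) : IsClosed {x : CBall n × CBall n | Near c x.1 x.2} := by
  have := continuous_korSq (n := n)
  have := continuous_defect (n := n)
  exact isClosed_le (by fun_prop) (by fun_prop)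

/-- Square 1 - |z|² ≤ 2|1 - ⟨z,w⟩| and cancel one factor. Near points thus have comparable defects,
which confines them to neighbouring layers. -/
lemma Near.defect_le {c : ℝ} {z w : CBall n} (h : Near c z w) : defect z ≤ 4 * c * defect w := by
  have h1 := defect_le_two_korSq z w
  have hz := defect_pos z
  have : defect z * defect z ≤ defect z * (4 * c * defect w) := by
    unfold Near at h; nlinarith
  exact le_of_mul_le_mul_left this hz

lemma starProjection_span_singleton (z w : EuclideanSpace ℂ (Fin n)) :
    (ℂ ∙ z).starProjection w = (inner ℂ z w / ((‖z‖ ^ 2 : ℝ) : ℂ)) • z := by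
  rw [Submodule.starProjection_singleton]; push_cast; rfl

/-- Pythagoras for the splitting of w along z and its orthogonal complement. The right-hand side is
1/cosh² β, which makes `Near` a substitute for hyperbolic balls. -/
lemma norm_mobius_sq (z w : CBall n) :
    1 - pseudoDist z w ^ 2 = defect z * defect w / korSq z w ^ 2 := by
  have hk := korSq_pos z w
  obtain ⟨z, hz⟩ := z
  obtain ⟨w, hw⟩ := w
  have hz1 : ‖z‖ < 1 := mem_ball_zero_iff.1 hz
  set P := (ℂ ∙ z).starProjection w with hP
  set s : ℝ := √(1 - ‖z‖ ^ 2) with hs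
  have hs2 : s ^ 2 = 1 - ‖z‖ ^ 2 := Real.sq_sqrt (by nlinarith [norm_nonneg z])
  have hPz : P ∈ (ℂ ∙ z) := Submodule.starProjection_apply_mem _ _
  have hQ : w - P ∈ (ℂ ∙ z)ᗮ := Submodule.sub_starProjection_mem_orthogonal _
  have hzz : z ∈ (ℂ ∙ z) := Submodule.mem_span_singleton_self z
  have e1 : ‖z - P - (s : ℂ) • (w - P)‖ ^ 2 = ‖z - P‖ ^ 2 + s ^ 2 * ‖w - P‖ ^ 2 := by
    have h0 : inner ℂ (z - P) (w - P) = 0 :=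
      (Submodule.mem_orthogonal _ _).1 hQ _ (Submodule.sub_mem _ hzz hPz)
    rw [@norm_sub_sq ℂ, inner_smul_right, h0, norm_smul, Complex.norm_real, mul_pow,
      Real.norm_eq_abs, sq_abs]
    simp
  have hPw : inner ℂ z P = inner ℂ z w := by
    have : inner ℂ z (w - P) = 0 := (Submodule.mem_orthogonal _ _).1 hQ _ hzz
    rw [inner_sub_right] at this
    exact (sub_eq_zero.1 this).symm
  have e2 : ‖w‖ ^ 2 = ‖P‖ ^ 2 + ‖w - P‖ ^ 2 := by
    have h0 : inner ℂ P (w - P) = 0 := (Submodule.mem_orthogonal _ _).1 hQ _ hPz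
    have h := @norm_add_sq ℂ _ _ _ _ P (w - P)
    rw [h0, add_sub_cancel] at h
    simpa using h
  have e3 : ‖z - P‖ ^ 2 = ‖z‖ ^ 2 - 2 * (inner ℂ z w).re + ‖P‖ ^ 2 := by
    rw [@norm_sub_sq ℂ, hPw]; rfl
  have e4 : ‖z‖ ^ 2 * ‖P‖ ^ 2 = ‖inner ℂ z w‖ ^ 2 := by
    rw [← hPw]
    obtain ⟨a, ha⟩ := Submodule.mem_span_singleton.1 hPz
    rw [← ha, inner_smul_right, norm_smul, norm_mul, inner_self_eq_norm_sq_to_K]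
    simp; ring
  have e5 : ‖(1 : ℂ) - inner ℂ z w‖ ^ 2 = 1 - 2 * (inner ℂ z w).re + ‖inner ℂ z w‖ ^ 2 := by
    rw [Complex.sq_norm, Complex.sq_norm, Complex.normSq_sub]
    simp only [map_one, one_mul, Complex.conj_re]; ring
  simp only [pseudoDist, mobius, defect, korSq] at hk ⊢
  rw [norm_smul, norm_inv, mul_pow, ← hP, ← hs, e1, inv_pow]
  field_simp
  rw [e5, e3, hs2, ← e4, e2]
  have : ‖w - P‖ ^ 2 = ‖w‖ ^ 2 - ‖P‖ ^ 2 := by linarith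
  ring

lemma pseudoDist_lt_one (z w : CBall n) : pseudoDist z w < 1 := by
  have h := norm_mobius_sq z w
  have h1 : 0 < defect z * defect w / korSq z w ^ 2 := by
    have := defect_pos z; have := defect_pos w; have := korSq_pos z w; positivity
  have : 0 ≤ pseudoDist z w := norm_nonneg _
  nlinarith

/-- This reads e^{2β} = (1 + ρ)² cosh² β. As 1 ≤ (1 + ρ)² ≤ 4, it accounts for the constants exp(2r)
and 4c in the comparison of `hypBall` with `Near`. -/
lemma pseudoDist_div (z w : CBall n) : (1 + pseudoDist z w) / (1 - pseudoDist z w)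
    = (1 + pseudoDist z w) ^ 2 * (korSq z w ^ 2 / (defect z * defect w)) := by
  have h0 := pseudoDist_lt_one z w
  have h1 : 0 ≤ pseudoDist z w := norm_nonneg _
  have h := norm_mobius_sq z w
  rw [← inv_div (defect z * defect w), ← h]
  have : 1 - pseudoDist z w ^ 2 = (1 - pseudoDist z w) * (1 + pseudoDist z w) := by ring
  rw [this]
  have : 1 - pseudoDist z w ≠ 0 := by linarith
  have : 1 + pseudoDist z w ≠ 0 := by linarith
  field_simp

lemma near_of_mem_hypBall {z w : CBall n} {r : ℝ} (h : w ∈ hypBall z r) :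
    Near (Real.exp (2 * r)) z w := by
  have h0 := pseudoDist_lt_one z w
  have h1 : 0 ≤ pseudoDist z w := norm_nonneg _
  have hd : 0 < defect z * defect w := mul_pos (defect_pos z) (defect_pos w)
  have hk := korSq_pos z w
  have h' : bergmanDist z w ≤ r := h
  unfold bergmanDist at h'
  have h2 : (1 + pseudoDist z w) / (1 - pseudoDist z w) ≤ Real.exp (2 * r) := by
    rw [← Real.log_le_iff_le_exp (div_pos (by linarith) (by linarith))]; linarith
  rw [pseudoDist_div] at h2
  unfold Near
  rw [← div_le_iff₀ hd]
  refine le_trans ?_ h2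
  exact le_mul_of_one_le_left (by positivity) (by nlinarith)

lemma mem_hypBall_of_near {z w : CBall n} {c : ℝ} (h : Near c z w) :
    w ∈ hypBall z (1 / 2 * Real.log (4 * c)) := by
  have h0 := pseudoDist_lt_one z w
  have h1 : 0 ≤ pseudoDist z w := norm_nonneg _
  have hd : 0 < defect z * defect w := mul_pos (defect_pos z) (defect_pos w)
  have hk := korSq_pos z w
  unfold Near at h
  rw [← div_le_iff₀ hd] at h
  change bergmanDist z w ≤ _
  unfold bergmanDist
  have h2 : 0 < 1 - pseudoDist z w := by linarith
  gcongr
  rw [pseudoDist_div]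
  have : (1 + pseudoDist z w) ^ 2 ≤ 4 := by nlinarith
  gcongr

end Mobius

/-! ### Covers whose overlap is independent of the scale -/

section Covering

lemma exists_maximal_separated {α : Type*} (r : α → α → Prop) (U : Set α) :
    ∃ I ⊆ U, (∀ i ∈ I, ∀ j ∈ I, i ≠ j → ¬ r i j ∧ ¬ r j i) ∧
      ∀ m ∈ U, m ∈ I ∨ ∃ i ∈ I, r m i ∨ r i m := by
  obtain ⟨I, hI⟩ := zorn_subset {I : Set α | I ⊆ U ∧ I.Pairwise fun i j => ¬ r i j ∧ ¬ r j i}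
    (fun c hc hchain => ⟨⋃₀ c, ⟨Set.sUnion_subset fun s hs => (hc hs).1,
      (Set.pairwise_sUnion hchain.directedOn).2 fun s hs => (hc hs).2⟩,
      fun s hs => Set.subset_sUnion_of_mem hs⟩)
  refine ⟨I, hI.prop.1, fun i hi j hj hij => hI.prop.2 hi hj hij, fun m hm => ?_⟩
  by_contra! hcon
  obtain ⟨hmI, hr⟩ := hcon
  refine hmI (hI.le_of_ge (y := insert m I) ⟨Set.insert_subset hm hI.prop.1, ?_⟩
    (Set.subset_insert _ _) (Set.mem_insert _ _))
  exact hI.prop.2.insert fun i hi _ => ⟨hr i hi, (hr i hi).symm⟩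

lemma exists_pow_scale {M : ℝ} (hM : 1 < M) {t : ℝ} (h0 : 0 < t) (h1 : t ≤ 1) :
    ∃ k : ℕ, (M⁻¹) ^ (k + 1) < t ∧ t ≤ (M⁻¹) ^ k :=
  exists_nat_pow_near_of_lt_one h0 h1 (by positivity) (inv_lt_one_of_one_lt₀ hM)

variable {n : ℕ}

/-- A maximal separated subset of a dense sequence, so that the cover is indexed by ℕ. The net may
reach height 2b, twice the layer, so that an element of the sequence close to w is always eligible;
the cost is a covering radius 2s in place of s. -/
lemma exists_layer_net {x : ℕ → CBall n} (hx : DenseRange x) (b s : ℝ) (hb : 0 < b)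
    (hs : 2 * b ≤ s ^ 2) (hs0 : 0 < s) :
    ∃ I : Set ℕ, (∀ l ∈ I, defect (x l) < 2 * b) ∧
      (∀ i ∈ I, ∀ j ∈ I, i ≠ j → s ≤ korDist (x i : EuclideanSpace ℂ (Fin n)) (x j)) ∧
      ∀ w : CBall n, defect w ≤ b →
        ∃ l ∈ I, korDist (w : EuclideanSpace ℂ (Fin n)) (x l) < 2 * s := by
  obtain ⟨I, hIU, hsep, hmax⟩ := exists_maximal_separated
    (fun i j : ℕ => korDist (x i : EuclideanSpace ℂ (Fin n)) (x j) < s)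
    {l | defect (x l) < 2 * b}
  refine ⟨I, hIU, fun i hi j hj hij => not_lt.1 (hsep i hi j hj hij).1, fun w hw => ?_⟩
  have hopen : IsOpen {y : CBall n | defect y < 2 * b ∧ korSq w y < 2 * b} := by
    have := continuous_defect (n := n)
    have hk : Continuous fun y => korSq w y := by unfold korSq; fun_prop
    have h1 : IsOpen {y : CBall n | defect y < 2 * b} := isOpen_lt this continuous_const
    have h2 : IsOpen {y : CBall n | korSq w y < 2 * b} := isOpen_lt hk continuous_const
    rw [Set.ofPred_and]
    exact h1.inter h2
  have hww : korSq w w = defect w := by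
    rw [korSq, ← korDist_sq, korDist_self (norm_lt_one w).le, defect]
  obtain ⟨m, hm1, hm2⟩ := hx.exists_mem_open hopen
    ⟨w, by linarith, by rw [hww]; linarith⟩
  have hwm : korDist (w : EuclideanSpace ℂ (Fin n)) (x m) < s := by
    rw [korDist, Real.sqrt_lt' hs0]
    exact hm2.trans_le hs
  rcases hmax m hm1 with h | ⟨l, hl, h⟩
  · exact ⟨m, h, by linarith⟩
  · refine ⟨l, hl, (korDist_triangle (norm_lt_one w).le (norm_lt_one (x m)).le
      (norm_lt_one (x l)).le).trans_lt ?_⟩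
    have : korDist (x m : EuclideanSpace ℂ (Fin n)) (x l) < s :=
      h.elim id fun h => by rwa [korDist_comm]
    linarith

/-- The hyperbolic ball has covers of bounded overlap at every scale, with an overlap that does not
depend on the scale. -/
lemma exists_cover (n : ℕ) : ∃ N : ℕ, ∀ c : ℝ, 1 ≤ c → ∃ (c' : ℝ) (E G : ℕ → Set (CBall n)),
    1 ≤ c' ∧ (∀ i, MeasurableSet (E i)) ∧ (∀ i, MeasurableSet (G i)) ∧ (⋃ i, E i) = Set.univ ∧
    (∀ i, ∀ w ∈ E i, ∀ z, Near c z w → z ∈ G i) ∧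
    (∀ i, ∀ w ∈ E i, ∀ z ∈ G i, Near c' z w) ∧
    ∀ (z : CBall n) (A : Finset ℕ), (∀ i ∈ A, z ∈ G i) → A.card ≤ N := by
  obtain ⟨N, hN⟩ := exists_packing_bound (EuclideanSpace ℂ (Fin n))
  -- N is fixed before c. A point meets G only in three consecutive layers, at most N times in each.
  refine ⟨3 * N, fun c hc => ?_⟩
  -- M exceeds the factor 4c by which c-near points can differ in defect, so they lie in adjacent
  -- layers. The radii s² = A b serve twice: c-near points of a layer satisfy |1 - ⟨z,w⟩| ≤ 2cb ≤
  -- s², and net points have defect below 2b ≤ s²/20, as the packing bound requires.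
  set M : ℝ := 4 * c + 1 with hM
  set A : ℝ := 40 * c with hA
  have hM1 : 1 < M := by linarith
  have hM0 : 0 < M := by linarith
  set b : ℕ → ℝ := fun k => (M⁻¹) ^ k with hb
  have hb0 : ∀ k, 0 < b k := fun k => by positivity
  have hbs : ∀ k, b k = M * b (k + 1) := fun k => by
    simp only [hb, pow_succ]; field_simp
  set s : ℕ → ℝ := fun k => √(A * b k) with hs
  have hA0 : 0 < A := by linarith
  have hs0 : ∀ k, 0 < s k := fun k => Real.sqrt_pos.2 (mul_pos hA0 (hb0 k))
  have hs2 : ∀ k, s k ^ 2 = A * b k := fun k => Real.sq_sqrt (mul_pos hA0 (hb0 k)).le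
  have hsb : ∀ k, 2 * b k ≤ s k ^ 2 := fun k => by
    rw [hs2]; exact mul_le_mul_of_nonneg_right (by linarith) (hb0 k).le
  obtain ⟨x, hx⟩ := TopologicalSpace.exists_dense_seq (CBall n)
  choose I hI1 hI2 hI3 using fun k => exists_layer_net hx (b k) (s k) (hb0 k) (hsb k) (hs0 k)
  -- E is a layer intersected with a Korányi ball; G adds one layer on each side and one s to the
  -- radius, enough to catch all points c-near E.
  let E : ℕ × ℕ → Set (CBall n) := fun j => {w | j.2 ∈ I j.1 ∧ b (j.1 + 1) < defect w ∧
    defect w ≤ b j.1 ∧ korDist (w : EuclideanSpace ℂ (Fin n)) (x j.2) < 2 * s j.1}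
  let G : ℕ × ℕ → Set (CBall n) := fun j => {z | j.2 ∈ I j.1 ∧ b (j.1 + 2) < defect z ∧
    defect z < M * b j.1 ∧ korDist (z : EuclideanSpace ℂ (Fin n)) (x j.2) ≤ 3 * s j.1}
  have hcd := continuous_defect (n := n)
  have hck : ∀ l, Continuous fun w : CBall n => korDist (w : EuclideanSpace ℂ (Fin n)) (x l) :=
    fun l => continuous_korDist.comp (by fun_prop : Continuous fun w : CBall n =>
      ((w : EuclideanSpace ℂ (Fin n)), (x l : EuclideanSpace ℂ (Fin n))))
  have hEm : ∀ j, MeasurableSet (E j) := fun j =>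
    (MeasurableSet.const _).inter ((measurableSet_lt measurable_const hcd.measurable).inter
      ((measurableSet_le hcd.measurable measurable_const).inter
        (measurableSet_lt (hck _).measurable measurable_const)))
  have hGm : ∀ j, MeasurableSet (G j) := fun j =>
    (MeasurableSet.const _).inter ((measurableSet_lt measurable_const hcd.measurable).inter
      ((measurableSet_lt hcd.measurable measurable_const).inter
        (measurableSet_le (hck _).measurable measurable_const)))
  -- From |1 - ⟨z,w⟩| ≤ (3s + 2s)² = 25 A b_k, squared, with b_k² = M³ b_{k+1} b_{k+2}.
  refine ⟨625 * A ^ 2 * M ^ 3, fun i => E i.unpair, fun i => G i.unpair, ?_, fun i => hEm _,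
    fun i => hGm _, ?_, ?_, ?_, ?_⟩
  · have h1 : 1 ≤ A := by linarith
    have h2 : 1 ≤ M ^ 3 := one_le_pow₀ hM1.le
    have h3 : 1 ≤ A ^ 2 := one_le_pow₀ h1
    nlinarith
  · rw [Set.eq_univ_iff_forall]
    intro w
    obtain ⟨k, hk1, hk2⟩ := exists_pow_scale hM1 (defect_pos w) (defect_le_one w)
    obtain ⟨l, hl, hwl⟩ := hI3 k w hk2
    refine Set.mem_iUnion.2 ⟨Nat.pair k l, ?_⟩
    simp only [Nat.unpair_pair]
    exact ⟨hl, hk1, hk2, hwl⟩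
  · rintro i w ⟨hl, hw1, hw2, hw3⟩ z hzw
    set k := i.unpair.1
    set l := i.unpair.2
    have h1 := hzw.defect_le
    have h2 := hzw.symm.defect_le
    have hdw := defect_pos w
    have hdz := defect_pos z
    refine ⟨hl, ?_, ?_, ?_⟩
    · have := hbs (k + 1)
      have h3 : M * b (k + 2) < M * defect z := by rw [← this]; nlinarith
      exact lt_of_mul_lt_mul_left h3 hM0.le
    · nlinarith [hb0 k]
    · have h3 : korDist (z : EuclideanSpace ℂ (Fin n)) w ≤ s k := by
        rw [korDist]
        refine Real.sqrt_le_sqrt ?_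
        change korSq z w ≤ _
        have h4 : korSq z w ^ 2 ≤ (2 * c * b k) ^ 2 := by
          refine hzw.trans ?_
          have : c * (defect z * defect w) ≤ c * ((4 * c * defect w) * defect w) := by gcongr
          have : c * ((4 * c * defect w) * defect w) ≤ c * ((4 * c * b k) * b k) := by
            gcongr
          nlinarith
        have h5 := abs_le_of_sq_le_sq h4 (by have := hb0 k; positivity)
        have := (abs_le.1 h5).2
        nlinarith [hb0 k]
      have := korDist_triangle (norm_lt_one z).le (norm_lt_one w).le (norm_lt_one (x l)).le
      linarith
  · rintro i w ⟨hl, hw1, hw2, hw3⟩ z ⟨-, hz1, hz2, hz3⟩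
    set k := i.unpair.1
    set l := i.unpair.2
    have h1 : korSq z w ≤ (5 * s k) ^ 2 := by
      have h2 := korDist_triangle (norm_lt_one z).le (norm_lt_one (x l)).le (norm_lt_one w).le
      rw [korDist_comm (x l : EuclideanSpace ℂ (Fin n))] at h2
      have h3 := korDist_nonneg (z : EuclideanSpace ℂ (Fin n)) w
      change ‖_‖ ≤ _
      rw [← korDist_sq]
      gcongr
      linarith
    have h2 : korSq z w ^ 2 ≤ (25 * (A * b k)) ^ 2 := by
      have := korSq_pos z w
      gcongr
      rw [← hs2]; linarith
    refine h2.trans ?_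
    have h3 : b (k + 2) * b (k + 1) ≤ defect z * defect w := by
      have := hb0 (k + 1); have := defect_pos z
      gcongr
    have h4 : b k * b k = M ^ 3 * (b (k + 2) * b (k + 1)) := by
      rw [hbs k, hbs (k + 1)]; ring
    calc (25 * (A * b k)) ^ 2 = 625 * A ^ 2 * (b k * b k) := by ring
      _ = 625 * A ^ 2 * M ^ 3 * (b (k + 2) * b (k + 1)) := by rw [h4]; ring
      _ ≤ _ := by gcongr
  · intro z S hS
    obtain ⟨k₀, hk1, hk2⟩ := exists_pow_scale hM1 (defect_pos z) (defect_le_one z)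
    have hanti : StrictAnti b := fun i j hij => pow_lt_pow_right_of_lt_one₀ (by positivity)
      (inv_lt_one_of_one_lt₀ hM1) hij
    -- For k₀ = 0 the truncated subtraction only shortens the interval: it never has more than three
    -- elements.
    have hrange : ∀ i ∈ S, i.unpair.1 ∈ Finset.Icc (k₀ - 1) (k₀ + 1) := by
      intro i hi
      obtain ⟨-, hz1, hz2, -⟩ := hS i hi
      have h1 : k₀ < i.unpair.1 + 2 := hanti.lt_iff_gt.1 (hz1.trans_le hk2)
      have h2 : i.unpair.1 < k₀ + 2 := by
        refine hanti.lt_iff_gt.1 ?_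
        have h3 : M * b (k₀ + 2) < M * b i.unpair.1 := by rw [← hbs]; exact hk1.trans hz2
        exact lt_of_mul_lt_mul_left h3 hM0.le
      rw [Finset.mem_Icc]; omega
    refine (Finset.card_le_mul_card_image_of_maps_to hrange N fun k hk => ?_).trans ?_
    · refine hN (s k) (hs0 k) z (norm_lt_one z).le _
        (fun i => (x i.unpair.2 : EuclideanSpace ℂ (Fin n))) (fun i hi => ?_) (fun i hi j hj hij => ?_)
      · obtain ⟨hiS, rfl⟩ := Finset.mem_filter.1 hi
        obtain ⟨hl, -, -, h3⟩ := hS i hiS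
        refine ⟨(norm_lt_one _).le, ?_, h3⟩
        have := hI1 _ _ hl
        change defect _ ≤ _
        rw [hs2]
        nlinarith [hb0 i.unpair.1]
      · obtain ⟨hiS, hik⟩ := Finset.mem_filter.1 hi
        obtain ⟨hjS, hjk⟩ := Finset.mem_filter.1 hj
        have hil := (hS i hiS).1
        have hjl := (hS j hjS).1
        rw [hik] at hil
        rw [hjk] at hjl
        refine hI2 k _ hil _ hjl fun h => hij ?_
        rw [← Nat.pair_unpair i, ← Nat.pair_unpair j, hik, hjk, h]
    · rw [mul_comm]
      gcongr
      rw [Nat.card_Icc]; omega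

end Covering

end BergmanBall

namespace BergmanBall

/-! ### The Möbius involution and its Jacobian -/

section ChangeOfVariables

variable {n : ℕ}

local notation "𝔼" => EuclideanSpace ℂ (Fin n)

lemma abs_det_restrictScalars (A : 𝔼 →L[ℂ] 𝔼) :
    |(A.restrictScalars ℝ).det| = ‖LinearMap.det (A : 𝔼 →ₗ[ℂ] 𝔼)‖ ^ 2 := by
  have h : (A.restrictScalars ℝ).det = Algebra.norm ℝ (LinearMap.det (A : 𝔼 →ₗ[ℂ] 𝔼)) := by
    rw [← LinearMap.det_restrictScalars]; rfl
  rw [h, Algebra.norm_complex_eq, Complex.sq_norm]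
  exact abs_of_nonneg (Complex.normSq_nonneg _)

/-- The linear map acting as `a` on the line of `z` and as `s` on its orthogonal complement. -/
noncomputable def lineScale (z : 𝔼) (a s : ℂ) : 𝔼 →L[ℂ] 𝔼 :=
  s • ContinuousLinearMap.id ℂ 𝔼 + (a - s) • (ℂ ∙ z).starProjection

lemma lineScale_apply (z : 𝔼) (a s : ℂ) (h : 𝔼) :
    lineScale z a s h = s • h + ((a - s) * (inner ℂ z h / ((‖z‖ ^ 2 : ℝ) : ℂ))) • z := by
  simp only [lineScale, add_apply, smul_apply,
    ContinuousLinearMap.id_apply, starProjection_span_singleton, smul_smul]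

/-- The map is s times a rank-one perturbation of the identity, whose determinant is explicit. The
extra factor s on the left avoids the exponent n - 1. When z = 0 the projection vanishes and only s
acts, hence the condition on a. -/
lemma det_lineScale {z : 𝔼} {a s : ℂ} (hs : s ≠ 0) (hz : z = 0 → a = s) :
    LinearMap.det (lineScale z a s : 𝔼 →ₗ[ℂ] 𝔼) * s = s ^ n * a := by
  have h : (lineScale z a s : 𝔼 →ₗ[ℂ] 𝔼) = s • LinearMap.transvection
      (((a - s) / s / ((‖z‖ ^ 2 : ℝ) : ℂ)) • (innerSL ℂ z : 𝔼 →ₗ[ℂ] ℂ)) z := by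
    ext1 h
    simp only [ContinuousLinearMap.coe_coe, lineScale_apply, LinearMap.smul_apply,
      LinearMap.transvection.apply, smul_add, smul_smul, innerSL_apply_apply, smul_eq_mul]
    congr 2
    field_simp
  rw [h, LinearMap.det_smul, LinearMap.transvection.det]
  simp only [LinearMap.smul_apply, ContinuousLinearMap.coe_coe, innerSL_apply_apply, smul_eq_mul,
    inner_self_eq_norm_sq_to_K, finrank_euclideanSpace_fin]
  rcases eq_or_ne z 0 with h0 | h0
  · rw [hz h0, h0]; simp
  · have : ((‖z‖ : ℝ) : ℂ) ≠ 0 := by exact_mod_cast norm_ne_zero_iff.2 h0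
    push_cast
    simp only [Complex.coe_algebraMap]
    field_simp
    ring

/-- The square root of the defect. -/
noncomputable def sqrtDefect (z : CBall n) : ℝ := √(defect z)

lemma sqrtDefect_pos (z : CBall n) : 0 < sqrtDefect z := Real.sqrt_pos.2 (defect_pos z)

lemma sqrtDefect_sq (z : CBall n) : sqrtDefect z ^ 2 = defect z := Real.sq_sqrt (defect_pos z).le

/-- The Möbius involution, as a map of the ambient space. -/
noncomputable def mobiusExt (z : CBall n) (w : 𝔼) : 𝔼 :=
  (1 - inner ℂ (z : 𝔼) w)⁻¹ • lineScale (z : 𝔼) 1 (sqrtDefect z) ((z : 𝔼) - w)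

lemma lineScale_self (z : 𝔼) (s : ℂ) : lineScale z 1 s z = z := by
  rw [lineScale, add_apply, smul_apply,
    smul_apply, ContinuousLinearMap.id_apply,
    Submodule.starProjection_eq_self_iff.2 (Submodule.mem_span_singleton_self z), ← add_smul]
  simp

lemma mobiusExt_coe (z w : CBall n) : mobiusExt z w = mobius z w := by
  have h : sqrtDefect z = √(1 - ‖(z : 𝔼)‖ ^ 2) := rfl
  rw [mobiusExt, mobius, map_sub, lineScale_self, ← h]
  congr 1
  simp only [lineScale, add_apply, smul_apply,
    ContinuousLinearMap.id_apply]
  module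

lemma one_sub_inner_ne_zero (z : CBall n) {w : 𝔼} (hw : w ∈ Metric.ball (0 : 𝔼) 1) :
    1 - inner ℂ (z : 𝔼) w ≠ 0 :=
  norm_pos_iff.1 ((one_sub_norm_pos z).trans_le (le_norm_one_sub_inner z hw))

lemma mobiusExt_mem_ball (z : CBall n) {w : 𝔼} (hw : w ∈ Metric.ball (0 : 𝔼) 1) :
    mobiusExt z w ∈ Metric.ball (0 : 𝔼) 1 := by
  rw [mobiusExt_coe z ⟨w, hw⟩, mem_ball_zero_iff]
  exact pseudoDist_lt_one z ⟨w, hw⟩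

lemma mobiusExt_zero (z : CBall n) : mobiusExt z 0 = z := by
  simp [mobiusExt, lineScale_self]

/-- For z = 0 the division by zero gives 0, and so is the right-hand side; no case distinction is
needed later. -/
lemma norm_sq_mul_proj (z h : 𝔼) :
    ((‖z‖ ^ 2 : ℝ) : ℂ) * (inner ℂ z h / ((‖z‖ ^ 2 : ℝ) : ℂ)) = inner ℂ z h := by
  rcases eq_or_ne z 0 with h0 | h0
  · simp [h0]
  · have : ((‖z‖ ^ 2 : ℝ) : ℂ) ≠ 0 := by
      exact_mod_cast pow_ne_zero 2 (norm_ne_zero_iff.2 h0)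
    field_simp

lemma inner_self_coe (z : 𝔼) : inner ℂ z z = ((‖z‖ ^ 2 : ℝ) : ℂ) := by
  rw [inner_self_eq_norm_sq_to_K]; push_cast; rfl

lemma inner_lineScale_one (z h : 𝔼) (s : ℂ) :
    inner ℂ z (lineScale z 1 s h) = inner ℂ z h := by
  rw [lineScale_apply, inner_add_right, inner_smul_right, inner_smul_right, inner_self_coe,
    mul_assoc, mul_comm (_ / _), norm_sq_mul_proj]
  ring

/-- The square acts as 1 on the line of z and as 1 - |z|² on its complement, that is, as (1 - |z|²)
I + zz*. This drives the proof that the Möbius map is an involution. -/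
lemma lineScale_lineScale (z : CBall n) (h : 𝔼) :
    lineScale (z : 𝔼) 1 (sqrtDefect z) (lineScale (z : 𝔼) 1 (sqrtDefect z) h)
      = (defect z : ℂ) • h + inner ℂ (z : 𝔼) h • (z : 𝔼) := by
  have hs : (sqrtDefect z : ℂ) ^ 2 = defect z := by exact_mod_cast sqrtDefect_sq z
  rw [lineScale_apply, inner_lineScale_one, lineScale_apply, smul_add, add_assoc, smul_smul,
    smul_smul, ← add_smul]
  congr 2
  · rw [← hs]; ring
  · conv_rhs => rw [← norm_sq_mul_proj]
    have : ((‖(z : 𝔼)‖ ^ 2 : ℝ) : ℂ) = 1 - (sqrtDefect z : ℂ) ^ 2 := by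
      rw [hs]; unfold defect; push_cast; ring
    rw [this]
    ring

lemma one_sub_inner_mobiusExt (z : CBall n) {w : 𝔼} (hw : w ∈ Metric.ball (0 : 𝔼) 1) :
    1 - inner ℂ (z : 𝔼) (mobiusExt z w) = defect z / (1 - inner ℂ (z : 𝔼) w) := by
  have ha := one_sub_inner_ne_zero z hw
  rw [mobiusExt, inner_smul_right, inner_lineScale_one, inner_sub_right, inner_self_coe, defect]
  field_simp
  push_cast
  ring

lemma mobiusExt_mobiusExt (z : CBall n) {w : 𝔼} (hw : w ∈ Metric.ball (0 : 𝔼) 1) :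
    mobiusExt z (mobiusExt z w) = w := by
  have ha := one_sub_inner_ne_zero z hw
  have hd : (defect z : ℂ) ≠ 0 := by exact_mod_cast (defect_pos z).ne'
  have hd2 : (defect z : ℂ) = 1 - ((‖(z : 𝔼)‖ ^ 2 : ℝ) : ℂ) := by unfold defect; push_cast; ring
  rw [mobiusExt, one_sub_inner_mobiusExt z hw, map_sub, lineScale_self, mobiusExt, map_smul,
    lineScale_lineScale, inner_sub_right, inner_self_coe]
  set a := inner ℂ (z : 𝔼) w
  set c := ((‖(z : 𝔼)‖ ^ 2 : ℝ) : ℂ)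
  have e : ((defect z : ℂ) / (1 - a))⁻¹ • ((z : 𝔼) - (1 - a)⁻¹ • ((defect z : ℂ) • ((z : 𝔼) - w)
      + (c - a) • (z : 𝔼)))
      = (((1 - a) - (defect z : ℂ) - (c - a)) / (defect z : ℂ)) • (z : 𝔼) + w := by
    match_scalars <;> field_simp
    ring
  rw [e, hd2]
  simp

lemma injOn_mobiusExt (z : CBall n) : Set.InjOn (mobiusExt z) (Metric.ball (0 : 𝔼) 1) :=
  fun x hx y hy h => by rw [← mobiusExt_mobiusExt z hx, h, mobiusExt_mobiusExt z hy]

lemma image_mobiusExt (z : CBall n) :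
    mobiusExt z '' Metric.ball (0 : 𝔼) 1 = Metric.ball (0 : 𝔼) 1 :=
  Set.Subset.antisymm (Set.image_subset_iff.2 fun _ hw => mobiusExt_mem_ball z hw)
    fun _ hw => ⟨_, mobiusExt_mem_ball z hw, mobiusExt_mobiusExt z hw⟩

/-- The complex derivative of the Möbius involution. -/
noncomputable def mobiusDeriv (z : CBall n) (w : 𝔼) : 𝔼 →L[ℂ] 𝔼 :=
  -(1 - inner ℂ (z : 𝔼) w)⁻¹ • (lineScale (z : 𝔼) 1 (sqrtDefect z)).comp
    (ContinuousLinearMap.id ℂ 𝔼 +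
      (-(1 - inner ℂ (z : 𝔼) w)⁻¹ • innerSL ℂ (z : 𝔼)).smulRight ((z : 𝔼) - w))

lemma hasFDerivAt_mobiusExt (z : CBall n) {w : 𝔼} (hw : w ∈ Metric.ball (0 : 𝔼) 1) :
    HasFDerivAt (mobiusExt z) (mobiusDeriv z w) w := by
  have ha := one_sub_inner_ne_zero z hw
  have h1 : HasFDerivAt (fun w : 𝔼 => 1 - inner ℂ (z : 𝔼) w) (-innerSL ℂ (z : 𝔼)) w := by
    have := (innerSL ℂ (z : 𝔼)).hasFDerivAt (x := w)
    exact this.const_sub 1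
  have h2 := (hasDerivAt_inv ha).comp_hasFDerivAt w h1
  have h3 : HasFDerivAt (fun w : 𝔼 => lineScale (z : 𝔼) 1 (sqrtDefect z) ((z : 𝔼) - w))
      (-lineScale (z : 𝔼) 1 (sqrtDefect z)) w := by
    have := (lineScale (z : 𝔼) 1 (sqrtDefect z)).hasFDerivAt.comp w
      ((hasFDerivAt_id (𝕜 := ℂ) w).const_sub (z : 𝔼))
    refine this.congr_fderiv ?_
    ext1 h
    simp
  refine (h2.smul h3).congr_fderiv ?_
  ext1 h
  simp only [mobiusDeriv, add_apply, smul_apply,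
    neg_apply, ContinuousLinearMap.comp_apply, ContinuousLinearMap.id_apply,
    ContinuousLinearMap.smulRight_apply, innerSL_apply_apply, map_add, map_smul, smul_add,
    smul_smul, Function.comp_apply, smul_eq_mul, smul_neg]
  match_scalars <;> field_simp

lemma abs_det_mobiusDeriv (z : CBall n) {w : 𝔼} (hw : w ∈ Metric.ball (0 : 𝔼) 1) :
    |((mobiusDeriv z w).restrictScalars ℝ).det|
      = defect z ^ (n + 1) / ‖1 - inner ℂ (z : 𝔼) w‖ ^ (2 * (n + 1)) := by
  have ha := one_sub_inner_ne_zero z hw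
  have hs := sqrtDefect_pos z
  have hs' : (sqrtDefect z : ℂ) ≠ 0 := by exact_mod_cast hs.ne'
  have hd := det_lineScale (z := (z : 𝔼)) (a := 1) hs' (fun h => by
    simp [sqrtDefect, defect, h])
  rw [abs_det_restrictScalars]
  -- The derivative is a scalar times `lineScale` times identity plus rank one. The last determinant
  -- is 1 plus the functional at its vector, namely (1 - |z|²)/(1 - ⟨z,w⟩), and the real Jacobian is
  -- the squared modulus of the product.
  have h1 : ((mobiusDeriv z w : 𝔼 →L[ℂ] 𝔼) : 𝔼 →ₗ[ℂ] 𝔼)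
      = (-(1 - inner ℂ (z : 𝔼) w)⁻¹) • ((lineScale (z : 𝔼) 1 (sqrtDefect z) : 𝔼 →ₗ[ℂ] 𝔼) *
        LinearMap.transvection ((-(1 - inner ℂ (z : 𝔼) w)⁻¹) • (innerSL ℂ (z : 𝔼) : 𝔼 →ₗ[ℂ] ℂ))
          ((z : 𝔼) - w)) := by
    ext1 h
    simp [mobiusDeriv, LinearMap.transvection.apply]
    abel
  have h2 : 1 + -(1 - inner ℂ (z : 𝔼) w)⁻¹ * inner ℂ (z : 𝔼) ((z : 𝔼) - w)
      = defect z / (1 - inner ℂ (z : 𝔼) w) := by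
    rw [inner_sub_right, inner_self_coe, defect]
    field_simp
    push_cast
    ring
  rw [h1, LinearMap.det_smul, map_mul, LinearMap.transvection.det]
  simp only [LinearMap.smul_apply, ContinuousLinearMap.coe_coe, innerSL_apply_apply, smul_eq_mul,
    finrank_euclideanSpace_fin]
  rw [h2]
  set D := LinearMap.det (lineScale (z : 𝔼) 1 (sqrtDefect z) : 𝔼 →ₗ[ℂ] 𝔼)
  have hD : ‖D‖ * sqrtDefect z = sqrtDefect z ^ n := by
    have := congrArg norm hd
    rw [norm_mul, mul_one, norm_pow, Complex.norm_real, Real.norm_of_nonneg hs.le] at this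
    exact this
  have hA : 0 < ‖1 - inner ℂ (z : 𝔼) w‖ := norm_pos_iff.2 ha
  rw [norm_mul, norm_mul, norm_div, norm_pow, norm_neg, norm_inv, Complex.norm_real,
    Real.norm_of_nonneg (defect_pos z).le]
  rw [← sqrtDefect_sq z]
  set A := ‖1 - inner ℂ (z : 𝔼) w‖
  have : (A⁻¹) ^ n * (‖D‖ * (sqrtDefect z ^ 2 / A)) = sqrtDefect z ^ (n + 1) / A ^ (n + 1) := by
    rw [show ‖D‖ * (sqrtDefect z ^ 2 / A) = (‖D‖ * sqrtDefect z) * (sqrtDefect z / A) by ring, hD,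
      inv_pow]
    field_simp
    ring
  rw [this]
  field_simp
  ring

/-- Möbius change of variables. -/
lemma setIntegral_mobius (z : CBall n) (H : 𝔼 → ℂ) :
    ∫ w in Metric.ball (0 : 𝔼) 1, H w = ∫ w in Metric.ball (0 : 𝔼) 1,
      (defect z ^ (n + 1) / ‖1 - inner ℂ (z : 𝔼) w‖ ^ (2 * (n + 1))) • H (mobiusExt z w) := by
  have h := integral_image_eq_integral_abs_det_fderiv_smul (volume : Measure 𝔼)
    (s := Metric.ball (0 : 𝔼) 1) measurableSet_ball
    (f' := fun w => (mobiusDeriv z w).restrictScalars ℝ)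
    (fun w hw => ((hasFDerivAt_mobiusExt z hw).restrictScalars ℝ).hasFDerivWithinAt)
    (injOn_mobiusExt z) H
  rw [image_mobiusExt] at h
  rw [h]
  exact setIntegral_congr_fun measurableSet_ball fun w hw => by
    simp only [abs_det_mobiusDeriv z hw]

lemma integrableOn_mobius (z : CBall n) (H : 𝔼 → ℂ) :
    IntegrableOn H (Metric.ball (0 : 𝔼) 1) ↔ IntegrableOn (fun w =>
      (defect z ^ (n + 1) / ‖1 - inner ℂ (z : 𝔼) w‖ ^ (2 * (n + 1))) • H (mobiusExt z w))
      (Metric.ball (0 : 𝔼) 1) := by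
  have h := integrableOn_image_iff_integrableOn_abs_det_fderiv_smul (volume : Measure 𝔼)
    (s := Metric.ball (0 : 𝔼) 1) measurableSet_ball
    (f' := fun w => (mobiusDeriv z w).restrictScalars ℝ)
    (fun w hw => ((hasFDerivAt_mobiusExt z hw).restrictScalars ℝ).hasFDerivWithinAt)
    (injOn_mobiusExt z) H
  rw [image_mobiusExt] at h
  rw [h]
  exact integrableOn_congr_fun (fun w hw => by simp only [abs_det_mobiusDeriv z hw])
    measurableSet_ball

end ChangeOfVariables

/-! ### Mean value property and reproducing formula -/

section MeanValue

variable {n : ℕ}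

local notation "𝔼" => EuclideanSpace ℂ (Fin n)

/-- Multiplication by a unimodular constant, as a real isometry. -/
noncomputable def circleRotation (n : ℕ) (θ : ℝ) :
    EuclideanSpace ℂ (Fin n) ≃ₗᵢ[ℝ] EuclideanSpace ℂ (Fin n) where
  toLinearEquiv := (LinearEquiv.smulOfNeZero ℂ (EuclideanSpace ℂ (Fin n)) (circleMap 0 1 θ)
    (circleMap_ne_center one_ne_zero)).restrictScalars ℝ
  norm_map' x := by
    change ‖circleMap 0 1 θ • x‖ = ‖x‖
    rw [norm_smul]; simp

lemma circleRotation_preimage_ball (θ : ℝ) :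
    circleRotation n θ ⁻¹' Metric.ball (0 : 𝔼) 1 = Metric.ball (0 : 𝔼) 1 := by
  ext x; simp

lemma setIntegral_rotation {F : Type*} [NormedAddCommGroup F] [NormedSpace ℝ F]
    (g : 𝔼 → F) (θ : ℝ) :
    ∫ w in Metric.ball (0 : 𝔼) 1, g (circleMap 0 1 θ • w) = ∫ w in Metric.ball (0 : 𝔼) 1, g w := by
  have h := (circleRotation n θ).measurePreserving.setIntegral_preimage_emb
    (circleRotation n θ).toHomeomorph.measurableEmbedding g (Metric.ball (0 : 𝔼) 1)
  rw [circleRotation_preimage_ball] at h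
  exact h

lemma integrableOn_rotation {g : 𝔼 → ℂ} (hg : IntegrableOn g (Metric.ball (0 : 𝔼) 1)) (θ : ℝ) :
    IntegrableOn (fun w => g (circleMap 0 1 θ • w)) (Metric.ball (0 : 𝔼) 1) := by
  have h := (circleRotation n θ).measurePreserving.integrableOn_comp_preimage
    (circleRotation n θ).toHomeomorph.measurableEmbedding (f := g) (s := Metric.ball (0 : 𝔼) 1)
  rw [circleRotation_preimage_ball] at h
  exact h.2 hg

lemma average_rotation {g : 𝔼 → ℂ} (hd : DifferentiableOn ℂ g (Metric.ball (0 : 𝔼) 1)) {w : 𝔼}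
    (hw : w ∈ Metric.ball (0 : 𝔼) 1) :
    (2 * Real.pi)⁻¹ • ∫ θ in 0..2 * Real.pi, g (circleMap 0 1 θ • w) = g 0 := by
  have hw' : ‖w‖ < 1 := mem_ball_zero_iff.1 hw
  have hdiff : DifferentiableOn ℂ (fun ζ : ℂ => g (ζ • w)) (Metric.closedBall 0 1) := by
    refine hd.comp (by fun_prop) fun ζ hζ => ?_
    rw [mem_ball_zero_iff, norm_smul]
    have : ‖ζ‖ ≤ 1 := mem_closedBall_zero_iff.1 hζ
    nlinarith [norm_nonneg w]
  have h : DiffContOnCl ℂ (fun ζ : ℂ => g (ζ • w)) (Metric.ball 0 |1|) := by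
    rw [abs_one]
    exact DifferentiableOn.diffContOnCl (by rwa [closure_ball _ one_ne_zero])
  have := h.circleAverage
  rw [Real.circleAverage_def] at this
  simpa using this

/-- The mean value property on the ball. -/
lemma setIntegral_ball_eq {g : 𝔼 → ℂ} (hd : DifferentiableOn ℂ g (Metric.ball (0 : 𝔼) 1))
    (hg : IntegrableOn g (Metric.ball (0 : 𝔼) 1)) :
    ∫ w in Metric.ball (0 : 𝔼) 1, g w = (volume (Metric.ball (0 : 𝔼) 1)).toReal • g 0 := by
  have hpi : (0 : ℝ) ≤ 2 * Real.pi := Real.two_pi_pos.le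
  have hcont : ContinuousOn (fun x : ℝ × 𝔼 => g (circleMap 0 1 x.1 • x.2))
      (Set.Ioc 0 (2 * Real.pi) ×ˢ Metric.ball (0 : 𝔼) 1) := by
    refine hd.continuousOn.comp (Continuous.continuousOn ?_) fun x hx => ?_
    · exact ((continuous_circleMap 0 1).comp continuous_fst).smul continuous_snd
    · have := hx.2
      rw [mem_ball_zero_iff] at this ⊢
      rwa [norm_smul, norm_circleMap_zero, abs_one, one_mul]
  have hint : Integrable (Function.uncurry fun (θ : ℝ) (w : 𝔼) => g (circleMap 0 1 θ • w))
      ((volume.restrict (Set.Ioc 0 (2 * Real.pi))).prod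
        (volume.restrict (Metric.ball (0 : 𝔼) 1))) := by
    have hm : AEStronglyMeasurable (Function.uncurry fun (θ : ℝ) (w : 𝔼) =>
        g (circleMap 0 1 θ • w)) ((volume.restrict (Set.Ioc 0 (2 * Real.pi))).prod
        (volume.restrict (Metric.ball (0 : 𝔼) 1))) := by
      rw [Measure.prod_restrict]
      exact hcont.aestronglyMeasurable (measurableSet_Ioc.prod measurableSet_ball)
    rw [integrable_prod_iff hm]
    refine ⟨Eventually.of_forall fun θ => integrableOn_rotation hg θ, ?_⟩
    simp only [Function.uncurry_apply_pair]
    simp_rw [setIntegral_rotation (fun w => ‖g w‖)]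
    exact integrable_const _
  -- Integrating over the ball first gives the same value for each rotation; integrating over the
  -- circle first gives 2π g(0), by the one-variable mean value property.
  have hswap := integral_integral_swap hint
  simp_rw [setIntegral_rotation g] at hswap
  rw [setIntegral_const, Real.volume_real_Ioc_of_le hpi, sub_zero] at hswap
  have h2 : ∫ w in Metric.ball (0 : 𝔼) 1, ∫ θ in Set.Ioc 0 (2 * Real.pi), g (circleMap 0 1 θ • w)
      = ∫ w in Metric.ball (0 : 𝔼) 1, (2 * Real.pi) • g 0 := by
    refine setIntegral_congr_fun measurableSet_ball fun w hw => ?_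
    rw [← average_rotation hd hw, smul_inv_smul₀ Real.two_pi_pos.ne',
      intervalIntegral.integral_of_le hpi]
  rw [h2, setIntegral_const, smul_comm] at hswap
  exact smul_right_injective _ Real.two_pi_pos.ne' hswap

lemma conj_kernelFun (z : CBall n) (w : 𝔼) :
    kernelFun z w * conj (kernelFun z w) = ((‖1 - inner ℂ (z : 𝔼) w‖ ^ (2 * (n + 1)))⁻¹ : ℝ) := by
  rw [RCLike.mul_conj, kernelFun, norm_inv, norm_pow]
  push_cast
  rw [inv_pow, ← pow_mul, mul_comm 2]
  rfl

/-- The reproducing formula. -/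
lemma setIntegral_mul_conj_kernelFun {f : 𝔼 → ℂ}
    (hd : DifferentiableOn ℂ f (Metric.ball (0 : 𝔼) 1))
    (hf : IntegrableOn f (Metric.ball (0 : 𝔼) 1)) (z : CBall n) :
    ∫ w in Metric.ball (0 : 𝔼) 1, f w * conj (kernelFun z w)
      = (volume (Metric.ball (0 : 𝔼) 1)).toReal • f z := by
  have hdz := defect_pos z
  have hd0 : (defect z : ℂ) ≠ 0 := by exact_mod_cast hdz.ne'
  -- After the change of variables φ_z, the Jacobian times the conjugate kernel becomes a constant
  -- times the holomorphic (1 - ⟨z,·⟩)^{n+1} at φ_z(w). So the integrand is holomorphic, and the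
  -- mean value property evaluates it at φ_z(0) = z.
  set F : 𝔼 → ℂ := fun w => f w * (1 - inner ℂ (z : 𝔼) w) ^ (n + 1) with hF
  have hFd : DifferentiableOn ℂ F (Metric.ball (0 : 𝔼) 1) :=
    hd.mul (((differentiable_const (1 : ℂ)).sub
      (innerSL ℂ (z : 𝔼)).differentiable).pow (n + 1)).differentiableOn
  have hmob : DifferentiableOn ℂ (mobiusExt z) (Metric.ball (0 : 𝔼) 1) := fun w hw =>
    (hasFDerivAt_mobiusExt z hw).differentiableAt.differentiableWithinAt
  have hFm : DifferentiableOn ℂ (F ∘ mobiusExt z) (Metric.ball (0 : 𝔼) 1) :=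
    hFd.comp hmob fun w hw => mobiusExt_mem_ball z hw
  have hkey : ∀ w ∈ Metric.ball (0 : 𝔼) 1,
      (defect z ^ (n + 1) / ‖1 - inner ℂ (z : 𝔼) w‖ ^ (2 * (n + 1))) •
        (f (mobiusExt z w) * conj (kernelFun z (mobiusExt z w)))
      = ((defect z : ℂ) ^ (n + 1))⁻¹ * F (mobiusExt z w) := by
    intro w hw
    have ha := one_sub_inner_ne_zero z hw
    have ha' := one_sub_inner_ne_zero z (mobiusExt_mem_ball z hw)
    have h1 : conj (kernelFun z (mobiusExt z w))
        = (1 - inner ℂ (z : 𝔼) (mobiusExt z w)) ^ (n + 1) *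
          ((‖1 - inner ℂ (z : 𝔼) (mobiusExt z w)‖ ^ (2 * (n + 1)))⁻¹ : ℝ) := by
      rw [← conj_kernelFun, ← mul_assoc, kernelFun, mul_inv_cancel₀ (pow_ne_zero _ ha'), one_mul]
    have hA : (‖1 - inner ℂ (z : 𝔼) w‖ : ℂ) ≠ 0 := by exact_mod_cast norm_ne_zero_iff.2 ha
    rw [h1, hF, Complex.real_smul]
    simp only
    have h2 : ‖1 - inner ℂ (z : 𝔼) (mobiusExt z w)‖ = defect z / ‖1 - inner ℂ (z : 𝔼) w‖ := by
      rw [one_sub_inner_mobiusExt z hw, norm_div, Complex.norm_real, Real.norm_of_nonneg hdz.le]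
    rw [h2, div_pow, inv_div]
    push_cast
    field_simp
    ring
  have hH : IntegrableOn (fun w => f w * conj (kernelFun z w)) (Metric.ball (0 : 𝔼) 1) := by
    refine Integrable.mul_bdd (c := ((1 - ‖(z : 𝔼)‖) ^ (n + 1))⁻¹) hf ?_ ?_
    · exact (Complex.continuous_conj.comp_continuousOn
        (differentiableOn_kernelFun z).continuousOn).aestronglyMeasurable measurableSet_ball
    · refine (ae_restrict_mem measurableSet_ball).mono fun w hw => ?_
      rw [RCLike.norm_conj, kernelFun, norm_inv, norm_pow]
      have := one_sub_norm_pos z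
      have := le_norm_one_sub_inner z hw
      gcongr
  have hFi : IntegrableOn (F ∘ mobiusExt z) (Metric.ball (0 : 𝔼) 1) := by
    rw [integrableOn_mobius z, integrableOn_congr_fun hkey measurableSet_ball] at hH
    have := hH.const_mul ((defect z : ℂ) ^ (n + 1))
    simp_rw [mul_inv_cancel_left₀ (pow_ne_zero (n + 1) hd0)] at this
    exact this
  rw [setIntegral_mobius z, setIntegral_congr_fun measurableSet_ball hkey, integral_const_mul]
  have hmv := setIntegral_ball_eq hFm hFi
  simp only [Function.comp_apply, mobiusExt_zero] at hmv
  have hz2 : 1 - inner ℂ (z : 𝔼) (z : 𝔼) = (defect z : ℂ) := by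
    rw [inner_self_coe, defect]; push_cast; ring
  rw [hmv, hF, Complex.real_smul, Complex.real_smul]
  simp only
  rw [hz2]
  field_simp

end MeanValue

end BergmanBall

namespace BergmanBall

/-! ### Volumes of Korányi regions -/

section Volume

variable {n : ℕ}

local notation "𝔼" => EuclideanSpace ℂ (Fin n)

/-- The Korányi region `|1 - ⟨z, w⟩| < t`, `1 - |w|² < h` of the ball. -/
def korRegion (z : 𝔼) (t h : ℝ) : Set 𝔼 :=
  {w | w ∈ Metric.ball (0 : 𝔼) 1 ∧ ‖1 - inner ℂ z w‖ < t ∧ 1 - ‖w‖ ^ 2 < h}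

lemma isOpen_korRegion (z : 𝔼) (t h : ℝ) : IsOpen (korRegion z t h) := by
  have h1 : IsOpen {w : 𝔼 | ‖1 - inner ℂ z w‖ < t} := isOpen_lt (by fun_prop) continuous_const
  have h2 : IsOpen {w : 𝔼 | 1 - ‖w‖ ^ 2 < h} := isOpen_lt (by fun_prop) continuous_const
  exact Metric.isOpen_ball.inter (h1.inter h2)

/-- A Korányi ball about a boundary point fits in an anisotropic box: size t along ζ and √t across
it. -/
lemma mem_lineScale_image {ζ : 𝔼} (hζ : ‖ζ‖ = 1) {t : ℝ} (ht : 0 < t) {w : 𝔼} (hw : ‖w‖ ≤ 1)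
    (hwt : ‖1 - inner ℂ ζ w‖ ≤ 2 * t) :
    w ∈ (fun x => ζ + x) '' (lineScale ζ t (√t : ℝ) '' Metric.closedBall 0 4) := by
  set a := inner ℂ ζ w - 1 with ha
  have hs : 0 < √t := Real.sqrt_pos.2 ht
  have hs2 : √t ^ 2 = t := Real.sq_sqrt ht.le
  have hsC : ((√t : ℝ) : ℂ) ≠ 0 := by exact_mod_cast hs.ne'
  have hsC2 : (t : ℂ) = ((√t : ℝ) : ℂ) ^ 2 := by exact_mod_cast hs2.symm
  have hζζ : inner ℂ ζ ζ = (1 : ℂ) := by rw [inner_self_coe, hζ]; simp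
  set u : 𝔼 := ((√t : ℝ) : ℂ)⁻¹ • (w - inner ℂ ζ w • ζ) + ((t : ℂ)⁻¹ * a) • ζ with hu
  have hu1 : inner ℂ ζ u = (t : ℂ)⁻¹ * a := by
    rw [hu, inner_add_right, inner_smul_right, inner_smul_right, inner_sub_right, inner_smul_right,
      hζζ]
    ring
  refine ⟨w - ζ, ⟨u, ?_, ?_⟩, by simp⟩
  · rw [mem_closedBall_zero_iff]
    have h1 : ‖w - inner ℂ ζ w • ζ‖ ≤ √t * 2 := by
      have h2 := norm_sub_inner_smul_sq_le hζ.le hw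
      rw [korDist_comm, korDist_sq] at h2
      refine abs_le_of_sq_le_sq ?_ (by positivity) |> (le_abs_self _).trans
      rw [mul_pow, hs2]; linarith
    calc ‖u‖ ≤ (√t)⁻¹ * ‖w - inner ℂ ζ w • ζ‖ + t⁻¹ * ‖a‖ := by
          refine (norm_add_le _ _).trans_eq ?_
          rw [norm_smul, norm_smul, norm_mul, norm_inv, norm_inv, Complex.norm_real,
            Complex.norm_real, Real.norm_of_nonneg hs.le, Real.norm_of_nonneg ht.le, hζ, mul_one]
      _ ≤ (√t)⁻¹ * (√t * 2) + t⁻¹ * (2 * t) := by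
          gcongr
          rw [ha, norm_sub_rev]; exact hwt
      _ = 4 := by field_simp; norm_num
  · rw [lineScale_apply, hu1, hζ, hu, ha, hsC2]
    push_cast
    match_scalars <;> field_simp
    ring

/-- The complex determinant is t · t^{(n-1)/2}; squaring it gives the real Jacobian t^{n+1}. -/
lemma volume_lineScale_image {ζ : 𝔼} (hζ : ‖ζ‖ = 1) {t : ℝ} (ht : 0 < t) (S : Set 𝔼) :
    volume (lineScale ζ t (√t : ℝ) '' S) = ENNReal.ofReal (t ^ (n + 1)) * volume S := by
  have hs : 0 < √t := Real.sqrt_pos.2 ht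
  have hs2 : √t ^ 2 = t := Real.sq_sqrt ht.le
  have h := Measure.addHaar_image_continuousLinearMap (volume : Measure 𝔼)
    ((lineScale ζ t (√t : ℝ)).restrictScalars ℝ) S
  have hd := abs_det_restrictScalars (lineScale ζ t (√t : ℝ))
  rw [ContinuousLinearMap.det] at hd
  rw [hd] at h
  have hdet := congrArg norm (det_lineScale (z := ζ) (a := (t : ℂ)) (s := ((√t : ℝ) : ℂ))
    (by exact_mod_cast hs.ne') (fun h0 => by simp [h0] at hζ))
  rw [norm_mul, norm_mul, norm_pow, Complex.norm_real, Complex.norm_real,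
    Real.norm_of_nonneg hs.le, Real.norm_of_nonneg ht.le] at hdet
  refine h.trans ?_
  congr 2
  set D := ‖LinearMap.det (lineScale ζ t (√t : ℝ) : 𝔼 →ₗ[ℂ] 𝔼)‖
  have h2 : D ^ 2 * t = t ^ (n + 1) * t := by
    calc D ^ 2 * t = (D * √t) ^ 2 := by rw [mul_pow, hs2]
      _ = (√t ^ 2) ^ n * t ^ 2 := by rw [hdet]; ring
      _ = t ^ (n + 1) * t := by rw [hs2]; ring
  exact mul_right_cancel₀ ht.ne' h2

variable (n) in
-- For t < 1 a nonempty region forces 1 - |z| < t, so z can be moved to z/|z| on the sphere at the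
-- cost of replacing t by 2t. For t ≥ 1 the whole ball is small enough.
lemma exists_volume_korRegion_le : ∃ C : ℝ, 0 < C ∧
    ∀ (z : 𝔼), ‖z‖ < 1 → ∀ t h : ℝ, 0 < t →
      volume (korRegion z t h) ≤ ENNReal.ofReal (C * t ^ (n + 1)) := by
  set V := (volume (Metric.closedBall (0 : 𝔼) 4)).toReal with hV
  have hVf : volume (Metric.closedBall (0 : 𝔼) 4) ≠ ∞ := measure_closedBall_lt_top.ne
  have hV0 : 0 ≤ V := ENNReal.toReal_nonneg
  have hVe : volume (Metric.closedBall (0 : 𝔼) 4) = ENNReal.ofReal V :=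
    (ENNReal.ofReal_toReal hVf).symm
  refine ⟨V + 1, by positivity, fun z hz t h ht => ?_⟩
  have hbound : volume (korRegion z t h) ≤ ENNReal.ofReal (V * t ^ (n + 1)) := by
    rcases le_or_gt 1 t with h1 | h1
    · calc volume (korRegion z t h) ≤ volume (Metric.closedBall (0 : 𝔼) 4) :=
            measure_mono fun w hw => Metric.ball_subset_closedBall
              (Metric.ball_subset_ball (by norm_num) hw.1)
        _ ≤ _ := by
            rw [hVe]
            exact ENNReal.ofReal_le_ofReal (le_mul_of_one_le_right hV0 (one_le_pow₀ h1))
    · rcases (korRegion z t h).eq_empty_or_nonempty with hE | ⟨w₀, hw₀⟩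
      · rw [hE]; simp
      · have hzt : 1 - ‖z‖ < t :=
          (le_norm_one_sub_inner ⟨z, mem_ball_zero_iff.2 hz⟩ hw₀.1).trans_lt hw₀.2.1
        have hz0 : 0 < ‖z‖ := by linarith
        have hzC : ((‖z‖ : ℝ) : ℂ) ≠ 0 := by exact_mod_cast hz0.ne'
        set ζ : 𝔼 := ((‖z‖ : ℝ) : ℂ)⁻¹ • z with hζ
        have hζ1 : ‖ζ‖ = 1 := by
          rw [hζ, norm_smul, norm_inv, Complex.norm_real, norm_norm, inv_mul_cancel₀ hz0.ne']
        have hsub : korRegion z t h ⊆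
            (fun x => ζ + x) '' (lineScale ζ t (√t : ℝ) '' Metric.closedBall 0 4) := by
          intro w hw
          have hw1 : ‖w‖ ≤ 1 := (mem_ball_zero_iff.1 hw.1).le
          refine mem_lineScale_image hζ1 ht hw1 ?_
          have h2 : 1 - inner ℂ ζ w = (1 - inner ℂ z w) - ((1 - ‖z‖ : ℝ) : ℂ) * inner ℂ ζ w := by
            have h3 : inner ℂ z w = ((‖z‖ : ℝ) : ℂ) * inner ℂ ζ w := by
              rw [hζ, inner_smul_left, map_inv₀, Complex.conj_ofReal]; field_simp
            rw [h3]; push_cast; ring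
          rw [h2]
          refine (norm_sub_le _ _).trans ?_
          rw [norm_mul, Complex.norm_real, Real.norm_of_nonneg (by linarith)]
          have := norm_inner_le_one hζ1.le hw1
          nlinarith [hw.2.1]
        calc volume (korRegion z t h) ≤ _ := measure_mono hsub
          _ = volume (lineScale ζ t (√t : ℝ) '' Metric.closedBall 0 4) := by
              rw [Set.image_add_left, measure_preimage_add]
          _ = ENNReal.ofReal (V * t ^ (n + 1)) := by
              rw [volume_lineScale_image hζ1 ht, hVe, ← ENNReal.ofReal_mul (by positivity),
                mul_comm]
  refine hbound.trans (ENNReal.ofReal_le_ofReal ?_)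
  gcongr
  linarith

lemma finrank_real_euclideanSpace : Module.finrank ℝ 𝔼 = 2 * n := by
  rw [← Module.finrank_mul_finrank ℝ ℂ]; simp

open scoped Pointwise in
/-- Dilated copies of a thin Korányi region are disjoint, which bounds its volume. -/
lemma mul_volume_korRegion_le {z : 𝔼} (hz : ‖z‖ < 1) {t h : ℝ} (h0 : 0 < h) (h1 : h < 1)
    (N : ℕ) (hNt : N * h ≤ t + h) (hN : 2 * (N * (n * h)) ≤ 1 + 2 * (n * h)) :
    N * (ENNReal.ofReal (1 / 2) * volume (korRegion z t h))
      ≤ volume (korRegion z (2 * t) 2) := by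
  set q : ℝ := 1 - h with hq
  have hq0 : 0 < q := by linarith
  have hq1 : q < 1 := by linarith
  -- Dilation by ρ m moves the shell 1 - h < |y|² < 1 into q^{m+1} < |x|² < q^m, so the copies are
  -- disjoint. By Bernoulli, `hNt` keeps 1 - ρ m ≤ t, so each copy stays in the region of size 2t,
  -- and `hN` keeps the volume factor (ρ m)^{2n} above 1/2.
  set ρ : ℕ → ℝ := fun m => √(q ^ m) with hρ
  have hρ0 : ∀ m, 0 < ρ m := fun m => Real.sqrt_pos.2 (by positivity)
  have hρ2 : ∀ m, ρ m ^ 2 = q ^ m := fun m => Real.sq_sqrt (by positivity)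
  have hρ1 : ∀ m, ρ m ≤ 1 := fun m => Real.sqrt_le_one.2 (pow_le_one₀ hq0.le hq1.le)
  set A : ℕ → Set 𝔼 := fun m => ρ m • korRegion z t h with hA
  have hAm : ∀ m, MeasurableSet (A m) := fun m =>
    (isOpen_korRegion z t h).measurableSet.const_smul_of_ne_zero (hρ0 m).ne'
  have hAr : ∀ m, ∀ x ∈ A m, q ^ (m + 1) < ‖x‖ ^ 2 ∧ ‖x‖ ^ 2 < q ^ m := by
    rintro m x ⟨y, hy, rfl⟩
    have hy1 : ‖y‖ < 1 := mem_ball_zero_iff.1 hy.1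
    have hy2 := hy.2.2
    have hqm : 0 < q ^ m := by positivity
    simp only [norm_smul, mul_pow, Real.norm_of_nonneg (hρ0 m).le, hρ2]
    constructor
    · rw [pow_succ]; nlinarith
    · have : ‖y‖ ^ 2 < 1 := by nlinarith [norm_nonneg y]
      nlinarith
  have hdisj : Pairwise (Function.onFun Disjoint A) := by
    have hlt : ∀ i j, i < j → Disjoint (A i) (A j) := fun i j hij => by
      rw [Set.disjoint_left]
      intro x hi hj
      have := (hAr i x hi).1
      have := (hAr j x hj).2
      have := pow_le_pow_of_le_one hq0.le hq1.le (Nat.succ_le_of_lt hij)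
      simp only [Nat.succ_eq_add_one] at this
      linarith
    intro i j hij
    rcases lt_or_gt_of_ne hij with h | h
    · exact hlt i j h
    · exact (hlt j i h).symm
  have hbern : ∀ (m k : ℕ), 1 - (m * k : ℝ) * h ≤ q ^ (m * k) := fun m k => by
    have := one_add_mul_le_pow (a := -h) (by linarith) (m * k)
    push_cast at this
    calc _ = 1 + (m * k : ℝ) * -h := by ring
      _ ≤ (1 + -h) ^ (m * k) := this
      _ = _ := by rw [hq]; ring
  have hmN : ∀ m ∈ Finset.range N, (m + 1 : ℝ) ≤ N := fun m hm => by
    exact_mod_cast Finset.mem_range.1 hm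
  have hsub : ∀ m ∈ Finset.range N, A m ⊆ korRegion z (2 * t) 2 := by
    rintro m hm x ⟨y, hy, rfl⟩
    have hy1 : ‖y‖ < 1 := mem_ball_zero_iff.1 hy.1
    have hm1 := hmN m hm
    have hmh : m * h ≤ t := by nlinarith
    have h3 : 1 - ρ m ≤ t := by
      have := hbern m 1
      rw [mul_one, ← hρ2] at this
      push_cast at this
      nlinarith [hρ0 m, hρ1 m]
    have hx1 : ‖ρ m • y‖ < 1 := by
      rw [norm_smul, Real.norm_of_nonneg (hρ0 m).le]
      nlinarith [hρ0 m, hρ1 m, norm_nonneg y]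
    refine ⟨mem_ball_zero_iff.2 hx1, ?_, by nlinarith [norm_nonneg (ρ m • y)]⟩
    have h4 : 1 - inner ℂ z (ρ m • y) = (1 - inner ℂ z y) + ((1 - ρ m : ℝ) : ℂ) * inner ℂ z y := by
      rw [inner_smul_right_eq_smul, Complex.real_smul]; push_cast; ring
    rw [h4]
    refine (norm_add_le _ _).trans_lt ?_
    rw [norm_mul, Complex.norm_real, Real.norm_of_nonneg (by linarith [hρ1 m])]
    have := norm_inner_le_one hz.le hy1.le
    nlinarith [hy.2.1, hρ1 m, norm_nonneg (inner ℂ z y)]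
  have hvol : ∀ m ∈ Finset.range N,
      ENNReal.ofReal (1 / 2) * volume (korRegion z t h) ≤ volume (A m) := by
    intro m hm
    rw [hA, Measure.addHaar_smul, finrank_real_euclideanSpace]
    gcongr
    rw [abs_of_pos (pow_pos (hρ0 m) _), pow_mul, hρ2, ← pow_mul]
    refine le_trans ?_ (hbern m n)
    have h5 := hmN m hm
    have h6 : (m + 1) * (n * h) ≤ N * (n * h) := by gcongr
    nlinarith
  calc N * (ENNReal.ofReal (1 / 2) * volume (korRegion z t h))
      = ∑ m ∈ Finset.range N, ENNReal.ofReal (1 / 2) * volume (korRegion z t h) := by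
        rw [Finset.sum_const, Finset.card_range, nsmul_eq_mul]
    _ ≤ ∑ m ∈ Finset.range N, volume (A m) := Finset.sum_le_sum hvol
    _ = volume (⋃ m ∈ Finset.range N, A m) :=
        (measure_biUnion_finset (fun i _ j _ hij => hdisj hij) fun m _ => hAm m).symm
    _ ≤ _ := measure_mono (Set.iUnion₂_subset hsub)

variable (n) in
-- About t/h disjoint dilates fit into a region of volume O(t^{n+1}), which trades a factor t for h.
-- This gain near the sphere is what makes negative powers of the defect integrable in the
-- Forelli–Rudin estimate.
lemma exists_volume_thin_korRegion_le : ∃ C : ℝ, 0 < C ∧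
    ∀ (z : 𝔼), ‖z‖ < 1 → ∀ t h : ℝ, 0 < t → 0 < h →
      volume (korRegion z t h) ≤ ENNReal.ofReal (C * (t ^ n * h)) := by
  obtain ⟨C, hC, hvol⟩ := exists_volume_korRegion_le n
  suffices H : ∃ C : ℝ, 0 < C ∧ ∀ (z : 𝔼), ‖z‖ < 1 → ∀ t h : ℝ,
      0 < t → t ≤ 3 → 0 < h → volume (korRegion z t h) ≤ ENNReal.ofReal (C * (t ^ n * h)) by
    obtain ⟨C, hC, H⟩ := H
    refine ⟨C, hC, fun z hz t h ht hh => ?_⟩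
    rcases le_or_gt t 3 with h3 | h3
    · exact H z hz t h ht h3 hh
    · have hsub : korRegion z t h ⊆ korRegion z 3 h := fun w hw => by
        have := korSq_le_two (⟨z, mem_ball_zero_iff.2 hz⟩ : CBall n) ⟨w, hw.1⟩
        exact ⟨hw.1, by unfold korSq at this; simp only at this; linarith, hw.2.2⟩
      refine (measure_mono hsub).trans ((H z hz 3 h (by norm_num) le_rfl hh).trans ?_)
      exact ENNReal.ofReal_le_ofReal (by gcongr)
  -- If t ≤ Bh the crude bound suffices. Otherwise ⌈t/(Bh)⌉ copies are used; with t ≤ 3 this B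
  -- forces h < 1 and makes both smallness conditions on the number of copies hold.
  set B : ℝ := 24 * (n + 1) with hB
  have hB0 : 24 ≤ B := by rw [hB]; nlinarith [(Nat.cast_nonneg n : (0 : ℝ) ≤ n)]
  refine ⟨C * 2 ^ (n + 2) * B, by positivity, fun z hz t h ht ht3 hh => ?_⟩
  have hpow : (1 : ℝ) ≤ 2 ^ (n + 2) := one_le_pow₀ (by norm_num)
  rcases le_or_gt t (B * h) with hth | hth
  · refine (hvol z hz t h ht).trans (ENNReal.ofReal_le_ofReal ?_)
    calc C * t ^ (n + 1) = C * (t ^ n * t) := by ring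
      _ ≤ C * (t ^ n * (B * h)) := by gcongr
      _ = C * 1 * B * (t ^ n * h) := by ring
      _ ≤ _ := by gcongr
  · have h1 : h < 1 := by nlinarith
    set x : ℝ := t / (B * h) with hx
    have hBh : 0 < B * h := by positivity
    have hxt : x * (B * h) = t := div_mul_cancel₀ _ hBh.ne'
    have hx1 : 1 < x := by rw [hx, lt_div_iff₀ hBh]; linarith
    set N := ⌈x⌉₊ with hN
    have hNx : x ≤ N := Nat.le_ceil x
    have hNx2 : (N : ℝ) < x + 1 := Nat.ceil_lt_add_one (by linarith)
    have hxh : x * h * B = t := by linarith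
    have hxh' : x * h * n ≤ t / 24 := by
      have : x * h * n * 24 ≤ x * h * B := by
        have : 0 < x * h := by positivity
        rw [hB]; nlinarith
      linarith
    have hxh2 : x * h ≤ t := by
      have : x * h * 1 ≤ x * h * B := by gcongr; linarith
      linarith
    have hmain := mul_volume_korRegion_le hz hh h1 N (by nlinarith) (t := t) (by
      have : (N : ℝ) * (n * h) ≤ (x + 1) * (n * h) := by gcongr
      nlinarith)
    have hfin : volume (korRegion z t h) ≠ ∞ :=
      ((hvol z hz t h ht).trans_lt ENNReal.ofReal_lt_top).ne
    rw [← ENNReal.ofReal_toReal hfin]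
    set V := (volume (korRegion z t h)).toReal with hV
    have h2 : (N : ℝ) * (1 / 2 * V) ≤ C * (2 * t) ^ (n + 1) := by
      have h3 := hmain.trans (hvol z hz (2 * t) 2 (by positivity))
      rw [← ENNReal.ofReal_toReal hfin, ← ENNReal.ofReal_natCast,
        ← ENNReal.ofReal_mul (by norm_num), ← ENNReal.ofReal_mul (by positivity)] at h3
      exact (ENNReal.ofReal_le_ofReal_iff (by positivity)).1 h3
    have hV0 : 0 ≤ V := ENNReal.toReal_nonneg
    refine ENNReal.ofReal_le_ofReal ?_
    have h4 : x * V ≤ 2 * (C * (2 * t) ^ (n + 1)) := by nlinarith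
    have h5 : x * V ≤ x * (C * 2 ^ (n + 2) * B * (t ^ n * h)) := by
      refine h4.trans_eq ?_
      calc 2 * (C * (2 * t) ^ (n + 1)) = C * 2 ^ (n + 2) * (t ^ n * t) := by ring
        _ = C * 2 ^ (n + 2) * (t ^ n * (x * (B * h))) := by rw [hxt]
        _ = _ := by ring
    exact le_of_mul_le_mul_left h5 (by linarith)

lemma ballMeasure_apply (S : Set (CBall n)) : ballMeasure n S
    = (volume (Metric.ball (0 : 𝔼) 1))⁻¹ * volume (Subtype.val '' S) := by
  rw [ballMeasure, Measure.smul_apply, smul_eq_mul,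
    comap_subtype_coe_apply Metric.isOpen_ball.measurableSet]

variable (n) in
lemma exists_ballMeasure_thin_le : ∃ C : ℝ, 0 < C ∧ ∀ (z : CBall n) (t h : ℝ),
    0 < t → 0 < h →
      ballMeasure n {w | korSq z w < t ∧ defect w < h} ≤ ENNReal.ofReal (C * (t ^ n * h)) := by
  obtain ⟨C, hC, H⟩ := exists_volume_thin_korRegion_le n
  have hB0 := (Metric.measure_ball_pos (volume : Measure 𝔼) 0 one_pos).ne'
  have hBt : volume (Metric.ball (0 : 𝔼) 1) ≠ ∞ := measure_ball_lt_top.ne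
  set b := (volume (Metric.ball (0 : 𝔼) 1)).toReal with hb
  have hb0 : 0 < b := ENNReal.toReal_pos hB0 hBt
  refine ⟨b⁻¹ * C, by positivity, fun z t h ht hh => ?_⟩
  rw [ballMeasure_apply, ← ENNReal.ofReal_toReal hBt, ← hb, ← ENNReal.ofReal_inv_of_pos hb0,
    mul_assoc, ENNReal.ofReal_mul (by positivity)]
  gcongr
  refine (measure_mono ?_).trans (H z (norm_lt_one z) t h ht hh)
  rintro _ ⟨w, hw, rfl⟩
  exact ⟨w.2, hw.1, hw.2⟩

variable (n) in
lemma exists_ballMeasure_korSq_lt_le : ∃ C : ℝ, 0 < C ∧ ∀ (z : CBall n) (t : ℝ),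
    0 < t → ballMeasure n {w | korSq z w < t} ≤ ENNReal.ofReal (C * t ^ (n + 1)) := by
  obtain ⟨C, hC, H⟩ := exists_ballMeasure_thin_le n
  refine ⟨C * 2, by positivity, fun z t ht => ?_⟩
  refine (measure_mono fun w hw => ?_).trans ((H z t (2 * t) ht (by positivity)).trans_eq ?_)
  · have hw' : korSq z w < t := hw
    have := defect_le_two_korSq w z
    rw [korSq_comm] at this
    exact ⟨hw', by linarith⟩
  · congr 1; ring

end Volume

/-! ### The Forelli–Rudin estimate by dyadic decomposition -/

section ForelliRudin

variable {n : ℕ}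

/-- Two dyadic scales: k locates X = |1 - ⟨z,w⟩| above δ, and j locates Y = 1 - |w|² below 4 · 2^k
δ, which exceeds 2X. -/
lemma forelliRudin_pointwise {δ X Y a : ℝ} (ha : 0 < a) (hδ : 0 < δ) (hX : δ ≤ X) (hY : 0 < Y)
    (hYX : Y ≤ 2 * X) :
    ∃ k j : ℕ, X < 2 ^ (k + 1) * δ ∧ Y < (1 / 2) ^ j * (2 ^ (k + 3) * δ) ∧
      (X ^ (n + 1))⁻¹ * Y ^ (-a) ≤ ((2 ^ k * δ) ^ (n + 1))⁻¹ *
        ((1 / 2) ^ j * (2 ^ k * δ)) ^ (-a) := by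
  obtain ⟨k, hk1, hk2⟩ := exists_nat_pow_near ((one_le_div hδ).2 hX) (one_lt_two (α := ℝ))
  rw [le_div_iff₀ hδ] at hk1
  rw [div_lt_iff₀ hδ] at hk2
  have hp : (0 : ℝ) < 2 ^ k * δ := by positivity
  have hY1 : Y / (4 * (2 ^ k * δ)) ≤ 1 := by
    rw [div_le_one (by positivity)]
    rw [pow_succ] at hk2; linarith
  obtain ⟨j, hj1, hj2⟩ := exists_nat_pow_near_of_lt_one (by positivity) hY1
    (by norm_num : (0 : ℝ) < 1 / 2) (by norm_num)
  rw [lt_div_iff₀ (by positivity)] at hj1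
  rw [div_le_iff₀ (by positivity)] at hj2
  have hj0 : (0 : ℝ) < (1 / 2) ^ j := by positivity
  refine ⟨k, j, hk2, hj2.trans_lt ?_, ?_⟩
  · rw [pow_add]
    have : 0 < (1 / 2 : ℝ) ^ j * (2 ^ k * δ) := by positivity
    nlinarith
  · have h1 : Y ^ (-a) ≤ ((1 / 2) ^ j * (2 ^ k * δ)) ^ (-a) := by
      refine Real.rpow_le_rpow_of_nonpos (by positivity) ?_ (by linarith)
      rw [pow_succ] at hj1
      have : 0 < (1 / 2 : ℝ) ^ j * (2 ^ k * δ) := by positivity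
      nlinarith
    gcongr

/-- The Forelli–Rudin estimate. -/
lemma exists_forelliRudin (n : ℕ) {a : ℝ} (ha : 0 < a) (ha1 : a < 1) : ∃ C : ℝ≥0∞, C ≠ ∞ ∧
    ∀ z : CBall n, ∫⁻ w, ENNReal.ofReal ((korSq z w ^ (n + 1))⁻¹ * defect w ^ (-a))
      ∂(ballMeasure n) ≤ C * ENNReal.ofReal (defect z ^ (-a)) := by
  obtain ⟨C, hC, hvol⟩ := exists_ballMeasure_thin_le n
  -- With the thin-region volume bound, the term of indices (k, j) is at most a constant times
  -- δ^{-a} 2^{-ka} 2^{-j(1-a)}. Both geometric series converge exactly because 0 < a < 1.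
  set r : ℝ := (2 : ℝ) ^ (-a) with hr
  set s : ℝ := (2 : ℝ) ^ (a - 1) with hs
  have hr0 : 0 < r := by positivity
  have hs0 : 0 < s := by positivity
  have hr1 : r < 1 := Real.rpow_lt_one_of_one_lt_of_neg one_lt_two (by linarith)
  have hs1 : s < 1 := Real.rpow_lt_one_of_one_lt_of_neg one_lt_two (by linarith)
  set K : ℝ := C * 2 ^ (n + 3) * (1 / 2 : ℝ) ^ (-a) with hK
  have hK0 : 0 < K := by positivity
  refine ⟨ENNReal.ofReal K * ((1 - ENNReal.ofReal r)⁻¹ * (1 - ENNReal.ofReal s)⁻¹), ?_, fun z => ?_⟩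
  · have h1 : (1 - ENNReal.ofReal r)⁻¹ ≠ ∞ := by
      rw [ENNReal.inv_ne_top]
      exact (tsub_pos_of_lt (by simpa using hr1)).ne'
    have h2 : (1 - ENNReal.ofReal s)⁻¹ ≠ ∞ := by
      rw [ENNReal.inv_ne_top]
      exact (tsub_pos_of_lt (by simpa using hs1)).ne'
    exact ENNReal.mul_ne_top ENNReal.ofReal_ne_top (ENNReal.mul_ne_top h1 h2)
  set δ : ℝ := 1 / 2 * defect z with hδ
  have hδ0 : 0 < δ := by have := defect_pos z; positivity
  let c : ℕ → ℕ → ℝ := fun k j => ((2 ^ k * δ) ^ (n + 1))⁻¹ * ((1 / 2) ^ j * (2 ^ k * δ)) ^ (-a)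
  let Q : ℕ → ℕ → Set (CBall n) := fun k j =>
    {w | korSq z w < 2 ^ (k + 1) * δ ∧ defect w < (1 / 2) ^ j * (2 ^ (k + 3) * δ)}
  have hQm : ∀ k j, MeasurableSet (Q k j) := fun k j => by
    have h1 : Continuous fun w => korSq z w := by unfold korSq; fun_prop
    exact (measurableSet_lt h1.measurable measurable_const).inter
      (measurableSet_lt continuous_defect.measurable measurable_const)
  have hpt : ∀ w, ENNReal.ofReal ((korSq z w ^ (n + 1))⁻¹ * defect w ^ (-a))
      ≤ ∑' k, ∑' j, (Q k j).indicator (fun _ => ENNReal.ofReal (c k j)) w := by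
    intro w
    obtain ⟨k, j, h1, h2, h3⟩ := forelliRudin_pointwise (n := n) ha hδ0
      (X := korSq z w) (by linarith [defect_le_two_korSq z w]) (defect_pos w)
      (by have := defect_le_two_korSq w z; rwa [korSq_comm] at this)
    have hw : w ∈ Q k j := ⟨h1, h2⟩
    calc _ ≤ (Q k j).indicator (fun _ => ENNReal.ofReal (c k j)) w := by
          rw [Set.indicator_of_mem hw]; exact ENNReal.ofReal_le_ofReal h3
      _ ≤ ∑' j, (Q k j).indicator (fun _ => ENNReal.ofReal (c k j)) w := ENNReal.le_tsum j
      _ ≤ _ := ENNReal.le_tsum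
            (f := fun k => ∑' j, (Q k j).indicator (fun _ => ENNReal.ofReal (c k j)) w) k
  have hterm : ∀ k j, ENNReal.ofReal (c k j) * ballMeasure n (Q k j)
      ≤ ENNReal.ofReal K * ENNReal.ofReal (defect z ^ (-a)) * ENNReal.ofReal r ^ k *
        ENNReal.ofReal s ^ j := by
    intro k j
    have hp : (0 : ℝ) < 2 ^ k * δ := by positivity
    have hj : (0 : ℝ) < (1 / 2) ^ j := by positivity
    calc _ ≤ ENNReal.ofReal (c k j) * ENNReal.ofReal (C * ((2 ^ (k + 1) * δ) ^ n *
          ((1 / 2) ^ j * (2 ^ (k + 3) * δ)))) := by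
          gcongr
          exact hvol z _ _ (by positivity) (by positivity)
      _ = ENNReal.ofReal (K * defect z ^ (-a) * r ^ k * s ^ j) := by
          rw [← ENNReal.ofReal_mul (by positivity)]
          congr 1
          have e1 : ((1 / 2 : ℝ) ^ j * (2 ^ k * δ)) ^ (-a)
              = ((1 / 2 : ℝ) ^ j) ^ (-a) * (r ^ k * ((1 / 2 : ℝ) ^ (-a) * defect z ^ (-a))) := by
            rw [Real.mul_rpow hj.le hp.le, Real.mul_rpow (by positivity) hδ0.le, hδ,
              Real.mul_rpow (by positivity) (defect_pos z).le, hr, ← Real.rpow_natCast 2 k,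
              ← Real.rpow_natCast _ k, ← Real.rpow_mul (by norm_num), ← Real.rpow_mul (by norm_num),
              mul_comm (k : ℝ)]
          have e2 : ((1 / 2 : ℝ) ^ j) ^ (-a) * (1 / 2) ^ j = s ^ j := by
            rw [← Real.rpow_natCast _ j, ← Real.rpow_mul (by norm_num), ← Real.rpow_add (by norm_num),
              one_div, Real.inv_rpow (by norm_num), ← Real.rpow_neg (by norm_num), hs,
              ← Real.rpow_natCast _ j, ← Real.rpow_mul (by norm_num)]
            congr 1; ring
          simp only [c]
          rw [e1, ← e2, hK]
          field_simp
          ring_nf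
      _ = _ := by
          have := defect_pos z
          rw [ENNReal.ofReal_mul (by positivity), ENNReal.ofReal_mul (by positivity),
            ENNReal.ofReal_mul (by positivity), ENNReal.ofReal_pow hr0.le,
            ENNReal.ofReal_pow hs0.le]
  calc _ ≤ ∫⁻ w, ∑' k, ∑' j, (Q k j).indicator (fun _ => ENNReal.ofReal (c k j)) w
        ∂(ballMeasure n) := lintegral_mono hpt
    _ = ∑' k, ∑' j, ENNReal.ofReal (c k j) * ballMeasure n (Q k j) := by
        rw [lintegral_tsum fun k => (Measurable.tsum fun j =>
          measurable_const.indicator (hQm k j)).aemeasurable]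
        congr 1; ext k
        rw [lintegral_tsum fun j => (measurable_const.indicator (hQm k j)).aemeasurable]
        congr 1; ext j
        rw [lintegral_indicator_const (hQm k j)]
    _ ≤ ∑' k, ∑' j, ENNReal.ofReal K * ENNReal.ofReal (defect z ^ (-a)) * ENNReal.ofReal r ^ k *
        ENNReal.ofReal s ^ j := ENNReal.tsum_le_tsum fun k => ENNReal.tsum_le_tsum fun j => hterm k j
    _ = _ := by
        simp_rw [ENNReal.tsum_mul_left, ENNReal.tsum_geometric, ENNReal.tsum_mul_right,
          ENNReal.tsum_mul_left, ENNReal.tsum_geometric]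
        ring_nf

end ForelliRudin

end BergmanBall

namespace BergmanBall

/-! ### The Schur test -/

section Schur

variable {X : Type*} [MeasurableSpace X] {μ : Measure X}

/-- The Schur test, with a common bound for both marginals. -/
lemma lintegral_schur [SFinite μ] {p q : ℝ} (hpq : p.HolderConjugate q) {k : X → X → ℝ≥0∞}
    (hk : Measurable (Function.uncurry k)) {g : X → ℝ≥0∞} (hg : Measurable g)
    (hg0 : ∀ x, g x ≠ 0) (hgt : ∀ x, g x ≠ ∞) {C : ℝ≥0∞}
    (h1 : ∀ w, ∫⁻ z, k w z * g z ^ q ∂μ ≤ C * g w ^ q)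
    (h2 : ∀ z, ∫⁻ w, k w z * g w ^ p ∂μ ≤ C * g z ^ p)
    {φ : X → ℝ≥0∞} (hφ : Measurable φ) :
    ∫⁻ w, (∫⁻ z, k w z * φ z ∂μ) ^ p ∂μ ≤ C ^ p * ∫⁻ z, φ z ^ p ∂μ := by
  have hp0 : 0 < p := hpq.pos
  have hq0 : 0 < q := hpq.symm.pos
  have hkw : ∀ w, Measurable (k w) := fun w => hk.comp measurable_prodMk_left
  have hkz : ∀ z, Measurable fun w => k w z := fun z => hk.comp measurable_prodMk_right
  have hpt : ∀ w, (∫⁻ z, k w z * φ z ∂μ) ^ p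
      ≤ C ^ (p / q) * (g w ^ p * ∫⁻ z, k w z * (φ z ^ p * (g z ^ p)⁻¹) ∂μ) := by
    intro w
    -- Hölder is applied to k^{1/q} g and k^{1/p} φ/g: the first factor is handled by `h1`, and `h2`
    -- enters after Tonelli.
    have hsplit : ∀ z, k w z * φ z
        = ((fun z => k w z ^ (1 / q) * g z) * fun z => k w z ^ (1 / p) * (φ z * (g z)⁻¹)) z := by
      intro z
      have e : k w z = k w z ^ (1 / q) * k w z ^ (1 / p) := by
        rw [← ENNReal.rpow_add_of_nonneg _ _ (by positivity) (by positivity)]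
        have : 1 / q + 1 / p = 1 := by
          rw [add_comm, one_div, one_div]; exact hpq.inv_add_inv_eq_one
        rw [this, ENNReal.rpow_one]
      calc k w z * φ z = (k w z ^ (1 / q) * k w z ^ (1 / p)) * φ z * (g z * (g z)⁻¹) := by
            rw [← e, ENNReal.mul_inv_cancel (hg0 z) (hgt z), mul_one]
        _ = _ := by simp only [Pi.mul_apply]; ring
    have hH := ENNReal.lintegral_mul_le_Lp_mul_Lq μ hpq.symm
      (f := fun z => k w z ^ (1 / q) * g z) (g := fun z => k w z ^ (1 / p) * (φ z * (g z)⁻¹))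
      (((hkw w).pow_const _).mul hg).aemeasurable
      (((hkw w).pow_const _).mul (hφ.mul hg.inv)).aemeasurable
    have hA : ∀ z, (k w z ^ (1 / q) * g z) ^ q = k w z * g z ^ q := fun z => by
      rw [ENNReal.mul_rpow_of_nonneg _ _ hq0.le, ← ENNReal.rpow_mul, one_div_mul_cancel hq0.ne',
        ENNReal.rpow_one]
    have hB : ∀ z, (k w z ^ (1 / p) * (φ z * (g z)⁻¹)) ^ p = k w z * (φ z ^ p * (g z ^ p)⁻¹) :=
      fun z => by
        rw [ENNReal.mul_rpow_of_nonneg _ _ hp0.le, ← ENNReal.rpow_mul, one_div_mul_cancel hp0.ne',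
          ENNReal.rpow_one, ENNReal.mul_rpow_of_nonneg _ _ hp0.le, ENNReal.inv_rpow]
    simp_rw [hA, hB] at hH
    simp_rw [hsplit]
    calc _ ≤ ((C * g w ^ q) ^ (1 / q) * (∫⁻ z, k w z * (φ z ^ p * (g z ^ p)⁻¹) ∂μ) ^ (1 / p)) ^ p := by
          gcongr
          refine hH.trans ?_
          gcongr
          exact h1 w
      _ = _ := by
          have e1 : 1 / q * p = p / q := by ring
          have e2 : q * (p / q) = p := by field_simp
          rw [ENNReal.mul_rpow_of_nonneg _ _ hp0.le, ← ENNReal.rpow_mul, ← ENNReal.rpow_mul,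
            one_div_mul_cancel hp0.ne', ENNReal.rpow_one, e1,
            ENNReal.mul_rpow_of_nonneg _ _ (by positivity), ← ENNReal.rpow_mul, e2, mul_assoc]
  have hCp : C ^ (p / q) * C = C ^ p := by
    conv_lhs => rw [← ENNReal.rpow_one C, ← ENNReal.rpow_mul,
      ← ENNReal.rpow_add_of_nonneg _ _ (by positivity) zero_le_one]
    congr 1
    have := hpq.inv_add_inv_eq_one
    field_simp at this ⊢
    linarith
  have hint : Measurable (Function.uncurry fun w z =>
      g w ^ p * (k w z * (φ z ^ p * (g z ^ p)⁻¹))) :=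
    ((hg.pow_const _).comp measurable_fst).mul (hk.mul
      (((hφ.pow_const _).mul (hg.pow_const _).inv).comp measurable_snd))
  calc _ ≤ ∫⁻ w, C ^ (p / q) * (g w ^ p * ∫⁻ z, k w z * (φ z ^ p * (g z ^ p)⁻¹) ∂μ) ∂μ :=
        lintegral_mono hpt
    _ = C ^ (p / q) * ∫⁻ w, ∫⁻ z, g w ^ p * (k w z * (φ z ^ p * (g z ^ p)⁻¹)) ∂μ ∂μ := by
        rw [lintegral_const_mul]
        · congr 1
          refine lintegral_congr fun w => ?_
          exact (lintegral_const_mul _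
            ((hkw w).mul ((hφ.pow_const _).mul (hg.pow_const _).inv))).symm
        · exact (hg.pow_const _).mul (Measurable.lintegral_prod_right' (ν := μ)
            (hk.mul (((hφ.pow_const _).mul (hg.pow_const _).inv).comp measurable_snd)))
    _ = C ^ (p / q) * ∫⁻ z, ∫⁻ w, g w ^ p * (k w z * (φ z ^ p * (g z ^ p)⁻¹)) ∂μ ∂μ := by
        rw [lintegral_lintegral_swap hint.aemeasurable]
    _ ≤ C ^ (p / q) * ∫⁻ z, C * φ z ^ p ∂μ := by
        gcongr with z
        calc _ = ∫⁻ w, (φ z ^ p * (g z ^ p)⁻¹) * (k w z * g w ^ p) ∂μ :=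
              lintegral_congr fun w => by ring
          _ = (φ z ^ p * (g z ^ p)⁻¹) * ∫⁻ w, k w z * g w ^ p ∂μ :=
              lintegral_const_mul _ ((hkz z).mul (hg.pow_const _))
          _ ≤ (φ z ^ p * (g z ^ p)⁻¹) * (C * g z ^ p) := by gcongr; exact h2 z
          _ = C * φ z ^ p * ((g z ^ p)⁻¹ * g z ^ p) := by ring
          _ = _ := by
              rw [ENNReal.inv_mul_cancel, mul_one]
              · exact (ENNReal.rpow_pos (pos_iff_ne_zero.2 (hg0 z)) (hgt z)).ne'
              · exact ENNReal.rpow_ne_top_of_nonneg hp0.le (hgt z)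
    _ = _ := by
        rw [lintegral_const_mul _ (hφ.pow_const _), ← mul_assoc, hCp]

end Schur

/-! ### Kernels as elements of A^p and point evaluations -/

section KernelElements

variable {n : ℕ}

local notation "𝔼" => EuclideanSpace ℂ (Fin n)

/-- The second variable ranges over a compact set, so currying gives continuity of z ↦ K_z in the
sup norm, and from there in every A^p and for evaluation functionals in operator norm. -/
lemma continuous_kernelFun_closedBall : Continuous
    fun x : CBall n × Metric.closedBall (0 : 𝔼) 1 => kernelFun x.1 (x.2 : 𝔼) := by
  unfold kernelFun
  refine Continuous.inv₀ (by fun_prop) fun x => pow_ne_zero _ ?_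
  have h1 := norm_lt_one x.1
  have h2 : ‖(x.2 : 𝔼)‖ ≤ 1 := mem_closedBall_zero_iff.1 x.2.2
  intro h
  have h3 : ‖inner ℂ (x.1 : 𝔼) (x.2 : 𝔼)‖ = 1 := by
    rw [← sub_eq_zero.1 h, norm_one]
  have h4 := norm_inner_le_norm (𝕜 := ℂ) (x.1 : 𝔼) (x.2 : 𝔼)
  nlinarith [norm_nonneg (x.1 : 𝔼), norm_nonneg (x.2 : 𝔼)]

/-- The kernel function as a bounded continuous function on the ball. -/
noncomputable def bddKernel (z : CBall n) : BoundedContinuousFunction (CBall n) ℂ :=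
  (BoundedContinuousFunction.mkOfCompact
    (ContinuousMap.curry ⟨_, continuous_kernelFun_closedBall (n := n)⟩ z)).compContinuous
    ⟨Set.inclusion Metric.ball_subset_closedBall, continuous_inclusion _⟩

lemma bddKernel_apply (z w : CBall n) : bddKernel z w = kernelFun z w := rfl

lemma continuous_bddKernel : Continuous (bddKernel (n := n)) := by
  refine (BoundedContinuousFunction.continuous_compContinuous _).comp ?_
  exact (ContinuousMap.isometryEquivBoundedOfCompact _ ℂ).continuous.comp
    (ContinuousMap.curry _).continuous

lemma kernel_coe_eq (p : ℝ≥0∞) [Fact (1 ≤ p)] (z : CBall n) :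
    (kernel n p z : Lp ℂ p (ballMeasure n))
      = BoundedContinuousFunction.toLp p (ballMeasure n) ℂ (bddKernel z) := by
  apply Lp.ext
  refine (memLp_kernelFun p z).coeFn_toLp.trans ?_
  filter_upwards [BoundedContinuousFunction.coeFn_toLp p (ballMeasure n) ℂ (bddKernel z)] with w hw
  rw [hw, bddKernel_apply]

lemma continuous_kernel (p : ℝ≥0∞) [Fact (1 ≤ p)] : Continuous (kernel n p) := by
  rw [continuous_induced_rng]
  have h : (Subtype.val ∘ kernel n p) = fun z =>
      BoundedContinuousFunction.toLp p (ballMeasure n) ℂ (bddKernel z) :=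
    funext fun z => kernel_coe_eq p z
  rw [h]
  exact (BoundedContinuousFunction.toLp p (ballMeasure n) ℂ).continuous.comp continuous_bddKernel

lemma kernel_ae (p : ℝ≥0∞) (z : CBall n) :
    (kernel n p z : Lp ℂ p (ballMeasure n)) =ᵐ[ballMeasure n] fun w => kernelFun z w :=
  (memLp_kernelFun p z).coeFn_toLp

lemma integral_ballMeasure {F : Type*} [NormedAddCommGroup F] [NormedSpace ℝ F] (g : 𝔼 → F) :
    ∫ z : CBall n, g z ∂(ballMeasure n) = ((volume (Metric.ball (0 : 𝔼) 1))⁻¹).toReal •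
      ∫ z in Metric.ball (0 : 𝔼) 1, g z := by
  rw [ballMeasure, integral_smul_measure, integral_subtype_comap measurableSet_ball]

lemma integrable_ballMeasure {g : 𝔼 → ℂ}
    (hg : Integrable (fun z : CBall n => g z) (ballMeasure n)) :
    IntegrableOn g (Metric.ball (0 : 𝔼) 1) := by
  have hB0 := (Metric.measure_ball_pos (volume : Measure 𝔼) 0 one_pos).ne'
  have hBt : volume (Metric.ball (0 : 𝔼) 1) ≠ ∞ := measure_ball_lt_top.ne
  rw [ballMeasure, integrable_smul_measure (ENNReal.inv_ne_zero.2 hBt) (ENNReal.inv_ne_top.2 hB0)]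
    at hg
  exact (integrableOn_iff_comap_subtypeVal measurableSet_ball).2 hg

variable {p p' : ℝ≥0∞} [Fact (1 ≤ p)] [Fact (1 ≤ p')] [p.HolderConjugate p']

/-- Evaluation at a point, as a functional on the Bergman space. -/
noncomputable def ev (p p' : ℝ≥0∞) [Fact (1 ≤ p)] [Fact (1 ≤ p')] [p.HolderConjugate p']
    (w : CBall n) : Bergman n p →L[ℂ] ℂ :=
  ((ContinuousLinearMap.lpPairing (ballMeasure n) p p' (ContinuousLinearMap.mul ℂ ℂ)).flip
    (BoundedContinuousFunction.toLp p' (ballMeasure n) ℂ (star (bddKernel w)))).comp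
    (Bergman n p).subtypeL

lemma ev_eq_pairing (w : CBall n) (f : Bergman n p) : ev p p' w f = pairing f (kernel n p' w) := by
  change ContinuousLinearMap.lpPairing (ballMeasure n) p p' (ContinuousLinearMap.mul ℂ ℂ) f
    (BoundedContinuousFunction.toLp p' (ballMeasure n) ℂ (star (bddKernel w))) = _
  rw [ContinuousLinearMap.lpPairing_eq_integral, pairing]
  refine integral_congr_ae ?_
  filter_upwards [BoundedContinuousFunction.coeFn_toLp p' (ballMeasure n) ℂ (star (bddKernel w)),
    kernel_ae p' w] with z h1 h2
  rw [h1, h2]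
  rfl

lemma ev_eq_integral (w : CBall n) (f : Bergman n p) : ev p p' w f
    = ∫ z, (f : Lp ℂ p (ballMeasure n)) z * kernelFun z (w : 𝔼) ∂(ballMeasure n) := by
  rw [ev_eq_pairing, pairing]
  refine integral_congr_ae ?_
  filter_upwards [kernel_ae p' w] with z h2
  rw [h2, kernelFun, kernelFun, map_inv₀, map_pow, map_sub, map_one, inner_conj_symm]

lemma continuous_ev : Continuous (ev p p' : CBall n → Bergman n p →L[ℂ] ℂ) := by
  unfold ev
  refine (ContinuousLinearMap.precomp ℂ (Bergman n p).subtypeL).continuous.comp ?_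
  refine (ContinuousLinearMap.flip (ContinuousLinearMap.lpPairing (ballMeasure n) p p'
    (ContinuousLinearMap.mul ℂ ℂ))).continuous.comp ?_
  refine (BoundedContinuousFunction.toLp p' (ballMeasure n) ℂ).continuous.comp ?_
  exact continuous_star.comp continuous_bddKernel

/-- `ev` is built as the pairing with K_w, hence bounded by construction; the reproducing formula
shows that it is evaluation of the holomorphic representative. -/
lemma ev_eq_of_ae {f : Bergman n p} {g : 𝔼 → ℂ} (hg : DifferentiableOn ℂ g (Metric.ball 0 1))
    (hfg : (f : Lp ℂ p (ballMeasure n)) =ᵐ[ballMeasure n] fun z => g z) (w : CBall n) :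
    ev p p' w f = g w := by
  have hB0 := (Metric.measure_ball_pos (volume : Measure 𝔼) 0 one_pos).ne'
  have hBt : volume (Metric.ball (0 : 𝔼) 1) ≠ ∞ := measure_ball_lt_top.ne
  have hint : Integrable (fun z : CBall n => g z) (ballMeasure n) :=
    (((Lp.memLp (f : Lp ℂ p (ballMeasure n))).integrable Fact.out).congr hfg)
  rw [ev_eq_pairing, pairing]
  have h1 : ∫ z, (f : Lp ℂ p (ballMeasure n)) z *
      conj ((kernel n p' w : Lp ℂ p' (ballMeasure n)) z) ∂(ballMeasure n)
      = ∫ z : CBall n, g z * conj (kernelFun w (z : 𝔼)) ∂(ballMeasure n) := by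
    refine integral_congr_ae ?_
    filter_upwards [hfg, kernel_ae p' w] with z h1 h2
    rw [h1, h2]
  rw [h1, integral_ballMeasure (fun z => g z * conj (kernelFun w z)),
    setIntegral_mul_conj_kernelFun hg (integrable_ballMeasure hint), smul_smul, ENNReal.toReal_inv,
    inv_mul_cancel₀ (ENNReal.toReal_pos hB0 hBt).ne', one_smul]

lemma coe_ae_eq_ev (f : Bergman n p) :
    (f : Lp ℂ p (ballMeasure n)) =ᵐ[ballMeasure n] fun w => ev p p' w f := by
  obtain ⟨g, hg, hfg⟩ := f.2
  filter_upwards [hfg] with w hw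
  rw [hw, ev_eq_of_ae hg hfg]

lemma ev_kernel (z w : CBall n) : ev p p' w (kernel n p z) = kernelFun z (w : 𝔼) :=
  ev_eq_of_ae (differentiableOn_kernelFun z) (kernel_ae p z) w

end KernelElements

/-- ‖K_z‖² = ⟨K_z, K_z⟩ = K_z(z) by the reproducing property. -/
lemma kernelNorm_eq {n : ℕ} (z : CBall n) : kernelNorm z = defect z ^ (-((n + 1 : ℝ) / 2)) := by
  have h1 : ((‖kernel n 2 z‖ ^ 2 : ℝ) : ℂ) = ((defect z ^ (n + 1))⁻¹ : ℝ) := by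
    have h2 := ev_kernel (p := 2) (p' := 2) z z
    rw [ev_eq_pairing] at h2
    have h3 : kernelFun z (z : EuclideanSpace ℂ (Fin n)) = ((defect z ^ (n + 1))⁻¹ : ℝ) := by
      rw [kernelFun, inner_self_coe, defect]; push_cast; rfl
    rw [← h3, ← h2, pairing]
    have h4 := L2.inner_def (𝕜 := ℂ) (kernel n 2 z : Lp ℂ 2 (ballMeasure n)) (kernel n 2 z)
    rw [inner_self_eq_norm_sq_to_K] at h4
    push_cast
    exact h4
  have h2 : kernelNorm z ^ 2 = (defect z ^ (n + 1))⁻¹ := by exact_mod_cast h1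
  have h0 : 0 ≤ kernelNorm z := norm_nonneg _
  rw [← Real.sqrt_sq h0, h2, Real.sqrt_eq_rpow, ← Real.rpow_natCast,
    ← Real.rpow_neg (defect_pos z).le, ← Real.rpow_mul (defect_pos z).le]
  congr 1
  push_cast; ring

end BergmanBall

namespace BergmanBall

/-! ### Completeness of the Bergman space -/

section Complete

variable {n : ℕ}

local notation "𝔼" => EuclideanSpace ℂ (Fin n)

lemma one_sub_norm_le_norm_one_sub_inner (z : CBall n) {w : 𝔼} (hw : ‖w‖ < 1) :
    1 - ‖w‖ ≤ ‖1 - inner ℂ (z : 𝔼) w‖ := by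
  have := le_norm_one_sub_inner (⟨w, mem_ball_zero_iff.2 hw⟩ : CBall n) z.2
  rwa [norm_one_sub_inner_comm] at this

lemma hasFDerivAt_kernelFun (z : CBall n) {w : 𝔼} (hw : ‖w‖ < 1) :
    HasFDerivAt (kernelFun z) (((n + 1 : ℂ) * ((1 - inner ℂ (z : 𝔼) w) ^ (n + 2))⁻¹) •
      innerSL ℂ (z : 𝔼)) w := by
  have ha := one_sub_inner_ne_zero z (mem_ball_zero_iff.2 hw)
  have h1 : HasFDerivAt (fun w : 𝔼 => 1 - inner ℂ (z : 𝔼) w) (-innerSL ℂ (z : 𝔼)) w := by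
    have := (innerSL ℂ (z : 𝔼)).hasFDerivAt (x := w)
    exact this.const_sub 1
  have h2 : HasDerivAt (fun x : ℂ => (x ^ (n + 1))⁻¹)
      (-((n + 1 : ℂ) * ((1 - inner ℂ (z : 𝔼) w) ^ (n + 2))⁻¹)) (1 - inner ℂ (z : 𝔼) w) := by
    refine ((hasDerivAt_pow (n + 1) (1 - inner ℂ (z : 𝔼) w)).inv (pow_ne_zero _ ha)).congr_deriv ?_
    push_cast
    field_simp
    ring
  refine (h2.comp_hasFDerivAt w h1).congr_fderiv ?_
  ext1 h
  simp

/-- The integral of a function against the Bergman kernel is holomorphic. -/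
lemma differentiableOn_integral_kernelFun {f : CBall n → ℂ} (hf : Integrable f (ballMeasure n)) :
    DifferentiableOn ℂ (fun w : 𝔼 => ∫ z, f z * kernelFun z w ∂(ballMeasure n))
      (Metric.ball 0 1) := by
  intro w₀ hw₀
  have hw1 : ‖w₀‖ < 1 := mem_ball_zero_iff.1 hw₀
  obtain ⟨r, hr1, hr2⟩ := exists_between hw1
  have hr0 : 0 < 1 - r := by linarith
  have hmeas : ∀ w : 𝔼, ‖w‖ < 1 → Continuous fun z : CBall n => kernelFun z w := fun w hw => by
    unfold kernelFun
    refine Continuous.inv₀ (by fun_prop) fun z => pow_ne_zero _ ?_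
    exact one_sub_inner_ne_zero z (mem_ball_zero_iff.2 hw)
  have hmeas' : Continuous fun z : CBall n =>
      ((n + 1 : ℂ) * ((1 - inner ℂ (z : 𝔼) w₀) ^ (n + 2))⁻¹) • innerSL ℂ (z : 𝔼) := by
    have h0 : Continuous fun z : CBall n => ((1 - inner ℂ (z : 𝔼) w₀) ^ (n + 2))⁻¹ :=
      Continuous.inv₀ (by fun_prop) fun z => pow_ne_zero _ (one_sub_inner_ne_zero z hw₀)
    have h1 : Continuous fun z : CBall n => innerSL ℂ (z : 𝔼) :=
      (innerSL ℂ).continuous.comp continuous_subtype_val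
    exact (continuous_const.mul h0).smul h1
  have hbd : ∀ z : CBall n, ∀ w : 𝔼, ‖w‖ < r → ∀ m : ℕ,
      ‖((1 - inner ℂ (z : 𝔼) w) ^ m)⁻¹‖ ≤ ((1 - r) ^ m)⁻¹ := fun z w hw m => by
    have := one_sub_norm_le_norm_one_sub_inner z (hw.trans hr2)
    rw [norm_inv, norm_pow]
    gcongr
    linarith
  have hd := hasFDerivAt_integral_of_dominated_of_fderiv_le (𝕜 := ℂ) (μ := ballMeasure n)
    (F := fun w z => f z * kernelFun z w) (x₀ := w₀) (s := Metric.ball 0 r)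
    (F' := fun w z => f z • (((n + 1 : ℂ) * ((1 - inner ℂ (z : 𝔼) w) ^ (n + 2))⁻¹) •
      innerSL ℂ (z : 𝔼)))
    (bound := fun z => ‖f z‖ * ((n + 1) * ((1 - r) ^ (n + 2))⁻¹))
    (Metric.isOpen_ball.mem_nhds (mem_ball_zero_iff.2 hr1)) ?_ ?_ ?_ ?_ ?_ ?_
  · exact hd.differentiableAt.differentiableWithinAt
  · filter_upwards [Metric.isOpen_ball.mem_nhds hw₀] with w hw
    exact hf.aestronglyMeasurable.mul (hmeas w (mem_ball_zero_iff.1 hw)).aestronglyMeasurable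
  · exact hf.mul_bdd (c := ((1 - r) ^ (n + 1))⁻¹) (hmeas w₀ hw1).aestronglyMeasurable
      (Eventually.of_forall fun z => hbd z w₀ hr1 _)
  · exact hf.aestronglyMeasurable.smul hmeas'.aestronglyMeasurable
  · refine Eventually.of_forall fun z w hw => ?_
    rw [norm_smul, norm_smul, norm_mul, innerSL_apply_norm]
    have h1 := hbd z w (mem_ball_zero_iff.1 hw) (n + 2)
    have h2 : ‖(n + 1 : ℂ)‖ = n + 1 := by
      rw [← Nat.cast_succ, Complex.norm_natCast]; push_cast; rfl
    have h3 := (norm_lt_one z).le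
    rw [h2]
    calc _ ≤ ‖f z‖ * ((n + 1) * ((1 - r) ^ (n + 2))⁻¹ * 1) := by gcongr
      _ = _ := by ring
  · exact hf.norm.mul_const _
  · refine Eventually.of_forall fun z w hw => ?_
    exact (hasFDerivAt_kernelFun z ((mem_ball_zero_iff.1 hw).trans hr2)).const_mul (f z)

variable {p p' : ℝ≥0∞} [Fact (1 ≤ p)] [Fact (1 ≤ p')]

/-- The candidate representative of an L^p limit f is the integral of f against the Bergman kernel,
which is holomorphic. It equals f almost everywhere: along a subsequence the functions converge
a.e., while their values, being given by a continuous functional, converge to this integral.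
Completeness is needed for Bochner integrals in A^p. -/
lemma isClosed_bergman (p' : ℝ≥0∞) [Fact (1 ≤ p')] [p.HolderConjugate p'] :
    IsClosed (Bergman n p : Set (Lp ℂ p (ballMeasure n))) := by
  refine isClosed_of_closure_subset fun f hf => ?_
  obtain ⟨u, hu, hlim⟩ := mem_closure_iff_seq_limit.1 hf
  have hfi : Integrable f (ballMeasure n) := (Lp.memLp f).integrable Fact.out
  refine ⟨_, differentiableOn_integral_kernelFun hfi, ?_⟩
  obtain ⟨ns, hns, hae⟩ := (tendstoInMeasure_of_tendsto_Lp hlim).exists_seq_tendsto_ae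
  have hu' : ∀ᵐ w ∂(ballMeasure n), ∀ m, u m w = ev p p' w ⟨u m, hu m⟩ :=
    ae_all_iff.2 fun m => coe_ae_eq_ev (p' := p') (⟨u m, hu m⟩ : Bergman n p)
  filter_upwards [hae, hu'] with w hw1 hw2
  refine tendsto_nhds_unique hw1 ?_
  simp_rw [hw2]
  set L := (ContinuousLinearMap.lpPairing (ballMeasure n) p p' (ContinuousLinearMap.mul ℂ ℂ)).flip
    (BoundedContinuousFunction.toLp p' (ballMeasure n) ℂ (star (bddKernel w))) with hL
  have h1 : L f = ∫ z, f z * kernelFun z (w : 𝔼) ∂(ballMeasure n) := by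
    rw [hL, ContinuousLinearMap.flip_apply, ContinuousLinearMap.lpPairing_eq_integral]
    refine integral_congr_ae ?_
    filter_upwards [BoundedContinuousFunction.coeFn_toLp p' (ballMeasure n) ℂ
      (star (bddKernel w))] with z h1
    rw [h1]
    change f z * conj (kernelFun w (z : 𝔼)) = _
    rw [kernelFun, kernelFun, map_inv₀, map_pow, map_sub, map_one, inner_conj_symm]
  rw [← h1]
  exact (L.continuous.tendsto f).comp (hlim.comp hns.tendsto_atTop)

end Complete

/-! ### Bergman projection as a Bochner integral, and kernels of operators -/

section Integral

variable {n : ℕ}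

lemma isCompact_core {σ : ℝ} (hσ : 0 < σ) : IsCompact {z : CBall n | σ ≤ defect z} := by
  rw [Topology.IsEmbedding.subtypeVal.isCompact_iff]
  have h : Subtype.val '' {z : CBall n | σ ≤ defect z}
      = {x : EuclideanSpace ℂ (Fin n) | σ ≤ 1 - ‖x‖ ^ 2} := by
    ext x
    constructor
    · rintro ⟨z, hz, rfl⟩; exact hz
    · intro hx
      have hx' : σ ≤ 1 - ‖x‖ ^ 2 := hx
      have hx1 : ‖x‖ < 1 := by nlinarith [norm_nonneg x]
      exact ⟨⟨x, mem_ball_zero_iff.2 hx1⟩, hx, rfl⟩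
  rw [h]
  refine Metric.isCompact_of_isClosed_isBounded (isClosed_le (by fun_prop) (by fun_prop)) ?_
  refine (Metric.isBounded_ball (x := 0) (r := 1)).subset fun x hx => ?_
  have hx' : σ ≤ 1 - ‖x‖ ^ 2 := hx
  rw [mem_ball_zero_iff]
  nlinarith [norm_nonneg x]

/-- Bounded measurable functions that vanish near the sphere. -/
structure CoreSupported (φ : CBall n → ℂ) : Prop where
  measurable : Measurable φ
  bounded : ∃ C : ℝ, ∀ z, ‖φ z‖ ≤ C
  support : ∃ σ : ℝ, 0 < σ ∧ ∀ z, φ z ≠ 0 → σ ≤ defect z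

lemma CoreSupported.indicator {φ : CBall n → ℂ} (h : CoreSupported φ) {S : Set (CBall n)}
    (hS : MeasurableSet S) : CoreSupported (S.indicator φ) := by
  obtain ⟨C, hC⟩ := h.bounded
  obtain ⟨σ, hσ, hs⟩ := h.support
  refine ⟨h.measurable.indicator hS, ⟨C, fun z => (norm_indicator_le_norm_self _ _).trans (hC z)⟩,
    σ, hσ, fun z hz => hs z fun h0 => hz ?_⟩
  by_cases hzS : z ∈ S
  · rw [Set.indicator_of_mem hzS, h0]
  · rw [Set.indicator_of_notMem hzS]

lemma coreSupported_of_continuous {f : CBall n → ℂ} (hf : Continuous f) {σ : ℝ} (hσ : 0 < σ) :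
    CoreSupported ({z | σ ≤ defect z}.indicator f) := by
  have hm : MeasurableSet {z : CBall n | σ ≤ defect z} :=
    (isClosed_le continuous_const continuous_defect).measurableSet
  obtain ⟨C, hC⟩ := (isCompact_core (n := n) hσ).exists_bound_of_continuousOn hf.continuousOn
  refine ⟨hf.measurable.indicator hm, ⟨max C 0, fun z => ?_⟩, σ, hσ, fun z hz => ?_⟩
  · by_cases hz : z ∈ {z : CBall n | σ ≤ defect z}
    · rw [Set.indicator_of_mem hz]; exact (hC z hz).trans (le_max_left _ _)
    · rw [Set.indicator_of_notMem hz]; simp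
  · by_contra h
    exact hz (Set.indicator_of_notMem (s := {z : CBall n | σ ≤ defect z}) h f)

variable {p p' : ℝ≥0∞} [Fact (1 ≤ p)] [Fact (1 ≤ p')] [p.HolderConjugate p']

/-- The Bergman projection `∫ φ(z) K_z dv(z)`, as a Bochner integral in `A^p`. -/
noncomputable def bergmanIntegral (p : ℝ≥0∞) [Fact (1 ≤ p)] (φ : CBall n → ℂ) : Bergman n p :=
  ∫ z, φ z • kernel n p z ∂(ballMeasure n)

lemma CoreSupported.integrable_smul {F : Type*} [NormedAddCommGroup F] [NormedSpace ℂ F]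
    {φ : CBall n → ℂ} (hφ : CoreSupported φ) {f : CBall n → F} (hf : Continuous f) :
    Integrable (fun z => φ z • f z) (ballMeasure n) := by
  obtain ⟨C, hC⟩ := hφ.bounded
  obtain ⟨σ, hσ, hs⟩ := hφ.support
  obtain ⟨M, hM⟩ := (isCompact_core (n := n) hσ).exists_bound_of_continuousOn hf.continuousOn
  refine Integrable.of_bound
    (hφ.measurable.aestronglyMeasurable.smul hf.aestronglyMeasurable) (C * max M 0)
    (Eventually.of_forall fun z => ?_)
  rw [norm_smul]
  have hC0 : 0 ≤ C := (norm_nonneg _).trans (hC z)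
  by_cases hz : φ z = 0
  · rw [hz, norm_zero, zero_mul]; positivity
  · gcongr
    · exact hC z
    · exact (hM z (hs z hz)).trans (le_max_left _ _)

/-- The integral kernel `⟨A K_z, K_w⟩` of an operator. -/
noncomputable def opKernel (p' : ℝ≥0∞) [Fact (1 ≤ p')] [p.HolderConjugate p']
    (A : Bergman n p →L[ℂ] Bergman n p) (z w : CBall n) : ℂ :=
  ev p p' w (A (kernel n p z))

/-- For φ vanishing near the sphere the integrand is bounded in A^p, so any bounded operator passes
under the integral. Thus every A acts on such φ through its kernel ⟨AK_z, K_w⟩. -/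
lemma ev_apply_bergmanIntegral [CompleteSpace (Bergman n p)] (A : Bergman n p →L[ℂ] Bergman n p)
    {φ : CBall n → ℂ} (hφ : CoreSupported φ) (w : CBall n) :
    ev p p' w (A (bergmanIntegral p φ)) = ∫ z, φ z * opKernel p' A z w ∂(ballMeasure n) := by
  have h := ((ev p p' w).comp A).integral_comp_comm (hφ.integrable_smul (continuous_kernel p))
  simp only [ContinuousLinearMap.comp_apply, map_smul, smul_eq_mul] at h
  exact h.symm

lemma enorm_ev_apply_bergmanIntegral_le [CompleteSpace (Bergman n p)]
    (A : Bergman n p →L[ℂ] Bergman n p) {φ : CBall n → ℂ} (hφ : CoreSupported φ) (w : CBall n) :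
    ‖ev p p' w (A (bergmanIntegral p φ))‖ₑ
      ≤ ∫⁻ z, ‖opKernel p' A z w‖ₑ * ‖φ z‖ₑ ∂(ballMeasure n) := by
  rw [ev_apply_bergmanIntegral A hφ]
  refine (enorm_integral_le_lintegral_enorm _).trans_eq (lintegral_congr fun z => ?_)
  rw [enorm_mul, mul_comm]

lemma bergmanIntegral_add_compl [CompleteSpace (Bergman n p)]
    {φ : CBall n → ℂ} (hφ : CoreSupported φ) {S : Set (CBall n)} (hS : MeasurableSet S) :
    bergmanIntegral p φ = bergmanIntegral p (S.indicator φ) + bergmanIntegral p (Sᶜ.indicator φ) := by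
  unfold bergmanIntegral
  rw [← integral_add ((hφ.indicator hS).integrable_smul (continuous_kernel p))
    ((hφ.indicator hS.compl).integrable_smul (continuous_kernel p))]
  refine integral_congr_ae (Eventually.of_forall fun z => ?_)
  simp only
  rw [← add_smul, Set.indicator_self_add_compl_apply]

/-- The `L^p` seminorm of a nonnegative function. -/
noncomputable def powNorm (n : ℕ) (P : ℝ) (g : CBall n → ℝ≥0∞) : ℝ≥0∞ :=
  (∫⁻ z, g z ^ P ∂(ballMeasure n)) ^ (1 / P)

lemma enorm_eq_powNorm (hp : p ≠ ∞) (f : Bergman n p) :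
    ‖f‖ₑ = powNorm n p.toReal fun w => ‖ev p p' w f‖ₑ := by
  have hp0 : p ≠ 0 := (zero_lt_one.trans_le (Fact.out : 1 ≤ p)).ne'
  have h1 : ‖f‖ₑ = ‖(f : Lp ℂ p (ballMeasure n))‖ₑ := rfl
  rw [h1, Lp.enorm_def, eLpNorm_congr_ae (coe_ae_eq_ev (p' := p') f),
    eLpNorm_eq_lintegral_rpow_enorm_toReal hp0 hp, powNorm]

end Integral

end BergmanBall

namespace BergmanBall

/-! ### L^p seminorms and boundedness of the projection -/

section PowNorm

variable {n : ℕ} {P q : ℝ}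

lemma powNorm_mono (hP : 0 < P) {f g : CBall n → ℝ≥0∞} (h : ∀ z, f z ≤ g z) :
    powNorm n P f ≤ powNorm n P g := by
  unfold powNorm
  gcongr with z
  exact h z

lemma powNorm_add_le (hP : 1 ≤ P) {f g : CBall n → ℝ≥0∞} (hf : Measurable f) (hg : Measurable g) :
    powNorm n P (fun z => f z + g z) ≤ powNorm n P f + powNorm n P g :=
  ENNReal.lintegral_Lp_add_le hf.aemeasurable hg.aemeasurable hP

lemma powNorm_le_of_lintegral_le (hP : 0 < P) {f g : CBall n → ℝ≥0∞} {C : ℝ≥0∞}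
    (h : ∫⁻ z, f z ^ P ∂(ballMeasure n) ≤ C ^ P * ∫⁻ z, g z ^ P ∂(ballMeasure n)) :
    powNorm n P f ≤ C * powNorm n P g := by
  unfold powNorm
  calc _ ≤ (C ^ P * ∫⁻ z, g z ^ P ∂(ballMeasure n)) ^ (1 / P) := by gcongr
    _ = _ := by
        rw [ENNReal.mul_rpow_of_nonneg _ _ (by positivity), ← ENNReal.rpow_mul,
          mul_one_div_cancel hP.ne', ENNReal.rpow_one]

lemma powNorm_rpow (hP : 0 < P) (f : CBall n → ℝ≥0∞) :
    powNorm n P f ^ P = ∫⁻ z, f z ^ P ∂(ballMeasure n) := by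
  rw [powNorm, ← ENNReal.rpow_mul, one_div_mul_cancel hP.ne', ENNReal.rpow_one]

/-- The Schur test on the ball, with a power of the defect as test function. -/
lemma powNorm_schur (hPq : P.HolderConjugate q) {k : CBall n → CBall n → ℝ≥0∞}
    (hk : Measurable (Function.uncurry k)) {a : ℝ} {C : ℝ≥0∞}
    (h1 : ∀ w, ∫⁻ z, k w z * ENNReal.ofReal (defect z ^ (-(a / P))) ∂(ballMeasure n)
      ≤ C * ENNReal.ofReal (defect w ^ (-(a / P))))
    (h2 : ∀ z, ∫⁻ w, k w z * ENNReal.ofReal (defect w ^ (-(a / q))) ∂(ballMeasure n)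
      ≤ C * ENNReal.ofReal (defect z ^ (-(a / q))))
    {φ : CBall n → ℝ≥0∞} (hφ : Measurable φ) :
    powNorm n P (fun w => ∫⁻ z, k w z * φ z ∂(ballMeasure n)) ≤ C * powNorm n P φ := by
  have hP := hPq.pos
  have hq := hPq.symm.pos
  have e : ∀ (z : CBall n) (b c : ℝ), 0 ≤ c →
      ENNReal.ofReal (defect z ^ b) ^ c = ENNReal.ofReal (defect z ^ (b * c)) := fun z b c hc => by
    rw [ENNReal.ofReal_rpow_of_nonneg (Real.rpow_nonneg (defect_pos z).le _) hc,
      ← Real.rpow_mul (defect_pos z).le]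
  -- The test function is the defect to the power -a/(Pq): its q-th and P-th powers are the two
  -- weights in `h1` and `h2`.
  have e1 : -(a / (P * q)) * q = -(a / P) := by field_simp
  have e2 : -(a / (P * q)) * P = -(a / q) := by field_simp
  refine powNorm_le_of_lintegral_le hP (lintegral_schur hPq hk
    (g := fun z => ENNReal.ofReal (defect z ^ (-(a / (P * q))))) ?_ ?_ ?_ ?_ ?_ hφ)
  · exact (continuous_defect.measurable.pow_const _).ennreal_ofReal
  · exact fun z => (ENNReal.ofReal_pos.2 (Real.rpow_pos_of_pos (defect_pos z) _)).ne'
  · exact fun z => ENNReal.ofReal_ne_top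
  · intro w; simp only [e _ _ _ hq.le, e1]; exact h1 w
  · intro w; simp only [e _ _ _ hP.le, e2]; exact h2 w

lemma enorm_kernelFun (z w : CBall n) : ‖kernelFun z (w : EuclideanSpace ℂ (Fin n))‖ₑ
    = ENNReal.ofReal (korSq z w ^ (n + 1))⁻¹ := by
  rw [← ofReal_norm, kernelFun, norm_inv, norm_pow, korSq]

lemma continuous_kernelFun_swap : Continuous fun x : CBall n × CBall n =>
    kernelFun x.2 (x.1 : EuclideanSpace ℂ (Fin n)) := by
  unfold kernelFun
  exact Continuous.inv₀ (by fun_prop) fun x => pow_ne_zero _ (one_sub_inner_ne_zero x.2 x.1.2)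

lemma continuous_kernelFun_left (w : CBall n) : Continuous fun z : CBall n =>
    kernelFun z (w : EuclideanSpace ℂ (Fin n)) := by
  unfold kernelFun
  exact Continuous.inv₀ (by fun_prop) fun z => pow_ne_zero _ (one_sub_inner_ne_zero z w.2)

/-- The Bergman projection is bounded on `L^p`. -/
lemma exists_bergman_bound (n : ℕ) (hPq : P.HolderConjugate q) : ∃ C : ℝ≥0∞, C ≠ ∞ ∧
    ∀ φ : CBall n → ℝ≥0∞, Measurable φ →
      powNorm n P (fun w => ∫⁻ z, ‖kernelFun z (w : EuclideanSpace ℂ (Fin n))‖ₑ * φ z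
        ∂(ballMeasure n)) ≤ C * powNorm n P φ := by
  -- Taking a = 1 in the Schur test gives the weights 1/P and 1/q, both admissible Forelli–Rudin
  -- exponents.
  obtain ⟨C₁, hC₁, h₁⟩ := exists_forelliRudin n (a := 1 / P) (one_div_pos.2 hPq.pos)
    ((div_lt_one hPq.pos).2 hPq.lt)
  obtain ⟨C₂, hC₂, h₂⟩ := exists_forelliRudin n (a := 1 / q) (one_div_pos.2 hPq.symm.pos)
    ((div_lt_one hPq.symm.pos).2 hPq.symm.lt)
  have hpos : ∀ z w : CBall n, 0 ≤ (korSq z w ^ (n + 1))⁻¹ := fun z w => by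
    have := korSq_pos z w; positivity
  refine ⟨C₁ + C₂, ENNReal.add_ne_top.2 ⟨hC₁, hC₂⟩, fun φ hφ => ?_⟩
  have hm : Measurable (Function.uncurry fun w z : CBall n =>
      ‖kernelFun z (w : EuclideanSpace ℂ (Fin n))‖ₑ) :=
    (continuous_kernelFun_swap (n := n)).measurable.enorm
  refine powNorm_schur hPq (a := 1) hm (fun w => ?_) (fun z => ?_) hφ
  · have h : ∀ z, ‖kernelFun z (w : EuclideanSpace ℂ (Fin n))‖ₑ *
        ENNReal.ofReal (defect z ^ (-(1 / P)))
        = ENNReal.ofReal ((korSq w z ^ (n + 1))⁻¹ * defect z ^ (-(1 / P))) := fun z => by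
      rw [enorm_kernelFun, korSq_comm, ENNReal.ofReal_mul (hpos _ _)]
    simp_rw [h]
    exact (h₁ w).trans (by gcongr; exact le_self_add)
  · have h : ∀ w : CBall n, ‖kernelFun z (w : EuclideanSpace ℂ (Fin n))‖ₑ *
        ENNReal.ofReal (defect w ^ (-(1 / q)))
        = ENNReal.ofReal ((korSq z w ^ (n + 1))⁻¹ * defect w ^ (-(1 / q))) := fun w => by
      rw [enorm_kernelFun, ENNReal.ofReal_mul (hpos _ _)]
    simp_rw [h]
    exact (h₂ z).trans (by gcongr; exact le_add_self)

end PowNorm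

/-! ### Truncation away from the sphere gives compact operators -/

section Truncation

variable {n : ℕ} {p p' : ℝ≥0∞} [Fact (1 ≤ p)] [Fact (1 ≤ p')] [p.HolderConjugate p']

/-- The bound of `exists_bergman_bound`, as a property of a constant. -/
def IsBergmanBound (n : ℕ) (P : ℝ) (C : ℝ≥0∞) : Prop :=
  ∀ φ : CBall n → ℝ≥0∞, Measurable φ →
    powNorm n P (fun w => ∫⁻ z, ‖kernelFun z (w : EuclideanSpace ℂ (Fin n))‖ₑ * φ z
      ∂(ballMeasure n)) ≤ C * powNorm n P φ

/-- The restriction of `f` to `{σ ≤ 1 - |z|²}`. -/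
noncomputable def core (p' : ℝ≥0∞) [Fact (1 ≤ p')] [p.HolderConjugate p'] (σ : ℝ)
    (f : Bergman n p) : CBall n → ℂ :=
  {z | σ ≤ defect z}.indicator fun z => ev p p' z f

lemma continuous_ev_apply (f : Bergman n p) : Continuous fun z : CBall n => ev p p' z f :=
  (continuous_ev (p := p) (p' := p')).clm_apply continuous_const

lemma coreSupported_core {σ : ℝ} (hσ : 0 < σ) (f : Bergman n p) : CoreSupported (core p' σ f) :=
  coreSupported_of_continuous (continuous_ev_apply f) hσ

lemma ev_bergmanIntegral [CompleteSpace (Bergman n p)] {φ : CBall n → ℂ} (hφ : CoreSupported φ)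
    (w : CBall n) : ev p p' w (bergmanIntegral p φ)
      = ∫ z, φ z * kernelFun z (w : EuclideanSpace ℂ (Fin n)) ∂(ballMeasure n) := by
  have h := ev_apply_bergmanIntegral (p' := p') (ContinuousLinearMap.id ℂ (Bergman n p)) hφ w
  simp only [opKernel, ContinuousLinearMap.id_apply, ev_kernel] at h
  exact h

lemma enorm_bergmanIntegral_le [CompleteSpace (Bergman n p)] (hp : p ≠ ∞) {C : ℝ≥0∞}
    (hC : IsBergmanBound n p.toReal C) (p' : ℝ≥0∞) [Fact (1 ≤ p')] [p.HolderConjugate p']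
    {φ : CBall n → ℂ} (hφ : CoreSupported φ) :
    ‖bergmanIntegral p φ‖ₑ ≤ C * powNorm n p.toReal fun z => ‖φ z‖ₑ := by
  have hP : 0 < p.toReal :=
    ENNReal.toReal_pos (zero_lt_one.trans_le (Fact.out : 1 ≤ p)).ne' hp
  rw [enorm_eq_powNorm (p' := p') hp]
  refine (powNorm_mono hP fun w => ?_).trans (hC _ hφ.measurable.enorm)
  rw [ev_bergmanIntegral hφ]
  refine (enorm_integral_le_lintegral_enorm _).trans_eq (lintegral_congr fun z => ?_)
  rw [enorm_mul, mul_comm]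

lemma integrable_ev_mul_kernelFun (f : Bergman n p) (w : CBall n) :
    Integrable (fun z => ev p p' z f * kernelFun z (w : EuclideanSpace ℂ (Fin n)))
      (ballMeasure n) := by
  have hf : Integrable (fun z => ev p p' z f) (ballMeasure n) :=
    ((Lp.memLp (f : Lp ℂ p (ballMeasure n))).integrable Fact.out).congr (coe_ae_eq_ev f)
  refine hf.mul_bdd (c := ((1 - ‖(w : EuclideanSpace ℂ (Fin n))‖) ^ (n + 1))⁻¹) ?_ ?_
  · exact (continuous_kernelFun_left w).aestronglyMeasurable
  · refine Eventually.of_forall fun z => ?_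
    have h1 := one_sub_norm_pos w
    have h2 := one_sub_norm_le_norm_one_sub_inner z (norm_lt_one w)
    rw [kernelFun, norm_inv, norm_pow]
    gcongr

/-- As f reproduces itself, the difference is the projection of the restriction of f to the rim. -/
lemma enorm_sub_bergmanIntegral_le [CompleteSpace (Bergman n p)] (hp : p ≠ ∞) {C : ℝ≥0∞}
    (hC : IsBergmanBound n p.toReal C) {σ : ℝ} (hσ : 0 < σ) (f : Bergman n p) :
    ‖f - bergmanIntegral p (core p' σ f)‖ₑ
      ≤ C * powNorm n p.toReal ({z | defect z < σ}.indicator fun z => ‖ev p p' z f‖ₑ) := by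
  have hP : 0 < p.toReal :=
    ENNReal.toReal_pos (zero_lt_one.trans_le (Fact.out : 1 ≤ p)).ne' hp
  have hφ := coreSupported_core (p' := p') hσ f
  have hS : MeasurableSet {z : CBall n | defect z < σ} :=
    measurableSet_lt continuous_defect.measurable measurable_const
  rw [enorm_eq_powNorm (p' := p') hp]
  refine (powNorm_mono hP fun w => ?_).trans
    (hC _ (((continuous_ev_apply f).measurable.enorm).indicator hS))
  have hint := hφ.integrable_smul (continuous_kernelFun_left w)
  simp only [smul_eq_mul] at hint
  have h1 : ev p p' w f
      = ∫ z, ev p p' z f * kernelFun z (w : EuclideanSpace ℂ (Fin n)) ∂(ballMeasure n) := by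
    rw [ev_eq_integral]
    refine integral_congr_ae ?_
    filter_upwards [coe_ae_eq_ev (p' := p') f] with z hz
    rw [hz]
  rw [map_sub, ev_bergmanIntegral hφ, h1, ← integral_sub (integrable_ev_mul_kernelFun f w) hint]
  refine (enorm_integral_le_lintegral_enorm _).trans_eq (lintegral_congr fun z => ?_)
  rw [← sub_mul, enorm_mul, mul_comm]
  congr 1
  by_cases hz : σ ≤ defect z
  · rw [core, Set.indicator_of_mem (s := {z : CBall n | σ ≤ defect z}) hz, sub_self, enorm_zero,
      Set.indicator_of_notMem (s := {z : CBall n | defect z < σ}) (not_lt.2 hz)]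
  · rw [core, Set.indicator_of_notMem (s := {z : CBall n | σ ≤ defect z}) hz, sub_zero,
      Set.indicator_of_mem (s := {z : CBall n | defect z < σ}) (not_le.1 hz)]

lemma powNorm_enorm_ev_ne_top (hp : p ≠ ∞) (f : Bergman n p) :
    powNorm n p.toReal (fun z => ‖ev p p' z f‖ₑ) ≠ ∞ := by
  rw [← enorm_eq_powNorm hp]; exact enorm_ne_top

/-- Truncations converge. -/
lemma tendsto_sub_bergmanIntegral [CompleteSpace (Bergman n p)] (hp : p ≠ ∞) {C : ℝ≥0∞}
    (hCt : C ≠ ∞) (hC : IsBergmanBound n p.toReal C) (f : Bergman n p) :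
    Tendsto (fun m : ℕ => ‖f - bergmanIntegral p (core p' (1 / ((m : ℝ) + 1)) f)‖ₑ) atTop
      (𝓝 0) := by
  have hP : 0 < p.toReal :=
    ENNReal.toReal_pos (zero_lt_one.trans_le (Fact.out : 1 ≤ p)).ne' hp
  have hS : ∀ m : ℕ, MeasurableSet {z : CBall n | defect z < 1 / ((m : ℝ) + 1)} := fun m =>
    measurableSet_lt continuous_defect.measurable measurable_const
  have hlim : Tendsto (fun m : ℕ => ∫⁻ z, ({z | defect z < 1 / ((m : ℝ) + 1)}.indicator
      fun z => ‖ev p p' z f‖ₑ) z ^ p.toReal ∂(ballMeasure n)) atTop (𝓝 0) := by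
    have h0 : ∫⁻ z : CBall n, 0 ∂(ballMeasure n) = 0 := lintegral_zero
    rw [← h0]
    refine tendsto_lintegral_of_dominated_convergence (fun z => ‖ev p p' z f‖ₑ ^ p.toReal)
      (fun m => (((continuous_ev_apply f).measurable.enorm).indicator (hS m)).pow_const _)
      (fun m => Eventually.of_forall fun z => ?_) ?_ (Eventually.of_forall fun z => ?_)
    · exact ENNReal.rpow_le_rpow (Set.indicator_le_self _ _ _) hP.le
    · rw [← powNorm_rpow hP]
      exact ENNReal.rpow_ne_top_of_nonneg hP.le (powNorm_enorm_ev_ne_top hp f)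
    · refine tendsto_const_nhds.congr' ?_
      have h1 := tendsto_one_div_add_atTop_nhds_zero_nat (𝕜 := ℝ)
      filter_upwards [h1.eventually_lt_const (defect_pos z)] with m hm
      rw [Set.indicator_of_notMem (s := {z : CBall n | defect z < 1 / ((m : ℝ) + 1)})
        (not_lt.2 hm.le), ENNReal.zero_rpow_of_pos hP]
  have hlim2 : Tendsto (fun m : ℕ => C * powNorm n p.toReal
      ({z | defect z < 1 / ((m : ℝ) + 1)}.indicator fun z => ‖ev p p' z f‖ₑ)) atTop (𝓝 0) := by
    have h2 := ENNReal.Tendsto.const_mul (a := C)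
      ((ENNReal.continuous_rpow_const (y := 1 / p.toReal)).tendsto 0 |>.comp hlim) (Or.inr hCt)
    rw [ENNReal.zero_rpow_of_pos (by positivity), mul_zero] at h2
    exact h2
  exact tendsto_of_tendsto_of_tendsto_of_le_of_le tendsto_const_nhds hlim2 (fun m => zero_le)
    fun m => enorm_sub_bergmanIntegral_le hp hC (by positivity) f

lemma continuous_smulRight {X E : Type*} [TopologicalSpace X] [NormedAddCommGroup E]
    [NormedSpace ℂ E] {ℓ : X → E →L[ℂ] ℂ} {v : X → E} (hℓ : Continuous ℓ) (hv : Continuous v) :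
    Continuous fun x => (ℓ x).smulRight (v x) :=
  ((ContinuousLinearMap.smulRightL ℂ E E).continuous.comp hℓ).clm_apply hv

lemma isCompactOperator_rankOne {E : Type*} [NormedAddCommGroup E] [NormedSpace ℂ E]
    (ℓ : E →L[ℂ] ℂ) (v : E) : IsCompactOperator (ℓ.smulRight v) :=
  (isCompactOperator_of_locallyCompactSpace_dom ℓ).continuous_comp
    (g := fun c : ℂ => c • v) (by fun_prop)

lemma isCompactOperator_integral {X E : Type*} [MeasurableSpace X] {μ : Measure X}
    [IsProbabilityMeasure μ] [NormedAddCommGroup E] [NormedSpace ℂ E] [CompleteSpace E]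
    {K : X → E →L[ℂ] E} (hK : ∀ x, IsCompactOperator (K x)) (hint : Integrable K μ) :
    IsCompactOperator (∫ x, K x ∂μ : E →L[ℂ] E) :=
  Convex.integral_mem (s := {K : E →L[ℂ] E | IsCompactOperator K})
    ((compactOperator (RingHom.id ℂ) E E).restrictScalars ℝ).convex
    isClosed_setOfPred_isCompactOperator (Eventually.of_forall hK) hint

/-- The truncations are given by compact operators. -/
lemma exists_compact_core [CompleteSpace (Bergman n p)] {σ : ℝ} (hσ : 0 < σ) :
    ∃ K : Bergman n p →L[ℂ] Bergman n p, IsCompactOperator K ∧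
      ∀ f, K f = bergmanIntegral p (core p' σ f) := by
  have hχ : CoreSupported ({z : CBall n | σ ≤ defect z}.indicator fun _ => (1 : ℂ)) :=
    coreSupported_of_continuous continuous_const hσ
  -- The truncation is an operator-norm Bochner integral of the rank-one maps f ↦ f(z) K_z, so it
  -- stays in the closed subspace of compact operators.
  have hint := hχ.integrable_smul (continuous_smulRight
    (continuous_ev (n := n) (p := p) (p' := p')) (continuous_kernel p))
  refine ⟨_, ?_, fun f => (ContinuousLinearMap.integral_apply hint f).trans ?_⟩
  · refine isCompactOperator_integral (fun z => ?_) hint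
    exact (isCompactOperator_rankOne (ev p p' z) (kernel n p z)).smul
      ({z : CBall n | σ ≤ defect z}.indicator (fun _ => (1 : ℂ)) z)
  · unfold bergmanIntegral
    refine integral_congr_ae (Eventually.of_forall fun z => ?_)
    simp only [core, smul_apply, ContinuousLinearMap.smulRight_apply, smul_smul]
    congr 1
    by_cases hz : σ ≤ defect z
    · rw [Set.indicator_of_mem (s := {z : CBall n | σ ≤ defect z}) hz,
        Set.indicator_of_mem (s := {z : CBall n | σ ≤ defect z}) hz, one_mul]
    · rw [Set.indicator_of_notMem (s := {z : CBall n | σ ≤ defect z}) hz,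
        Set.indicator_of_notMem (s := {z : CBall n | σ ≤ defect z}) hz, zero_mul]

end Truncation

end BergmanBall

namespace BergmanBall

/-! ### Normalized kernels in terms of the integral kernel -/

section Pairing

variable {n : ℕ} {p p' : ℝ≥0∞}

lemma norm_pairing_comm (f : Bergman n p) (g : Bergman n p') :
    ‖pairing f g‖ = ‖pairing g f‖ := by
  rw [← RCLike.norm_conj (pairing g f), pairing, pairing, ← integral_conj]
  simp only [map_mul, RCLike.conj_conj, mul_comm]

lemma norm_pairing_smul_left (a : ℂ) (f : Bergman n p) (g : Bergman n p') :
    ‖pairing (a • f) g‖ = ‖a‖ * ‖pairing f g‖ := by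
  rw [pairing, pairing, ← norm_mul, ← integral_const_mul]
  congr 1
  refine integral_congr_ae ?_
  filter_upwards [Lp.coeFn_smul a (f : Lp ℂ p (ballMeasure n))] with z hz
  rw [Submodule.coe_smul, hz, Pi.smul_apply, smul_eq_mul, mul_assoc]

lemma norm_pairing_smul_right (a : ℂ) (f : Bergman n p) (g : Bergman n p') :
    ‖pairing f (a • g)‖ = ‖a‖ * ‖pairing f g‖ := by
  rw [norm_pairing_comm, norm_pairing_smul_left, norm_pairing_comm]

variable [Fact (1 ≤ p)] [Fact (1 ≤ p')] [p.HolderConjugate p']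

lemma norm_pairing_normKernel (S : Bergman n p →L[ℂ] Bergman n p) (z w : CBall n) :
    ‖pairing (S (normKernel n p z)) (normKernel n p' w)‖
      = defect z ^ (((n : ℝ) + 1) / 2) * defect w ^ (((n : ℝ) + 1) / 2) * ‖opKernel p' S z w‖ := by
  have h : ∀ z : CBall n, ‖(((1 - ‖(z : EuclideanSpace ℂ (Fin n))‖ ^ 2) ^ (((n : ℝ) + 1) / 2) : ℝ)
      : ℂ)‖ = defect z ^ (((n : ℝ) + 1) / 2) := fun z => by
    rw [Complex.norm_real]
    exact Real.norm_of_nonneg (Real.rpow_nonneg (defect_pos z).le _)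
  rw [normKernel, normKernel, map_smul, norm_pairing_smul_left, norm_pairing_smul_right, h, h,
    opKernel, ev_eq_pairing, mul_assoc]

lemma norm_pairing_pNormKernel (T : Bergman n p →L[ℂ] Bergman n p) (z w : CBall n) :
    ‖opKernel p' T z w‖ = ‖pairing (T (pNormKernel n p p' z)) (pNormKernel n p' p w)‖
      * (defect z ^ (-((n + 1 : ℝ) / p'.toReal)) * defect w ^ (-((n + 1 : ℝ) / p.toReal))) := by
  have h : ∀ (z : CBall n) (Q : ℝ), ‖((kernelNorm z ^ (2 / Q) : ℝ) : ℂ)‖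
      = defect z ^ (-((n + 1 : ℝ) / Q)) := fun z Q => by
    rw [Complex.norm_real, kernelNorm_eq, ← Real.rpow_mul (defect_pos z).le,
      Real.norm_of_nonneg (Real.rpow_nonneg (defect_pos z).le _)]
    congr 1
    ring
  have h0 : ∀ (z : CBall n) (b : ℝ), defect z ^ b ≠ 0 := fun z b =>
    (Real.rpow_pos_of_pos (defect_pos z) b).ne'
  rw [pNormKernel, pNormKernel, map_smul, norm_pairing_smul_left, norm_pairing_smul_right,
    norm_inv, norm_inv, h, h, opKernel, ev_eq_pairing]
  field_simp [h0]

end Pairing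

/-! ### Weak localization as a Schur condition off the diagonal -/

section Localized

variable {n : ℕ} {p p' : ℝ≥0∞} [Fact (1 ≤ p)] [Fact (1 ≤ p')] [p.HolderConjugate p']

/-- Since ‖K_z‖ is a power of the defect, all weights combine with the density of dλ into the ratio
of defects to the power δ/Q. The localization integrals are therefore Schur conditions for dv with a
power of the defect as test function. -/
lemma localization_weight (z w : CBall n) (x : ℝ) {δ Q : ℝ} (hQ : 0 < Q) :
    (defect w ^ (n + 1))⁻¹ * (defect z ^ (((n : ℝ) + 1) / 2) * defect w ^ (((n : ℝ) + 1) / 2) * x *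
      (kernelNorm z ^ (1 - 2 * δ / (Q * (n + 1))) / kernelNorm w ^ (1 - 2 * δ / (Q * (n + 1)))))
      = defect z ^ (δ / Q) * (x * defect w ^ (-(δ / Q))) := by
  have hz := defect_pos z
  have hw := defect_pos w
  have e : ∀ a : ℝ, 0 < a → ∀ b c d : ℝ, b + c = d → a ^ b * a ^ c = a ^ d := fun a ha b c d h => by
    rw [← Real.rpow_add ha, h]
  have hn : (n : ℝ) + 1 ≠ 0 := by positivity
  rw [kernelNorm_eq, kernelNorm_eq, ← Real.rpow_mul hz.le, ← Real.rpow_mul hw.le,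
    div_eq_mul_inv (defect z ^ _), ← Real.rpow_neg hw.le, ← Real.rpow_natCast,
    ← Real.rpow_neg hw.le]
  have h1 := e _ hz (((n : ℝ) + 1) / 2) (-((n + 1 : ℝ) / 2) * (1 - 2 * δ / (Q * (n + 1)))) (δ / Q)
    (by field_simp; ring)
  have h2 := e _ hw (((n : ℝ) + 1) / 2) (-(-((n + 1 : ℝ) / 2) * (1 - 2 * δ / (Q * (n + 1)))))
    (((n : ℝ) + 1) - δ / Q) (by field_simp; ring)
  have h3 := e _ hw (-((n + 1 : ℕ) : ℝ)) (((n : ℝ) + 1) - δ / Q) (-(δ / Q))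
    (by push_cast; ring)
  rw [← h1, ← h3, ← h2]
  ring

lemma ofReal_mul_locKernel (S : Bergman n p →L[ℂ] Bergman n p) (hq : 0 < p'.toReal) (δ : ℝ)
    (z w : CBall n) :
    ENNReal.ofReal (defect w ^ (n + 1))⁻¹ * locKernel p' S δ z w
      = ENNReal.ofReal (defect z ^ (δ / p'.toReal)) *
        (‖opKernel p' S z w‖ₑ * ENNReal.ofReal (defect w ^ (-(δ / p'.toReal)))) := by
  have hz := defect_pos z
  have hw := defect_pos w
  rw [locKernel, ← ENNReal.ofReal_mul (by positivity), norm_pairing_normKernel,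
    localization_weight z w _ hq, ENNReal.ofReal_mul (by positivity),
    ENNReal.ofReal_mul (norm_nonneg _), ofReal_norm]

lemma ofReal_mul_locKernelAdj (S : Bergman n p →L[ℂ] Bergman n p) (hp : 0 < p.toReal) (δ : ℝ)
    (z w : CBall n) :
    ENNReal.ofReal (defect w ^ (n + 1))⁻¹ * locKernelAdj p' S δ z w
      = ENNReal.ofReal (defect z ^ (δ / p.toReal)) *
        (‖opKernel p' S w z‖ₑ * ENNReal.ofReal (defect w ^ (-(δ / p.toReal)))) := by
  have hz := defect_pos z
  have hw := defect_pos w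
  rw [locKernelAdj, ← ENNReal.ofReal_mul (by positivity), norm_pairing_comm,
    norm_pairing_normKernel, mul_comm (defect w ^ _) (defect z ^ _), localization_weight z w _ hp,
    ENNReal.ofReal_mul (by positivity), ENNReal.ofReal_mul (norm_nonneg _), ofReal_norm]

lemma measurableSet_near_right (c : ℝ) (z : CBall n) : MeasurableSet {w | Near c z w} := by
  have := (isClosed_near (n := n) c).measurableSet
  exact measurable_prodMk_left this

open Classical in
/-- The part of the integral kernel of `S` off a neighbourhood of the diagonal. -/
noncomputable def farKernel (p' : ℝ≥0∞) [Fact (1 ≤ p')] [p.HolderConjugate p']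
    (S : Bergman n p →L[ℂ] Bergman n p) (c : ℝ) (w z : CBall n) : ℝ≥0∞ :=
  if Near c z w then 0 else ‖opKernel p' S z w‖ₑ

lemma farKernel_of_near {S : Bergman n p →L[ℂ] Bergman n p} {c : ℝ} {z w : CBall n}
    (h : Near c z w) : farKernel p' S c w z = 0 :=
  if_pos h

lemma farKernel_of_not_near {S : Bergman n p →L[ℂ] Bergman n p} {c : ℝ} {z w : CBall n}
    (h : ¬ Near c z w) : farKernel p' S c w z = ‖opKernel p' S z w‖ₑ :=
  if_neg h

lemma continuous_opKernel (S : Bergman n p →L[ℂ] Bergman n p) :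
    Continuous fun x : CBall n × CBall n => opKernel p' S x.2 x.1 :=
  ((continuous_ev (n := n) (p := p) (p' := p')).comp continuous_fst).clm_apply
    (S.continuous.comp ((continuous_kernel (n := n) p).comp continuous_snd))

lemma measurable_opKernel (S : Bergman n p →L[ℂ] Bergman n p) :
    Measurable fun x : CBall n × CBall n => ‖opKernel p' S x.2 x.1‖ₑ :=
  (continuous_opKernel (p' := p') S).measurable.enorm

lemma measurableSet_near_swap (n : ℕ) (c : ℝ) :
    MeasurableSet {x : CBall n × CBall n | Near c x.2 x.1} := by
  have h := (isClosed_near (n := n) c).measurableSet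
  exact measurable_swap h

lemma measurable_farKernel (S : Bergman n p →L[ℂ] Bergman n p) (c : ℝ) :
    Measurable (Function.uncurry (farKernel p' S c)) :=
  Measurable.ite (measurableSet_near_swap n c) measurable_const (measurable_opKernel S)

/-- Passing from the invariant measure to weights. -/
lemma lintegral_weight_le {L k : CBall n → ℝ≥0∞} {z : CBall n} {b : ℝ} {r : ℝ} {ε : ℝ≥0∞}
    (hL : ∫⁻ w in (hypBall z r)ᶜ, L w ∂(invMeasure n) ≤ ε)
    (hk : ∀ w, ¬ Near (Real.exp (2 * r)) z w → ENNReal.ofReal (defect w ^ (n + 1))⁻¹ * L w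
      = ENNReal.ofReal (defect z ^ b) * (k w * ENNReal.ofReal (defect w ^ (-b))))
    (hkm : Measurable k) (hk0 : ∀ w, Near (Real.exp (2 * r)) z w → k w = 0) :
    ∫⁻ w, k w * ENNReal.ofReal (defect w ^ (-b)) ∂(ballMeasure n)
      ≤ ε * ENNReal.ofReal (defect z ^ (-b)) := by
  -- The complement of a closed set, hence measurable, and contained in the complement of the
  -- hyperbolic ball.
  set A : Set (CBall n) := {w | Near (Real.exp (2 * r)) z w}ᶜ with hA
  have hAm : MeasurableSet A := (measurableSet_near_right _ z).compl
  have hsub : A ⊆ (hypBall z r)ᶜ := Set.compl_subset_compl.2 fun w hw => near_of_mem_hypBall hw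
  have hm : Measurable fun w : CBall n => ENNReal.ofReal (defect w ^ (n + 1))⁻¹ :=
    ((continuous_defect.measurable.pow_const _).inv).ennreal_ofReal
  have hwm : Measurable fun w : CBall n => k w * ENNReal.ofReal (defect w ^ (-b)) :=
    hkm.mul (continuous_defect.measurable.pow_const _).ennreal_ofReal
  have h1 : ∫⁻ w in A, ENNReal.ofReal (defect w ^ (n + 1))⁻¹ * L w ∂(ballMeasure n) ≤ ε := by
    -- No measurability of L is assumed; finiteness of the density is enough to unfold the invariant
    -- measure.
    refine le_trans (le_of_eq ?_) ((lintegral_mono_set hsub).trans hL)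
    exact (setLIntegral_withDensity_eq_setLIntegral_mul_non_measurable _ hm L hAm
      (Eventually.of_forall fun w => ENNReal.ofReal_lt_top)).symm
  rw [setLIntegral_congr_fun hAm fun w hw => hk w hw, lintegral_const_mul _ hwm] at h1
  have h2 : ∫⁻ w, k w * ENNReal.ofReal (defect w ^ (-b)) ∂(ballMeasure n)
      = ∫⁻ w in A, k w * ENNReal.ofReal (defect w ^ (-b)) ∂(ballMeasure n) := by
    rw [← lintegral_indicator hAm]
    refine lintegral_congr fun w => ?_
    by_cases hw : w ∈ A
    · rw [Set.indicator_of_mem hw]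
    · rw [Set.indicator_of_notMem hw, hk0 w (not_not.1 hw), zero_mul]
  have hz := Real.rpow_pos_of_pos (defect_pos z) b
  have h3 : ENNReal.ofReal (defect z ^ (-b)) * ENNReal.ofReal (defect z ^ b) = 1 := by
    rw [← ENNReal.ofReal_mul (Real.rpow_nonneg (defect_pos z).le _), ← Real.rpow_add (defect_pos z),
      neg_add_cancel, Real.rpow_zero, ENNReal.ofReal_one]
  rw [h2, mul_comm ε]
  calc _ = ENNReal.ofReal (defect z ^ (-b)) * (ENNReal.ofReal (defect z ^ b) *
        ∫⁻ w in A, k w * ENNReal.ofReal (defect w ^ (-b)) ∂(ballMeasure n)) := by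
        rw [← mul_assoc, h3, one_mul]
    _ ≤ _ := by gcongr

/-- The far part of a weakly localized operator is small. -/
lemma WeaklyLocalized.exists_far_le {S : Bergman n p →L[ℂ] Bergman n p}
    (hS : WeaklyLocalized p' S) (hPq : p.toReal.HolderConjugate p'.toReal) {ε : ℝ≥0∞}
    (hε : ε ≠ 0) : ∃ c : ℝ, 1 ≤ c ∧ ∀ φ : CBall n → ℝ≥0∞, Measurable φ →
      powNorm n p.toReal (fun w => ∫⁻ z, farKernel p' S c w z * φ z ∂(ballMeasure n))
        ≤ ε * powNorm n p.toReal φ := by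
  obtain ⟨δ, -, -, hd1, hd2⟩ := hS.decay
  have hε' : (0 : ℝ≥0∞) < ε := pos_iff_ne_zero.2 hε
  obtain ⟨r, hr1, hr2, hr0⟩ := ((hd1.eventually_le_const hε').and
    ((hd2.eventually_le_const hε').and (eventually_ge_atTop (0 : ℝ)))).exists
  refine ⟨Real.exp (2 * r), Real.one_le_exp (by positivity), fun φ hφ => ?_⟩
  -- The condition on S* carries the weight δ/p and integrates over z; the one on S carries δ/p' and
  -- integrates over w. These are the two halves of the Schur test with a = δ.
  refine powNorm_schur hPq (measurable_farKernel S _) (a := δ) (fun w => ?_) (fun z => ?_) hφ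
  · have h : Measurable fun z => farKernel p' S (Real.exp (2 * r)) w z :=
      (measurable_farKernel S _).of_uncurry_left
    refine lintegral_weight_le (L := locKernelAdj p' S δ w) ((le_iSup _ w).trans hr2)
      (fun z hz => ?_) h fun z hz => farKernel_of_near hz.symm
    rw [ofReal_mul_locKernelAdj S hPq.pos, farKernel_of_not_near fun h => hz h.symm]
  · have h : Measurable fun w => farKernel p' S (Real.exp (2 * r)) w z :=
      (measurable_farKernel S _).of_uncurry_right
    refine lintegral_weight_le (L := locKernel p' S δ z) ((le_iSup _ z).trans hr1)
      (fun w hw => ?_) h fun w hw => farKernel_of_near hw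
    rw [ofReal_mul_locKernel S hPq.symm.pos, farKernel_of_not_near hw]

end Localized

/-! ### Schur test near the diagonal -/

section NearPart

variable {n : ℕ} {P q : ℝ}

/-- The exponents add up to -(n+1) because 1/p + 1/p' = 1, so the mixed weight is bounded by a
multiple of (1 - |u|²)^{-(n+1)}, which balances the volume bound for the set of points near u. -/
lemma rpow_mul_rpow_le_of_defect_le (hPq : P.HolderConjugate q) {c : ℝ} (hc : 1 ≤ c)
    {z w u : CBall n} (hz : defect u ≤ 4 * c * defect z) (hw : defect u ≤ 4 * c * defect w) :
    defect z ^ (-((n + 1 : ℝ) / q)) * defect w ^ (-((n + 1 : ℝ) / P))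
      ≤ (4 * c / defect u) ^ (n + 1) := by
  have hu := defect_pos u
  have hP := hPq.pos
  have hq := hPq.symm.pos
  have hm : 0 < defect u / (4 * c) := by positivity
  have h1 : defect u / (4 * c) ≤ defect z := by rw [div_le_iff₀ (by positivity)]; linarith
  have h2 : defect u / (4 * c) ≤ defect w := by rw [div_le_iff₀ (by positivity)]; linarith
  have e := hPq.inv_add_inv_eq_one
  calc _ ≤ (defect u / (4 * c)) ^ (-((n + 1 : ℝ) / q)) *
        (defect u / (4 * c)) ^ (-((n + 1 : ℝ) / P)) := by
        exact mul_le_mul (Real.rpow_le_rpow_of_nonpos hm h1 (neg_nonpos.2 (by positivity)))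
          (Real.rpow_le_rpow_of_nonpos hm h2 (neg_nonpos.2 (by positivity)))
          (Real.rpow_nonneg (defect_pos w).le _) (Real.rpow_nonneg hm.le _)
    _ = (defect u / (4 * c)) ^ (-((n + 1 : ℕ) : ℝ)) := by
        rw [← Real.rpow_add hm]
        congr 1
        push_cast
        linear_combination (-(n + 1 : ℝ)) * e
    _ = _ := by
        rw [Real.rpow_neg hm.le, Real.rpow_natCast, ← inv_pow, inv_div]

/-- The Schur test near the diagonal. -/
lemma exists_near_bound (n : ℕ) (hPq : P.HolderConjugate q) {c : ℝ} (hc : 1 ≤ c) :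
    ∃ K : ℝ, 0 < K ∧ ∀ (η : ℝ≥0∞) (k : CBall n → CBall n → ℝ≥0∞),
      Measurable (Function.uncurry k) → (∀ z w, ¬ Near c z w → k w z = 0) →
      (∀ z w, Near c z w → k w z ≤ η * ENNReal.ofReal
        (defect z ^ (-((n + 1 : ℝ) / q)) * defect w ^ (-((n + 1 : ℝ) / P)))) →
      ∀ φ : CBall n → ℝ≥0∞, Measurable φ →
        powNorm n P (fun w => ∫⁻ z, k w z * φ z ∂(ballMeasure n))
          ≤ η * ENNReal.ofReal K * powNorm n P φ := by
  obtain ⟨C, hC, hvol⟩ := exists_ballMeasure_korSq_lt_le n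
  -- The first factor comes from the weight, the second from the volume of {|1 - ⟨u,v⟩| < 3c(1 -
  -- |u|²)}, which contains the points near u; the powers of 1 - |u|² cancel.
  refine ⟨(4 * c) ^ (n + 1) * (C * (3 * c) ^ (n + 1)), by positivity,
    fun η k hk hk0 hkη φ hφ => ?_⟩
  have hd : ∀ u : CBall n, defect u ≤ 4 * c * defect u := fun u => by
    nlinarith [defect_pos u]
  have key : ∀ (u : CBall n) (f : CBall n → ℝ≥0∞), (∀ v, ¬ Near c u v → f v = 0) →
      (∀ v, Near c u v → f v ≤ η * ENNReal.ofReal ((4 * c / defect u) ^ (n + 1))) →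
      ∫⁻ v, f v ∂(ballMeasure n)
        ≤ η * ENNReal.ofReal ((4 * c) ^ (n + 1) * (C * (3 * c) ^ (n + 1))) := fun u f hf0 hf => by
    have hu := defect_pos u
    have hsub : {v | Near c u v} ⊆ {v | korSq u v < 3 * c * defect u} := fun v hv => by
      have h1 : korSq u v ^ 2 ≤ c * (defect u * defect v) := hv
      have h2 := hv.symm.defect_le
      have h3 := korSq_pos u v
      have h4 : korSq u v ^ 2 ≤ (2 * c * defect u) ^ 2 := by
        calc _ ≤ c * (defect u * (4 * c * defect u)) := h1.trans (by gcongr)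
          _ = _ := by ring
      have h5 := abs_le_of_sq_le_sq' h4 (by positivity)
      have h6 : 0 < c * defect u := by positivity
      change korSq u v < 3 * c * defect u
      linarith [h5.2]
    calc _ ≤ ∫⁻ v, {v | Near c u v}.indicator
          (fun _ => η * ENNReal.ofReal ((4 * c / defect u) ^ (n + 1))) v ∂(ballMeasure n) := by
          refine lintegral_mono fun v => ?_
          by_cases hv : Near c u v
          · rw [Set.indicator_of_mem (s := {v | Near c u v}) hv]; exact hf v hv
          · rw [hf0 v hv]; exact bot_le
      _ = η * ENNReal.ofReal ((4 * c / defect u) ^ (n + 1)) * ballMeasure n {v | Near c u v} :=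
          lintegral_indicator_const (measurableSet_near_right c u) _
      _ ≤ η * ENNReal.ofReal ((4 * c / defect u) ^ (n + 1)) *
          ENNReal.ofReal (C * (3 * c * defect u) ^ (n + 1)) := by
          gcongr
          exact (measure_mono hsub).trans (hvol u _ (by positivity))
      _ = _ := by
          rw [mul_assoc, ← ENNReal.ofReal_mul (by positivity)]
          congr 2
          rw [div_pow, mul_pow _ (defect u)]
          field_simp
  -- With comparable defects the constant test function is enough.
  refine powNorm_schur hPq hk (a := 0) (fun w => ?_) (fun z => ?_) hφ
  · simp only [zero_div, neg_zero, Real.rpow_zero, ENNReal.ofReal_one, mul_one]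
    refine key w _ (fun z hz => hk0 z w fun h => hz h.symm) fun z hz => (hkη z w hz.symm).trans ?_
    gcongr
    exact rpow_mul_rpow_le_of_defect_le hPq hc hz.defect_le (hd w)
  · simp only [zero_div, neg_zero, Real.rpow_zero, ENNReal.ofReal_one, mul_one]
    refine key z _ (fun w hw => hk0 z w hw) fun w hw => (hkη z w hw).trans ?_
    gcongr
    exact rpow_mul_rpow_le_of_defect_le hPq hc (hd z) hw.defect_le

end NearPart

end BergmanBall

namespace BergmanBall

/-! ### Small operators applied piecewise over a cover -/

section Covering

variable {n : ℕ} {p p' : ℝ≥0∞} [Fact (1 ≤ p)] [Fact (1 ≤ p')] [p.HolderConjugate p']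

lemma lintegral_tsum_indicator_le {P : ℝ} (hP : 0 < P) {G : ℕ → Set (CBall n)}
    (hG : ∀ i, MeasurableSet (G i)) {N : ℕ}
    (hN : ∀ (z : CBall n) (A : Finset ℕ), (∀ i ∈ A, z ∈ G i) → A.card ≤ N)
    {φ : CBall n → ℂ} (hφ : Measurable φ) :
    ∑' i, ∫⁻ z, ‖(G i).indicator φ z‖ₑ ^ P ∂(ballMeasure n)
      ≤ N * ∫⁻ z, ‖φ z‖ₑ ^ P ∂(ballMeasure n) := by
  classical
  rw [← lintegral_tsum fun i => ((hφ.indicator (hG i)).enorm.pow_const _).aemeasurable,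
    ← lintegral_const_mul _ (hφ.enorm.pow_const _)]
  refine lintegral_mono fun z => ?_
  rw [ENNReal.tsum_eq_iSup_sum]
  refine iSup_le fun A => ?_
  have h : ∀ i ∈ A, ‖(G i).indicator φ z‖ₑ ^ P ≤ if z ∈ G i then ‖φ z‖ₑ ^ P else 0 := by
    intro i _
    by_cases hz : z ∈ G i
    · rw [Set.indicator_of_mem hz, if_pos hz]
    · rw [Set.indicator_of_notMem hz, if_neg hz, enorm_zero, ENNReal.zero_rpow_of_pos hP]
  refine (Finset.sum_le_sum h).trans ?_
  rw [← Finset.sum_filter, Finset.sum_const, nsmul_eq_mul]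
  gcongr
  exact hN z _ fun i hi => (Finset.mem_filter.1 hi).2

/-- An operator applied piecewise to localizations of `φ`. -/
noncomputable def piecewiseOp (p' : ℝ≥0∞) [Fact (1 ≤ p')] [p.HolderConjugate p']
    (A : Bergman n p →L[ℂ] Bergman n p) (F G : ℕ → Set (CBall n)) (φ : CBall n → ℂ)
    (w : CBall n) : ℝ≥0∞ :=
  ∑' i, (F i).indicator (fun w => ‖ev p p' w (A (bergmanIntegral p ((G i).indicator φ)))‖ₑ) w

lemma measurable_enorm_ev (f : Bergman n p) : Measurable fun w : CBall n => ‖ev p p' w f‖ₑ :=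
  (continuous_ev_apply f).measurable.enorm

lemma measurable_piecewiseOp (A : Bergman n p →L[ℂ] Bergman n p) {F : ℕ → Set (CBall n)}
    (hF : ∀ i, MeasurableSet (F i)) (G : ℕ → Set (CBall n)) (φ : CBall n → ℂ) :
    Measurable (piecewiseOp p' A F G φ) :=
  Measurable.tsum fun i => (measurable_enorm_ev _).indicator (hF i)

lemma piecewiseOp_of_mem (A : Bergman n p →L[ℂ] Bergman n p) {F : ℕ → Set (CBall n)}
    (hd : Pairwise (Function.onFun Disjoint F)) (G : ℕ → Set (CBall n)) (φ : CBall n → ℂ)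
    {i : ℕ} {w : CBall n} (hw : w ∈ F i) :
    piecewiseOp p' A F G φ w = ‖ev p p' w (A (bergmanIntegral p ((G i).indicator φ)))‖ₑ := by
  rw [piecewiseOp, tsum_eq_single i, Set.indicator_of_mem hw]
  intro j hj
  exact Set.indicator_of_notMem (fun h => Set.disjoint_left.1 (hd hj) h hw) _

/-- On disjoint pieces p-th powers add. Each piece costs ‖A‖ C times the norm of φ on G_i, and the
overlap bounds the sum. Only the operator norm of A enters, which is why this can be used for S - T.
-/
lemma powNorm_piecewiseOp_le [CompleteSpace (Bergman n p)] (hp : p ≠ ∞) {C : ℝ≥0∞}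
    (hC : IsBergmanBound n p.toReal C) {A : Bergman n p →L[ℂ] Bergman n p} {ε : ℝ≥0∞}
    (hA : ‖A‖ₑ ≤ ε) {F G : ℕ → Set (CBall n)} (hF : ∀ i, MeasurableSet (F i))
    (hd : Pairwise (Function.onFun Disjoint F)) (hFu : ⋃ i, F i = Set.univ)
    (hG : ∀ i, MeasurableSet (G i)) {N : ℕ}
    (hN : ∀ (z : CBall n) (A : Finset ℕ), (∀ i ∈ A, z ∈ G i) → A.card ≤ N)
    {φ : CBall n → ℂ} (hφ : CoreSupported φ) :
    powNorm n p.toReal (piecewiseOp p' A F G φ)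
      ≤ ε * C * (N : ℝ≥0∞) ^ (1 / p.toReal) * powNorm n p.toReal fun z => ‖φ z‖ₑ := by
  have hP : 0 < p.toReal :=
    ENNReal.toReal_pos (zero_lt_one.trans_le (Fact.out : 1 ≤ p)).ne' hp
  have hi : ∀ i, ∫⁻ w in F i, piecewiseOp p' A F G φ w ^ p.toReal ∂(ballMeasure n)
      ≤ (ε * C) ^ p.toReal * ∫⁻ z, ‖(G i).indicator φ z‖ₑ ^ p.toReal ∂(ballMeasure n) := fun i => by
    calc _ = ∫⁻ w in F i, ‖ev p p' w (A (bergmanIntegral p ((G i).indicator φ)))‖ₑ ^ p.toReal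
          ∂(ballMeasure n) :=
          setLIntegral_congr_fun (hF i) fun w hw => by rw [piecewiseOp_of_mem A hd G φ hw]
      _ ≤ ∫⁻ w, ‖ev p p' w (A (bergmanIntegral p ((G i).indicator φ)))‖ₑ ^ p.toReal
          ∂(ballMeasure n) := setLIntegral_le_lintegral _ _
      _ = ‖A (bergmanIntegral p ((G i).indicator φ))‖ₑ ^ p.toReal := by
          rw [enorm_eq_powNorm (p' := p') hp, powNorm_rpow hP]
      _ ≤ (ε * (C * powNorm n p.toReal fun z => ‖(G i).indicator φ z‖ₑ)) ^ p.toReal := by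
          gcongr
          refine (A.le_opENorm _).trans ?_
          gcongr
          exact enorm_bergmanIntegral_le hp hC p' (hφ.indicator (hG i))
      _ = _ := by
          rw [← mul_assoc, ENNReal.mul_rpow_of_nonneg _ _ hP.le, powNorm_rpow hP]
  refine powNorm_le_of_lintegral_le hP ?_
  rw [← setLIntegral_univ, ← hFu, lintegral_iUnion hF hd]
  refine (ENNReal.tsum_le_tsum hi).trans ?_
  rw [ENNReal.tsum_mul_left, ENNReal.mul_rpow_of_nonneg (ε * C) _ hP.le, ← ENNReal.rpow_mul,
    one_div_mul_cancel hP.ne', ENNReal.rpow_one, mul_assoc]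
  gcongr
  exact lintegral_tsum_indicator_le hP hG hN hφ.measurable

end Covering

/-! ### From the local decomposition to the essential norm -/

section Main

variable {n : ℕ} {p p' : ℝ≥0∞} [Fact (1 ≤ p)] [Fact (1 ≤ p')] [p.HolderConjugate p']

open Classical in
/-- The part of the integral kernel of `T` close to the diagonal and to the sphere. -/
noncomputable def nearKernel (p' : ℝ≥0∞) [Fact (1 ≤ p')] [p.HolderConjugate p']
    (T : Bergman n p →L[ℂ] Bergman n p) (c σ : ℝ) (w z : CBall n) : ℝ≥0∞ :=
  if Near c z w ∧ defect z < σ then ‖opKernel p' T z w‖ₑ else 0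

lemma measurable_nearKernel (T : Bergman n p →L[ℂ] Bergman n p) (c σ : ℝ) :
    Measurable (Function.uncurry (nearKernel p' T c σ)) := by
  have h : MeasurableSet {x : CBall n × CBall n | defect x.2 < σ} :=
    measurableSet_lt (continuous_defect.measurable.comp measurable_snd) measurable_const
  exact Measurable.ite ((measurableSet_near_swap n c).inter h) (measurable_opKernel T)
    measurable_const

lemma measurable_lintegral_kernel_mul {k : CBall n → CBall n → ℝ≥0∞}
    (hk : Measurable (Function.uncurry k)) {φ : CBall n → ℝ≥0∞} (hφ : Measurable φ) :
    Measurable fun w => ∫⁻ z, k w z * φ z ∂(ballMeasure n) := by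
  have h : Measurable fun x : CBall n × CBall n => φ x.2 := hφ.comp measurable_snd
  exact Measurable.lintegral_prod_right' (hk.mul h)

/-- The sup over hyperbolic balls that controls the essential norm. -/
noncomputable def localSup (p' : ℝ≥0∞) (T : Bergman n p →L[ℂ] Bergman n p) (r : ℝ)
    (z : CBall n) : ℝ≥0∞ :=
  ⨆ w ∈ hypBall z r, ‖pairing (T (pNormKernel n p p' z)) (pNormKernel n p' p w)‖ₑ

lemma nearKernel_le (T : Bergman n p →L[ℂ] Bergman n p) {c σ : ℝ} {η : ℝ≥0∞}
    (hη : ∀ z, defect z < σ → localSup p' T (1 / 2 * Real.log (4 * c)) z ≤ η) {z w : CBall n}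
    (h : Near c z w) : nearKernel p' T c σ w z ≤ η * ENNReal.ofReal
      (defect z ^ (-((n + 1 : ℝ) / p'.toReal)) * defect w ^ (-((n + 1 : ℝ) / p.toReal))) := by
  unfold nearKernel
  split_ifs with hz
  · rw [← ofReal_norm, norm_pairing_pNormKernel, ENNReal.ofReal_mul (norm_nonneg _), ofReal_norm]
    gcongr
    exact (le_iSup₂ (f := fun w _ =>
      ‖pairing (T (pNormKernel n p p' z)) (pNormKernel n p' p w)‖ₑ) w
      (mem_hypBall_of_near h)).trans (hη z hz.2)
  · exact bot_le

/-- Write T = (T - S) + S, cut φ at G, and use S = T + (S - T) on the part inside G. Seen from w in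
E, the outside part involves only the far kernel of S and the inside part only the near kernel of T.
-/
lemma enorm_ev_apply_le_of_cover [CompleteSpace (Bergman n p)]
    (T S : Bergman n p →L[ℂ] Bergman n p) {c c' σ : ℝ} {E G : Set (CBall n)}
    (hG : MeasurableSet G) (hEG : ∀ w ∈ E, ∀ z, Near c z w → z ∈ G)
    (hGE : ∀ w ∈ E, ∀ z ∈ G, Near c' z w) {φ : CBall n → ℂ} (hφ : CoreSupported φ)
    (hσ : ∀ z, φ z ≠ 0 → defect z < σ) {w : CBall n} (hw : w ∈ E) :
    ‖ev p p' w (T (bergmanIntegral p φ))‖ₑ ≤ ‖ev p p' w ((T - S) (bergmanIntegral p φ))‖ₑ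
      + ∫⁻ z, farKernel p' S c w z * ‖φ z‖ₑ ∂(ballMeasure n)
      + ‖ev p p' w ((S - T) (bergmanIntegral p (G.indicator φ)))‖ₑ
      + ∫⁻ z, nearKernel p' T c' σ w z * ‖φ z‖ₑ ∂(ballMeasure n) := by
  have hsplit := bergmanIntegral_add_compl (p := p) hφ hG
  have e : ev p p' w (T (bergmanIntegral p φ)) = ev p p' w ((T - S) (bergmanIntegral p φ))
      + ev p p' w (S (bergmanIntegral p (Gᶜ.indicator φ)))
      + ev p p' w ((S - T) (bergmanIntegral p (G.indicator φ)))
      + ev p p' w (T (bergmanIntegral p (G.indicator φ))) := by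
    have h1 := congrArg (fun f => ev p p' w (S f)) hsplit
    simp only [map_add] at h1
    simp only [sub_apply, map_sub, h1]
    ring
  rw [e]
  refine (enorm_add_le _ _).trans ?_
  gcongr ?_ + ?_
  · refine (enorm_add_le _ _).trans ?_
    gcongr
    refine (enorm_add_le _ _).trans ?_
    gcongr
    refine (enorm_ev_apply_bergmanIntegral_le S (hφ.indicator hG.compl) w).trans
      (lintegral_mono fun z => ?_)
    by_cases hz : z ∈ G
    · rw [Set.indicator_of_notMem (s := Gᶜ) (not_not.2 hz), enorm_zero, mul_zero]; exact bot_le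
    · rw [Set.indicator_of_mem (Set.mem_compl hz),
        farKernel_of_not_near fun h => hz (hEG w hw z h)]
  · refine (enorm_ev_apply_bergmanIntegral_le T (hφ.indicator hG) w).trans
      (lintegral_mono fun z => ?_)
    by_cases hz : z ∈ G
    · rw [Set.indicator_of_mem hz]
      by_cases h0 : φ z = 0
      · rw [h0, enorm_zero, mul_zero]; exact bot_le
      · rw [nearKernel, if_pos ⟨hGE w hw z hz, hσ z h0⟩]
    · rw [Set.indicator_of_notMem hz, enorm_zero, mul_zero]; exact bot_le

lemma exists_norm_sub_lt_of_mem_closure {E : Type*} [NormedAddCommGroup E] [NormedSpace ℂ E]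
    {s : Set (E →L[ℂ] E)} {T : E →L[ℂ] E} (hT : T ∈ closure s) {ε : ℝ} (hε : 0 < ε) :
    ∃ S ∈ s, ‖T - S‖ < ε := by
  obtain ⟨S, hS, h⟩ := Metric.mem_closure_iff.1 hT ε hε
  exact ⟨S, hS, by rwa [← dist_eq_norm]⟩

/-- Functions supported near the sphere are mapped to small ones. -/
lemma exists_enorm_apply_le [CompleteSpace (Bergman n p)] (hp : p ≠ ∞)
    (hPq : p.toReal.HolderConjugate p'.toReal) : ∃ D : ℝ≥0∞, D ≠ ∞ ∧
    ∀ T ∈ closure {S : Bergman n p →L[ℂ] Bergman n p | WeaklyLocalized p' S},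
    ∀ ε : ℝ, 0 < ε → ∃ r K : ℝ, 0 < r ∧ 0 < K ∧ ∀ (σ : ℝ) (η : ℝ≥0∞),
      (∀ z, defect z < σ → localSup p' T r z ≤ η) →
      ∀ φ : CBall n → ℂ, CoreSupported φ → (∀ z, φ z ≠ 0 → defect z < σ) →
        ‖T (bergmanIntegral p φ)‖ₑ ≤ (D * ENNReal.ofReal ε + η * ENNReal.ofReal K) *
          powNorm n p.toReal fun z => ‖φ z‖ₑ := by
  obtain ⟨C, hCt, hC⟩ := exists_bergman_bound n hPq
  obtain ⟨N, hN⟩ := exists_cover n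
  have hP := hPq.pos
  -- The summands come from T - S applied globally, from the far kernel of S, and from S - T applied
  -- piecewise. None depends on T, ε or c.
  refine ⟨C + 1 + C * (N : ℝ≥0∞) ^ (1 / p.toReal), ?_, fun T hT ε hε => ?_⟩
  · refine ENNReal.add_ne_top.2 ⟨ENNReal.add_ne_top.2 ⟨hCt, ENNReal.one_ne_top⟩,
      ENNReal.mul_ne_top hCt (ENNReal.rpow_ne_top_of_nonneg (by positivity)
        (ENNReal.natCast_ne_top N))⟩
  obtain ⟨S, hS, hTS⟩ := exists_norm_sub_lt_of_mem_closure hT hε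
  have hTS' : ‖T - S‖ₑ ≤ ENNReal.ofReal ε := by
    rw [← ofReal_norm]
    exact ENNReal.ofReal_le_ofReal hTS.le
  have hST' : ‖S - T‖ₑ ≤ ENNReal.ofReal ε := by rwa [← enorm_neg, neg_sub]
  obtain ⟨c, hc, hfar⟩ := hS.exists_far_le hPq (ENNReal.ofReal_pos.2 hε).ne'
  obtain ⟨c', E, G, hc', hE, hG, hEu, hEG, hGE, hov⟩ := hN c hc
  obtain ⟨K, hK, hnear⟩ := exists_near_bound n hPq hc'
  refine ⟨1 / 2 * Real.log (4 * c'), K, ?_, hK, fun σ η hη φ hφ hσ => ?_⟩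
  · have := Real.log_pos (by linarith : 1 < 4 * c'); positivity
  -- The piecewise sum needs disjoint pieces; shrinking E while keeping G preserves the near-point
  -- inclusions.
  have hF : ∀ i, MeasurableSet (disjointed E i) := fun i => MeasurableSet.disjointed hE i
  have hFu : ⋃ i, disjointed E i = Set.univ := by rw [iUnion_disjointed, hEu]
  have hpt : ∀ w, ‖ev p p' w (T (bergmanIntegral p φ))‖ₑ
      ≤ ‖ev p p' w ((T - S) (bergmanIntegral p φ))‖ₑ
      + ∫⁻ z, farKernel p' S c w z * ‖φ z‖ₑ ∂(ballMeasure n)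
      + piecewiseOp p' (S - T) (disjointed E) G φ w
      + ∫⁻ z, nearKernel p' T c' σ w z * ‖φ z‖ₑ ∂(ballMeasure n) := fun w => by
    obtain ⟨i, hi⟩ := Set.mem_iUnion.1 (hFu ▸ Set.mem_univ w)
    rw [piecewiseOp_of_mem _ (disjoint_disjointed E) G φ hi]
    exact enorm_ev_apply_le_of_cover T S (hG i) (hEG i) (hGE i) hφ hσ (disjointed_subset E i hi)
  have ma := measurable_enorm_ev (p' := p') ((T - S) (bergmanIntegral p φ))
  have mb := measurable_lintegral_kernel_mul (measurable_farKernel (p' := p') S c)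
    hφ.measurable.enorm
  have mc := measurable_piecewiseOp (p' := p') (S - T) hF G φ
  have md := measurable_lintegral_kernel_mul (measurable_nearKernel (p' := p') T c' σ)
    hφ.measurable.enorm
  have h1P : 1 ≤ p.toReal := hPq.lt.le
  rw [enorm_eq_powNorm (p' := p') hp]
  refine (powNorm_mono hP hpt).trans ?_
  refine (powNorm_add_le h1P ((ma.add mb).add mc) md).trans ?_
  have ha : powNorm n p.toReal (fun w => ‖ev p p' w ((T - S) (bergmanIntegral p φ))‖ₑ)
      ≤ ENNReal.ofReal ε * (C * powNorm n p.toReal fun z => ‖φ z‖ₑ) := by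
    rw [← enorm_eq_powNorm hp]
    refine ((T - S).le_opENorm _).trans ?_
    gcongr
    exact enorm_bergmanIntegral_le hp hC p' hφ
  have hb := hfar _ hφ.measurable.enorm
  have hcc := powNorm_piecewiseOp_le (p' := p') hp hC hST' hF (disjoint_disjointed E) hFu hG hov hφ
  have hd := hnear η _ (measurable_nearKernel T c' σ)
    (fun z w h => if_neg fun h0 => h h0.1) (fun z w h => nearKernel_le T hη h) _
    hφ.measurable.enorm
  calc _ ≤ ENNReal.ofReal ε * (C * powNorm n p.toReal fun z => ‖φ z‖ₑ)
        + ENNReal.ofReal ε * (powNorm n p.toReal fun z => ‖φ z‖ₑ)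
        + ENNReal.ofReal ε * C * (N : ℝ≥0∞) ^ (1 / p.toReal) *
          (powNorm n p.toReal fun z => ‖φ z‖ₑ)
        + η * ENNReal.ofReal K * powNorm n p.toReal fun z => ‖φ z‖ₑ := by
        gcongr ?_ + ?_
        refine (powNorm_add_le h1P (ma.add mb) mc).trans ?_
        gcongr ?_ + ?_
        refine (powNorm_add_le h1P ma mb).trans ?_
        gcongr
    _ = _ := by ring

lemma essNorm_le {E : Type*} [NormedAddCommGroup E] [NormedSpace ℂ E] (T K : E →L[ℂ] E)
    (hK : IsCompactOperator K) : essNorm T ≤ ‖T - K‖ :=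
  ciInf_le (f := fun K : {K : E →L[ℂ] E // IsCompactOperator K} => ‖T - K‖)
    ⟨0, by rintro _ ⟨K, rfl⟩; exact norm_nonneg _⟩ ⟨K, hK⟩

lemma essNorm_nonneg {E : Type*} [NormedAddCommGroup E] [NormedSpace ℂ E] (T : E →L[ℂ] E) :
    0 ≤ essNorm T :=
  Real.iInf_nonneg fun _ => norm_nonneg _

/-- A bound on functions supported near the sphere bounds the essential norm. -/
lemma ofReal_essNorm_le [CompleteSpace (Bergman n p)] (hp : p ≠ ∞)
    (hPq : p.toReal.HolderConjugate p'.toReal) (T : Bergman n p →L[ℂ] Bergman n p) {σ : ℝ}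
    (hσ : 0 < σ) {M : ℝ≥0∞}
    (hM : ∀ φ : CBall n → ℂ, CoreSupported φ → (∀ z, φ z ≠ 0 → defect z < σ) →
      ‖T (bergmanIntegral p φ)‖ₑ ≤ M * powNorm n p.toReal fun z => ‖φ z‖ₑ) :
    ENNReal.ofReal (essNorm T) ≤ M := by
  obtain ⟨C, hCt, hC⟩ := exists_bergman_bound n hPq
  obtain ⟨K, hK, hKf⟩ := exists_compact_core (n := n) (p := p) (p' := p') hσ
  have hS : MeasurableSet {z : CBall n | defect z < σ} :=
    measurableSet_lt continuous_defect.measurable measurable_const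
  have hbd : ∀ f, ‖(T - T.comp K) f‖ₑ ≤ M * ‖f‖ₑ := fun f => by
    -- f need not vanish near the sphere, so `hM` is applied to its truncation at 1/(m+1) ≤ σ.
    -- Subtracting the compact part leaves the rim of the truncation and the error T(f - f_m), which
    -- tends to 0.
    have hlim := ENNReal.Tendsto.const_mul (a := ‖T‖ₑ)
      (tendsto_sub_bergmanIntegral (p' := p') hp hCt hC f) (Or.inr enorm_ne_top)
    have hlim' := hlim.add_const (M * ‖f‖ₑ)
    rw [mul_zero, zero_add] at hlim'
    refine ge_of_tendsto hlim' ?_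
    have hev := (tendsto_one_div_add_atTop_nhds_zero_nat (𝕜 := ℝ)).eventually_le_const hσ
    filter_upwards [hev] with m hm
    set s : ℝ := 1 / ((m : ℝ) + 1) with hs
    have hs0 : 0 < s := by positivity
    have hφ := coreSupported_core (p' := p') hs0 f
    have hsplit := bergmanIntegral_add_compl (p := p) hφ hS
    have hcompl : {z : CBall n | defect z < σ}ᶜ.indicator (core p' s f) = core p' σ f := by
      funext z
      by_cases hz : σ ≤ defect z
      · rw [Set.indicator_of_mem (s := {z : CBall n | defect z < σ}ᶜ) (not_lt.2 hz), core, core,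
          Set.indicator_of_mem (s := {z : CBall n | s ≤ defect z}) (hm.trans hz),
          Set.indicator_of_mem (s := {z : CBall n | σ ≤ defect z}) hz]
      · rw [Set.indicator_of_notMem (s := {z : CBall n | defect z < σ}ᶜ)
          (fun h => h (not_le.1 hz)), core,
          Set.indicator_of_notMem (s := {z : CBall n | σ ≤ defect z}) hz]
    rw [hcompl] at hsplit
    have e : (T - T.comp K) f = T (f - bergmanIntegral p (core p' s f))
        + T (bergmanIntegral p ({z : CBall n | defect z < σ}.indicator (core p' s f))) := by
      rw [sub_apply, ContinuousLinearMap.comp_apply, hKf, hsplit, map_sub,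
        map_add]
      abel
    rw [e]
    refine (enorm_add_le _ _).trans ?_
    gcongr
    · exact T.le_opENorm _
    · refine (hM _ (hφ.indicator hS) fun z hz => ?_).trans ?_
      · by_contra h
        exact hz (Set.indicator_of_notMem (s := {z : CBall n | defect z < σ}) h _)
      · rw [enorm_eq_powNorm (p' := p') hp f]
        gcongr
        refine powNorm_mono hPq.pos fun z => ?_
        exact (enorm_indicator_le_enorm_self _ _).trans (enorm_indicator_le_enorm_self _ _)
  refine (ENNReal.ofReal_le_ofReal (essNorm_le T (T.comp K) (hK.clm_comp T))).trans ?_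
  by_cases hMt : M = ∞
  · rw [hMt]; exact le_top
  refine ENNReal.ofReal_le_of_le_toReal ?_
  refine ContinuousLinearMap.opNorm_le_bound _ ENNReal.toReal_nonneg fun f => ?_
  have := ENNReal.toReal_mono (ENNReal.mul_ne_top hMt enorm_ne_top) (hbd f)
  rwa [ENNReal.toReal_mul, toReal_enorm, toReal_enorm] at this

lemma exists_defect_lt_of_eventually {Q : CBall n → Prop}
    (h : ∀ᶠ z in comap (fun z : CBall n => ‖(z : EuclideanSpace ℂ (Fin n))‖) (𝓝[<] 1), Q z) :
    ∃ σ : ℝ, 0 < σ ∧ ∀ z, defect z < σ → Q z := by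
  obtain ⟨s, hs, hsQ⟩ := mem_comap.1 h
  obtain ⟨a, ha, has⟩ := mem_nhdsLT_iff_exists_Ioo_subset.1 hs
  have ha1 : a < 1 := ha
  -- The radius a supplied by the filter may be negative, and is made nonnegative before squaring.
  have hb : max a 0 < 1 := max_lt ha1 one_pos
  have hb0 : 0 ≤ max a 0 := le_max_right _ _
  refine ⟨1 - max a 0 ^ 2, by nlinarith, fun z hz => hsQ (has ⟨?_, norm_lt_one z⟩)⟩
  have hz' : 1 - ‖(z : EuclideanSpace ℂ (Fin n))‖ ^ 2 < 1 - max a 0 ^ 2 := hz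
  refine (le_max_left a 0).trans_lt (lt_of_pow_lt_pow_left₀ 2 (norm_nonneg _) (by linarith))

lemma exists_essNorm_le_add [CompleteSpace (Bergman n p)] (hp : p ≠ ∞)
    (hPq : p.toReal.HolderConjugate p'.toReal) : ∃ D : ℝ≥0∞, D ≠ ∞ ∧
    ∀ T ∈ closure {S : Bergman n p →L[ℂ] Bergman n p | WeaklyLocalized p' S},
    ∀ ε : ℝ, 0 < ε → ∃ r K : ℝ, 0 < r ∧ 0 < K ∧
      ENNReal.ofReal (essNorm T) ≤ D * ENNReal.ofReal ε + ENNReal.ofReal K *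
        limsup (localSup p' T r)
          (comap (fun z : CBall n => ‖(z : EuclideanSpace ℂ (Fin n))‖) (𝓝[<] 1)) := by
  obtain ⟨D, hD, H⟩ := exists_enorm_apply_le hp hPq (n := n)
  refine ⟨D, hD, fun T hT ε hε => ?_⟩
  obtain ⟨r, K, hr, hK, h⟩ := H T hT ε hε
  refine ⟨r, K, hr, hK, ?_⟩
  set L := limsup (localSup p' T r)
    (comap (fun z : CBall n => ‖(z : EuclideanSpace ℂ (Fin n))‖) (𝓝[<] 1)) with hL
  have hη : ∀ η, L < η →
      ENNReal.ofReal (essNorm T) ≤ D * ENNReal.ofReal ε + ENNReal.ofReal K * η := fun η hη => by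
    obtain ⟨σ, hσ, hσQ⟩ := exists_defect_lt_of_eventually (eventually_lt_of_limsup_lt hη)
    have := ofReal_essNorm_le hp hPq T hσ (h σ η fun z hz => (hσQ z hz).le)
    rwa [mul_comm η] at this
  by_cases hLt : L = ∞
  · rw [hLt, ENNReal.mul_top (ENNReal.ofReal_pos.2 hK).ne', add_top]; exact le_top
  have hcont : Tendsto (fun η => D * ENNReal.ofReal ε + ENNReal.ofReal K * η) (𝓝[>] L)
      (𝓝 (D * ENNReal.ofReal ε + ENNReal.ofReal K * L)) :=
    ((ENNReal.Tendsto.const_mul tendsto_id (Or.inr ENNReal.ofReal_ne_top)).const_add _).mono_left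
      nhdsWithin_le_nhds
  have hne : (𝓝[>] L).NeBot := nhdsGT_neBot_of_exists_gt ⟨∞, lt_top_iff_ne_top.2 hLt⟩
  refine ge_of_tendsto hcont ?_
  filter_upwards [self_mem_nhdsWithin] with η hη'
  exact hη η hη'

end Main

end BergmanBall

open BergmanBall in
theorem theorem2p6 (n : ℕ) (hn : 1 ≤ n) (p p' : ℝ≥0∞) [Fact (1 ≤ p)]
    (hp1 : 1 < p) (hp : p < ∞) (hpp' : p⁻¹ + p'⁻¹ = 1)
    (T : Bergman n p →L[ℂ] Bergman n p)
    (hT : T ∈ closure {S : Bergman n p →L[ℂ] Bergman n p | WeaklyLocalized p' S}) :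
    ∃ r C : ℝ, 0 < r ∧ 0 < C ∧
      ENNReal.ofReal (essNorm T) ≤ ENNReal.ofReal C *
        limsup (fun z : CBall n => ⨆ w ∈ hypBall z r,
            ‖pairing (T (pNormKernel n p p' z)) (pNormKernel n p' p w)‖ₑ)
          (comap (fun z : CBall n => ‖(z : EuclideanSpace ℂ (Fin n))‖) (𝓝[<] 1)) := by
  have hconj : p.HolderConjugate p' := ENNReal.holderConjugate_iff.2 hpp'
  have : Fact (1 ≤ p') := ⟨hconj.symm.one_le⟩
  have : CompleteSpace (Bergman n p) := (isClosed_bergman p').completeSpace_coe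
  have hP1 : 1 < p.toReal := by
    have := (ENNReal.toReal_lt_toReal ENNReal.one_ne_top hp.ne).2 hp1
    rwa [ENNReal.toReal_one] at this
  have hPq : p.toReal.HolderConjugate p'.toReal := ENNReal.HolderConjugate.toReal hP1
  -- The absorption below takes ε proportional to the essential norm, so vanishing is treated apart.
  rcases (essNorm_nonneg T).eq_or_lt with h0 | h0
  · refine ⟨1, 1, one_pos, one_pos, ?_⟩
    rw [← h0, ENNReal.ofReal_zero]
    exact bot_le
  obtain ⟨D, hD, H⟩ := exists_essNorm_le_add (n := n) hp.ne hPq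
  -- This ε makes Dε at most half the essential norm, and D + 1 avoids division by zero. The other
  -- half is bounded by K times the limsup, whence the constant 2K.
  obtain ⟨r, K, hr, hK, h⟩ := H T hT (essNorm T / (2 * (D.toReal + 1))) (by positivity)
  refine ⟨r, 2 * K, hr, by positivity, ?_⟩
  have h1 : D * ENNReal.ofReal (essNorm T / (2 * (D.toReal + 1)))
      ≤ ENNReal.ofReal (essNorm T / 2) := by
    rw [← ENNReal.ofReal_toReal hD, ← ENNReal.ofReal_mul ENNReal.toReal_nonneg,
      ENNReal.toReal_ofReal ENNReal.toReal_nonneg]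
    refine ENNReal.ofReal_le_ofReal ?_
    have hd : 0 ≤ D.toReal := ENNReal.toReal_nonneg
    rw [mul_div_assoc', div_le_div_iff₀ (by positivity) (by positivity)]
    nlinarith
  set L := limsup (localSup p' T r)
    (comap (fun z : CBall n => ‖(z : EuclideanSpace ℂ (Fin n))‖) (𝓝[<] 1)) with hL
  change ENNReal.ofReal (essNorm T) ≤ ENNReal.ofReal (2 * K) * L
  have h2 : ENNReal.ofReal (essNorm T)
      = ENNReal.ofReal (essNorm T / 2) + ENNReal.ofReal (essNorm T / 2) := by
    rw [← ENNReal.ofReal_add (by positivity) (by positivity), add_halves]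
  have h3 : ENNReal.ofReal (essNorm T / 2) ≤ ENNReal.ofReal K * L := by
    refine (ENNReal.add_le_add_iff_left (a := ENNReal.ofReal (essNorm T / 2))
      ENNReal.ofReal_ne_top).1 ?_
    rw [← h2]
    exact h.trans (by gcongr)
  calc _ ≤ ENNReal.ofReal K * L + ENNReal.ofReal K * L := by rw [h2]; gcongr
    _ = _ := by
        rw [ENNReal.ofReal_mul zero_le_two, ENNReal.ofReal_ofNat]
        ring
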